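/- Let $k$ be a field, $q\in k^{\times}$ with $[2]_q=q+q^{-1}\neq 0$, and $n\ge 0$. Let $T_n=T_n(q)$ be the Temperley–Lieb algebra over $k$: generators $U_1,\dots,U_{n-1}$, relations $U_i^2=(q+q^{-1})U_i$, $U_iU_{i\pm1}U_i=U_i$, $U_iU_j=U_jU_i$ for $|i-j|\ne 1$. Let $V$ have basis $v_1,v_2$. $T_n$ acts on $V^{\otimes n}$, where $U_i$ acts on the tensor factors $i,i+1$ by $$v_1v_1\mapsto 0,\quad v_1v_2\mapsto q\,v_1v_2+v_2v_1,\quad v_2v_1\mapsto v_1v_2+q^{-1}v_2v_1,\quad v_2v_2\mapsto 0 .$$ For $s\in\mathbb Z$ let $M(s,n)\subseteq V^{\otimes n}$ be the permutation module, spanned by the words $v_{i_1}\otimes\cdots\otimes v_{i_n}$ in which the number of $1$s minus the number of $2$s is $s$. Let $\Lambda_n=\{n,n-2,\dots,0/1\}$, with heredity order the reverse of the natural order. Put $e_0=1$, $e_l=[2]_q^{-l}\,U_{n-1}U_{n-3}\cdots U_{n+1-2l}$ for $0<2l\le n$, $e_l=0$ for $2l>n$, and $J_l=T_ne_lT_n$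 (a heredity chain). For $s=n-2l\in\Lambda_n$ the standard module is $\Delta_n(s)=(T_n/J_{l+1})e_l$ and the costandard module is $\nabla_n(s)=\mathrm{Hom}_k\big(e_l(T_n/J_{l+1}),k\big)$. A $T_n$-module is *tilting* if it has a finite filtration with standard sections and a finite filtration with costandard sections. A tilting module is *full* if every indecomposable tilting module is isomorphic to a direct summand of it. Write $(M:\Delta_n(u))$ for the number of sections $\Delta_n(u)$ in a standard filtration of $M$. $T_n(s)$ denotes an indecomposable tilting module with $(T_n(s):\Delta_n(s))=1$ and $(T_n(s):\Delta_n(u))=0$ unless $u\ge s$. Then $V^{\otimes n}$ is a full tilting module for $T_n$. Moreover, for every $s\in\Lambda_n$: 1. $M(s,n)$ is tilting, and $[M(s,n)]=[\Delta_n(s)]+[\Delta_n(s+2)]+\cdots+[\Delta_n(n)]$; that is, $M(s,n)$ has a standard filtration, and in every standard filtration of it the multiplicity $(M(s,n):\Delta_n(u))$ is $1$ for $u\in\Lambda_n$ with $u\ge s$ and $0$ for the other $u\in\Lambda_n$. 2. The module $T_n(s)$ exists, is unique up to isomorphism, and occurs exactly once as a direct summand of $M(s,n)$: $M(s,n)=T\oplus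 N$ with $T\cong T_n(s)$, and $N$ has no direct summand isomorphic to $T_n(s)$. -/

import Mathlib

open scoped TensorProduct

noncomputable section

namespace TLTilting

universe u v w

/-! ## Generalities on modules over a ring -/

section Modules

variable (A : Type u) [Ring A]

/-- `X` is isomorphic to a direct summand of `M`. -/
def IsSummand (X : Type v) [AddCommGroup X] [Module A X]
    (M : Type w) [AddCommGroup M] [Module A M] : Prop :=
  ∃ P Q : Submodule A M, IsCompl P Q ∧ Nonempty (X ≃ₗ[A] P)

/-- `X` occurs exactly once as a summand of `M`: `M = P ⊕ Q` with `P ≅ X`, and `Q` has no summand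
isomorphic to `X`. -/
def OccursExactlyOnce (X : Type v) [AddCommGroup X] [Module A X]
    (M : Type w) [AddCommGroup M] [Module A M] : Prop :=
  ∃ P Q : Submodule A M, IsCompl P Q ∧ Nonempty (X ≃ₗ[A] P) ∧ ¬ IsSummand A X Q

/-- A nonzero module that is not the direct sum of two nonzero submodules. -/
def IsIndecomposable (X : Type v) [AddCommGroup X] [Module A X] : Prop :=
  Nontrivial X ∧ ∀ P Q : Submodule A X, IsCompl P Q → P = ⊥ ∨ Q = ⊥

/-- `M` has a finite filtration `0 = N₀ ≤ N₁ ≤ ⋯ ≤ N_r = M` each of whose sections is isomorphic to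
one of the modules `D i`, the module `D i` being used exactly `m i` times. -/
def HasFiltration {ι : Type} (D : ι → Type w) [∀ i, AddCommGroup (D i)] [∀ i, Module A (D i)]
    (M : Type v) [AddCommGroup M] [Module A M] (m : ι → ℕ) : Prop :=
  ∃ (r : ℕ) (N : Fin (r + 1) → Submodule A M) (lab : Fin r → ι),
    Monotone N ∧ N 0 = ⊥ ∧ N (Fin.last r) = ⊤ ∧
    (∀ j : Fin r,
      Nonempty ((N j.succ ⧸ (N j.castSucc).submoduleOf (N j.succ)) ≃ₗ[A] D (lab j))) ∧
    ∀ i, m i = Nat.card {j : Fin r // lab j = i}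

end Modules

/-! ## The Temperley–Lieb algebra -/

section Algebra

variable {k : Type u} [Field k]

/-- The defining relations of `T_n(q)`. The letter `i : Fin (n - 1)` stands for the generator
`U_{i+1}`. -/
inductive TLRel (q : kˣ) (n : ℕ) :
    FreeAlgebra k (Fin (n - 1)) → FreeAlgebra k (Fin (n - 1)) → Prop
  | sq (i : Fin (n - 1)) :
      TLRel q n (FreeAlgebra.ι k i * FreeAlgebra.ι k i)
        (((q : k) + (q : k)⁻¹) • FreeAlgebra.ι k i)
  | braid (i j : Fin (n - 1)) (h : (i : ℕ) + 1 = j ∨ (j : ℕ) + 1 = i) :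
      TLRel q n (FreeAlgebra.ι k i * FreeAlgebra.ι k j * FreeAlgebra.ι k i) (FreeAlgebra.ι k i)
  | comm (i j : Fin (n - 1)) (h : ¬ ((i : ℕ) + 1 = j ∨ (j : ℕ) + 1 = i)) :
      TLRel q n (FreeAlgebra.ι k i * FreeAlgebra.ι k j) (FreeAlgebra.ι k j * FreeAlgebra.ι k i)

/-- The Temperley–Lieb algebra `T_n(q)` over `k`. -/
def TL (q : kˣ) (n : ℕ) : Type u := RingQuot (TLRel q n)

variable (q : kˣ) (n : ℕ)

instance : Ring (TL q n) := inferInstanceAs (Ring (RingQuot (TLRel q n)))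

instance : Algebra k (TL q n) := inferInstanceAs (Algebra k (RingQuot (TLRel q n)))

/-- The quotient map from the free algebra. -/
def TL.mk : FreeAlgebra k (Fin (n - 1)) →ₐ[k] TL q n := RingQuot.mkAlgHom k (TLRel q n)

theorem TL.mk_surjective : Function.Surjective (TL.mk q n) :=
  RingQuot.mkAlgHom_surjective k (TLRel q n)

/-- The generator `U_{i+1}` of `T_n(q)`. -/
def TL.gen (i : Fin (n - 1)) : TL q n := TL.mk q n (FreeAlgebra.ι k i)

/-! ## Tensor space -/

/-- The `4 × 4` matrix `𝒰^q`, whose rows and columns are indexed by the words `11, 12, 21, 22`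
(the letters `1`, `2` being the elements `0`, `1` of `Fin 2`). -/
def localMatrix : Matrix (Fin 2 × Fin 2) (Fin 2 × Fin 2) k :=
  fun r c =>
    if r = (0, 1) ∧ c = (0, 1) then (q : k)
    else if r = (0, 1) ∧ c = (1, 0) then 1
    else if r = (1, 0) ∧ c = (0, 1) then 1
    else if r = (1, 0) ∧ c = (1, 0) then (q : k)⁻¹
    else 0

/-- The first of the two letter positions on which the generator with index `i` acts. -/
def pos₁ {n : ℕ} (i : Fin (n - 1)) : Fin n := ⟨i, by omega⟩

/-- The second of the two letter positions on which the generator with index `i` acts. -/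
def pos₂ {n : ℕ} (i : Fin (n - 1)) : Fin n := ⟨i + 1, by omega⟩

/-- The word `w` with the letters in positions `i`, `i + 1` replaced by `a`, `b`. -/
def replace {n : ℕ} (i : Fin (n - 1)) (a b : Fin 2) (w : Fin n → Fin 2) : Fin n → Fin 2 :=
  Function.update (Function.update w (pos₁ i) a) (pos₂ i) b

/-- `μ^q(U_i)` in coordinates with respect to the basis of words: the matrix `𝒰^q` acting on the
`i`-th and `(i+1)`-st tensor factors. -/
def coordGen (i : Fin (n - 1)) : Module.End k ((Fin n → Fin 2) → k) where
  toFun f w := ∑ c : Fin 2 × Fin 2,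
    localMatrix q (w (pos₁ i), w (pos₂ i)) c * f (replace i c.1 c.2 w)
  map_add' f g := by
    funext w
    simp [mul_add, Finset.sum_add_distrib]
  map_smul' r f := by
    funext w
    simp [Finset.mul_sum, mul_left_comm]

theorem fin2_cases (x : Fin 2) : x = 0 ∨ x = 1 := by omega

theorem pos_ne {n : ℕ} (i : Fin (n - 1)) : pos₁ i ≠ pos₂ i := by
  simp [pos₁, pos₂]

theorem coordGen_apply (i : Fin (n - 1)) (f : (Fin n → Fin 2) → k) (w : Fin n → Fin 2) :
    coordGen q n i f w = ∑ c : Fin 2 × Fin 2,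
      localMatrix q (w (pos₁ i), w (pos₂ i)) c * f (replace i c.1 c.2 w) := rfl

theorem replace_self {n : ℕ} (i : Fin (n - 1)) (a b : Fin 2) (w : Fin n → Fin 2)
    (h₁ : w (pos₁ i) = a) (h₂ : w (pos₂ i) = b) : replace i a b w = w := by
  subst h₁ h₂
  simp [replace]

theorem coordGen_expand (i : Fin (n - 1)) (f : (Fin n → Fin 2) → k) (w : Fin n → Fin 2) :
    coordGen q n i f w =
      if w (pos₁ i) = 0 then
        if w (pos₂ i) = 0 then 0 else q * f (replace i 0 1 w) + f (replace i 1 0 w)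
      else
        if w (pos₂ i) = 0 then f (replace i 0 1 w) + (q : k)⁻¹ * f (replace i 1 0 w) else 0 := by
  rw [coordGen_apply, Fintype.sum_prod_type]
  rcases fin2_cases (w (pos₁ i)) with h₁ | h₁ <;> rcases fin2_cases (w (pos₂ i)) with h₂ | h₂ <;>
    simp [h₁, h₂, localMatrix]

theorem coordGen_sq (i : Fin (n - 1)) :
    coordGen q n i * coordGen q n i = ((q : k) + (q : k)⁻¹) • coordGen q n i := by
  have hq : (q : k) ≠ 0 := q.ne_zero
  refine LinearMap.ext fun f => funext fun w => ?_
  have e₁ : ∀ a b, (replace i a b w) (pos₁ i) = a := fun a b => by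
    simp [replace, Function.update_of_ne (pos_ne i)]
  have e₂ : ∀ a b, (replace i a b w) (pos₂ i) = b := fun a b => by simp [replace]
  have e₃ : ∀ a b c d, replace i c d (replace i a b w) = replace i c d w := fun a b c d => by
    funext x
    by_cases h₁ : x = pos₁ i <;> by_cases h₂ : x = pos₂ i <;>
      simp [replace, Function.update_apply, h₁, h₂]
  simp only [Module.End.mul_apply, LinearMap.smul_apply, Pi.smul_apply, smul_eq_mul,
    coordGen_expand, e₁, e₂, e₃]
  rcases fin2_cases (w (pos₁ i)) with h₁ | h₁ <;> rcases fin2_cases (w (pos₂ i)) with h₂ | h₂ <;>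
    simp [h₁, h₂] <;> field_simp

theorem coordGen_comm (i j : Fin (n - 1)) (h : ¬ ((i : ℕ) + 1 = j ∨ (j : ℕ) + 1 = i)) :
    coordGen q n i * coordGen q n j = coordGen q n j * coordGen q n i := by
  by_cases hij : i = j
  · rw [hij]
  have hij' : (i : ℕ) ≠ j := fun h => hij (Fin.ext h)
  have n₁ : pos₁ i ≠ pos₁ j := by simp [pos₁]; omega
  have n₂ : pos₁ i ≠ pos₂ j := by simp [pos₁, pos₂]; omega
  have n₃ : pos₂ i ≠ pos₁ j := by simp [pos₁, pos₂]; omega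
  have n₄ : pos₂ i ≠ pos₂ j := by simp [pos₂]; omega
  refine LinearMap.ext fun f => funext fun w => ?_
  simp only [Module.End.mul_apply, coordGen_apply, Finset.mul_sum]
  rw [Finset.sum_comm]
  refine Finset.sum_congr rfl fun c _ => Finset.sum_congr rfl fun d _ => ?_
  have e : replace j c.1 c.2 (replace i d.1 d.2 w) = replace i d.1 d.2 (replace j c.1 c.2 w) := by
    simp only [replace]
    rw [Function.update_comm n₃, Function.update_comm n₁, Function.update_comm n₄,
      Function.update_comm n₂]
  have a₁ : replace i d.1 d.2 w (pos₁ j) = w (pos₁ j) := by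
    simp [replace, Function.update_of_ne n₁.symm, Function.update_of_ne n₃.symm]
  have a₂ : replace i d.1 d.2 w (pos₂ j) = w (pos₂ j) := by
    simp [replace, Function.update_of_ne n₂.symm, Function.update_of_ne n₄.symm]
  have a₃ : replace j c.1 c.2 w (pos₁ i) = w (pos₁ i) := by
    simp [replace, Function.update_of_ne n₁, Function.update_of_ne n₂]
  have a₄ : replace j c.1 c.2 w (pos₂ i) = w (pos₂ i) := by
    simp [replace, Function.update_of_ne n₃, Function.update_of_ne n₄]
  rw [e, a₁, a₂, a₃, a₄]
  ring

theorem coordGen_braid (i j : Fin (n - 1)) (h : (i : ℕ) + 1 = j ∨ (j : ℕ) + 1 = i) :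
    coordGen q n i * coordGen q n j * coordGen q n i = coordGen q n i := by
  have hq : (q : k) ≠ 0 := q.ne_zero
  refine LinearMap.ext fun f => funext fun w => ?_
  rcases h with h | h
  · have m : pos₁ j = pos₂ i := by simp [pos₁, pos₂]; omega
    have n₁ : pos₁ i ≠ pos₂ i := pos_ne i
    have n₂ : pos₁ i ≠ pos₂ j := by simp [pos₁, pos₂]; omega
    have n₃ : pos₂ i ≠ pos₂ j := by simp [pos₂]; omega
    obtain ⟨W, hW, v₁, v₂, v₃, ri, rj⟩ : ∃ W : Fin 2 → Fin 2 → Fin 2 → (Fin n → Fin 2),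
        W (w (pos₁ i)) (w (pos₂ i)) (w (pos₂ j)) = w ∧
        (∀ x y z, W x y z (pos₁ i) = x) ∧ (∀ x y z, W x y z (pos₂ i) = y) ∧
        (∀ x y z, W x y z (pos₂ j) = z) ∧
        (∀ x y z a b, replace i a b (W x y z) = W a b z) ∧
        (∀ x y z a b, replace j a b (W x y z) = W x a b) := by
      refine ⟨fun x y z => Function.update (Function.update (Function.update w
        (pos₁ i) x) (pos₂ i) y) (pos₂ j) z, by simp, ?_, ?_, ?_, ?_, ?_⟩
      · intro x y z; simp [n₁, n₂]
      · intro x y z; simp [n₃]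
      · intro x y z; simp
      · intro x y z a b
        funext t
        simp only [replace, Function.update_apply]
        grind
      · intro x y z a b
        funext t
        simp only [replace, m, Function.update_apply]
        grind
    rw [← hW]
    generalize w (pos₁ i) = x
    generalize w (pos₂ i) = y
    generalize w (pos₂ j) = z
    simp only [Module.End.mul_apply, coordGen_expand, m, v₁, v₂, v₃, ri, rj]
    rcases fin2_cases x with rfl | rfl <;> rcases fin2_cases y with rfl | rfl <;>
      rcases fin2_cases z with rfl | rfl <;> simp [hq, mul_add]
  · have m : pos₂ j = pos₁ i := by simp [pos₁, pos₂]; omega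
    have n₁ : pos₁ i ≠ pos₂ i := pos_ne i
    have n₂ : pos₁ j ≠ pos₁ i := by simp [pos₁]; omega
    have n₃ : pos₁ j ≠ pos₂ i := by simp [pos₁, pos₂]; omega
    obtain ⟨W, hW, v₁, v₂, v₃, ri, rj⟩ : ∃ W : Fin 2 → Fin 2 → Fin 2 → (Fin n → Fin 2),
        W (w (pos₁ j)) (w (pos₁ i)) (w (pos₂ i)) = w ∧
        (∀ x y z, W x y z (pos₁ j) = x) ∧ (∀ x y z, W x y z (pos₁ i) = y) ∧
        (∀ x y z, W x y z (pos₂ i) = z) ∧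
        (∀ x y z a b, replace i a b (W x y z) = W x a b) ∧
        (∀ x y z a b, replace j a b (W x y z) = W a b z) := by
      refine ⟨fun x y z => Function.update (Function.update (Function.update w
        (pos₁ j) x) (pos₁ i) y) (pos₂ i) z, by simp, ?_, ?_, ?_, ?_, ?_⟩
      · intro x y z; simp [n₂, n₃]
      · intro x y z; simp [n₁]
      · intro x y z; simp
      · intro x y z a b
        funext t
        simp only [replace, Function.update_apply]
        grind
      · intro x y z a b
        funext t
        simp only [replace, m, Function.update_apply]
        grind
    rw [← hW]
    generalize w (pos₁ j) = x
    generalize w (pos₁ i) = y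
    generalize w (pos₂ i) = z
    simp only [Module.End.mul_apply, coordGen_expand, m, v₁, v₂, v₃, ri, rj]
    rcases fin2_cases x with rfl | rfl <;> rcases fin2_cases y with rfl | rfl <;>
      rcases fin2_cases z with rfl | rfl <;> simp [hq, mul_add]

theorem coordGen_rel ⦃x y : FreeAlgebra k (Fin (n - 1))⦄ (h : TLRel q n x y) :
    FreeAlgebra.lift k (coordGen q n) x = FreeAlgebra.lift k (coordGen q n) y := by
  cases h with
  | sq i => simpa only [map_mul, map_smul, FreeAlgebra.lift_ι_apply] using coordGen_sq q n i
  | braid i j h =>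
    simpa only [map_mul, FreeAlgebra.lift_ι_apply] using coordGen_braid q n i j h
  | comm i j h =>
    simpa only [map_mul, FreeAlgebra.lift_ι_apply] using coordGen_comm q n i j h

/-- The action of `T_n(q)` in coordinates. -/
def coordRep : TL q n →ₐ[k] Module.End k ((Fin n → Fin 2) → k) :=
  RingQuot.liftAlgHom k ⟨FreeAlgebra.lift k (coordGen q n), coordGen_rel q n⟩

theorem coordRep_gen (i : Fin (n - 1)) : coordRep q n (TL.gen q n i) = coordGen q n i := by
  have h := RingQuot.liftAlgHom_mkAlgHom_apply k (FreeAlgebra.lift k (coordGen q n))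
    (coordGen_rel q n) (FreeAlgebra.ι k i)
  rw [FreeAlgebra.lift_ι_apply] at h
  exact h

/-- Tensor space `V^{⊗ n}`, where `V = k²` has the basis `v₁, v₂`. -/
def TensorSpace (_q : kˣ) (n : ℕ) : Type u := ⨂[k]^n (Fin 2 → k)

instance : AddCommGroup (TensorSpace q n) := inferInstanceAs (AddCommGroup (⨂[k]^n (Fin 2 → k)))

instance : Module k (TensorSpace q n) := inferInstanceAs (Module k (⨂[k]^n (Fin 2 → k)))

/-- The basis of `V^{⊗ n}` given by the words `v_{i₁} ⊗ ⋯ ⊗ v_{iₙ}`. -/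
def wordBasis : Module.Basis (Fin n → Fin 2) k (TensorSpace q n) :=
  Basis.piTensorProduct (R := k) (fun _ : Fin n => Pi.basisFun k (Fin 2))

/-- The tensor space representation `μ^q` of `T_n(q)`. -/
def tensorRep : TL q n →ₐ[k] Module.End k (TensorSpace q n) :=
  ((wordBasis q n).equivFun.symm.conjAlgEquiv k).toAlgHom.comp (coordRep q n)

instance : Module (TL q n) (TensorSpace q n) :=
  Module.compHom (TensorSpace q n) (tensorRep q n).toRingHom

theorem smul_def (a : TL q n) (x : TensorSpace q n) : a • x = tensorRep q n a x := rfl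

/-- The excess of `1`s over `2`s in a word. -/
def excess {n : ℕ} (w : Fin n → Fin 2) : ℤ :=
  (Finset.card {j | w j = 0} : ℤ) - (Finset.card {j | w j = 1} : ℤ)

theorem excess_eq_sum {n : ℕ} (w : Fin n → Fin 2) :
    excess w = ∑ j, if w j = 0 then (1 : ℤ) else -1 := by
  have h : ∀ j, (if w j = 0 then (1 : ℤ) else -1) =
      (if w j = 0 then 1 else 0) - (if w j = 1 then 1 else 0) := fun j => by
    rcases fin2_cases (w j) with h | h <;> simp [h]
  simp only [excess, h, Finset.sum_sub_distrib, Finset.sum_boole]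

theorem excess_replace {n : ℕ} (i : Fin (n - 1)) (a b : Fin 2) (w : Fin n → Fin 2)
    (h : (w (pos₁ i) = 0 ∧ w (pos₂ i) = 1) ∨ (w (pos₁ i) = 1 ∧ w (pos₂ i) = 0))
    (h' : (a = 0 ∧ b = 1) ∨ (a = 1 ∧ b = 0)) : excess (replace i a b w) = excess w := by
  have key : ∀ v : Fin n → Fin 2, excess v =
      ((if v (pos₁ i) = 0 then (1 : ℤ) else -1) + (if v (pos₂ i) = 0 then (1 : ℤ) else -1)) +
      ∑ j ∈ (Finset.univ.erase (pos₁ i)).erase (pos₂ i), if v j = 0 then (1 : ℤ) else -1 := by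
    intro v
    rw [excess_eq_sum, ← Finset.add_sum_erase _ _ (Finset.mem_univ (pos₁ i)), add_assoc,
      Finset.add_sum_erase _ (fun j => if v j = 0 then (1 : ℤ) else -1)
        (Finset.mem_erase.2 ⟨(pos_ne i).symm, Finset.mem_univ (pos₂ i)⟩)]
  rw [key, key w]
  congr 1
  · have e₁ : (replace i a b w) (pos₁ i) = a := by
      simp [replace, Function.update_of_ne (pos_ne i)]
    have e₂ : (replace i a b w) (pos₂ i) = b := by simp [replace]
    rw [e₁, e₂]
    rcases h with h | h <;> rcases h' with h' | h' <;> simp [h.1, h.2, h'.1, h'.2]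
  · refine Finset.sum_congr rfl fun j hj => ?_
    simp only [Finset.mem_erase, Finset.mem_univ, and_true] at hj
    simp [replace, hj.1, hj.2]

theorem coordGen_excess (s : ℤ) (i : Fin (n - 1)) (f : (Fin n → Fin 2) → k)
    (hf : ∀ w, excess w ≠ s → f w = 0) (w : Fin n → Fin 2) (hw : excess w ≠ s) :
    coordGen q n i f w = 0 := by
  rw [coordGen_expand]
  rcases fin2_cases (w (pos₁ i)) with h₁ | h₁ <;> rcases fin2_cases (w (pos₂ i)) with h₂ | h₂
  · simp [h₁, h₂]
  · rw [hf (replace i 0 1 w) (by rw [excess_replace] <;> simp [*]),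
      hf (replace i 1 0 w) (by rw [excess_replace] <;> simp [*])]
    simp
  · rw [hf (replace i 0 1 w) (by rw [excess_replace] <;> simp [*]),
      hf (replace i 1 0 w) (by rw [excess_replace] <;> simp [*])]
    simp
  · simp [h₁, h₂]

theorem repr_smul (a : TL q n) (x : TensorSpace q n) :
    (wordBasis q n).equivFun (a • x) = coordRep q n a ((wordBasis q n).equivFun x) := by
  have h : a • x = (wordBasis q n).equivFun.symm
      (coordRep q n a ((wordBasis q n).equivFun x)) := rfl
  rw [h, LinearEquiv.apply_symm_apply]

theorem coordRep_excess (s : ℤ) (a : TL q n) (f : (Fin n → Fin 2) → k)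
    (hf : ∀ w, excess w ≠ s → f w = 0) : ∀ w, excess w ≠ s → coordRep q n a f w = 0 := by
  obtain ⟨a, rfl⟩ := TL.mk_surjective q n a
  induction a using FreeAlgebra.induction generalizing f with
  | grade0 r =>
    intro w hw
    simp [hf w hw]
  | grade1 i =>
    intro w hw
    have := coordRep_gen q n i
    rw [TL.gen] at this
    rw [this]
    exact coordGen_excess q n s i f hf w hw
  | mul a b ha hb =>
    intro w hw
    rw [map_mul, map_mul, Module.End.mul_apply]
    exact ha _ (hb f hf) w hw
  | add a b ha hb =>
    intro w hw
    rw [map_add, map_add, LinearMap.add_apply, Pi.add_apply, ha f hf w hw, hb f hf w hw, add_zero]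

theorem smul_excess (s : ℤ) (a : TL q n) (x : TensorSpace q n)
    (hx : ∀ w, excess w ≠ s → (wordBasis q n).repr x w = 0) :
    ∀ w, excess w ≠ s → (wordBasis q n).repr (a • x) w = 0 := by
  intro w hw
  have h := congrFun (repr_smul q n a x) w
  rw [Module.Basis.equivFun_apply] at h
  rw [h]
  exact coordRep_excess q n s a _ (fun w hw => by simpa using hx w hw) w hw

/-- The permutation module `M(s, n)`: the summand of `V^{⊗ n}` spanned by the words in which the
excess of `1`s over `2`s is `s`. -/
def permModule (s : ℤ) : Submodule (TL q n) (TensorSpace q n) where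
  carrier := {x | ∀ w, excess w ≠ s → (wordBasis q n).repr x w = 0}
  add_mem' hx hy w hw := by simp [hx w hw, hy w hw]
  zero_mem' w _ := by simp
  smul_mem' a x hx := smul_excess q n s a x hx

/-! ## Standard and costandard modules -/

/-- The weights `Λ_n = {n, n - 2, …, 0/1}`. The heredity order is the reverse of the natural
order. -/
abbrev Weight (n : ℕ) : Type := {s : ℕ // s ≤ n ∧ s % 2 = n % 2}

/-- The number `l` with `s = n - 2 l`. -/
def Weight.cups {n : ℕ} (s : Weight n) : ℕ := (n - s.1) / 2

/-- `U_i ∈ T_n(q)` for `1 ≤ i ≤ n - 1` (and `0` for other `i`). -/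
def TL.U (i : ℕ) : TL q n :=
  if h : 1 ≤ i ∧ i < n then TL.gen q n ⟨i - 1, by omega⟩ else 0

/-- The idempotents `e₀ = 1`, `e_l = [2]^{-l} U_{n-1} U_{n-3} ⋯ U_{n+1-2l}` for `2 l ≤ n`, and
`e_l = 0` for `2 l > n`. In particular `e₁ = ε = [2]^{-1} U_{n-1}`. -/
def heredityIdem (l : ℕ) : TL q n :=
  if 2 * l ≤ n then
    (((q : k) + (q : k)⁻¹)⁻¹ ^ l) • ((List.range l).map fun j => TL.U q n (n - 1 - 2 * j)).prod
  else 0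

/-- The heredity chain `T_n = J₀ ⊇ J₁ ⊇ J₂ ⊇ ⋯`, where `J_l = T_n e_l T_n`; this two-sided ideal
is recorded as a left ideal. -/
def heredityIdeal (l : ℕ) : Submodule (TL q n) (TL q n) :=
  Submodule.span (TL q n) {y | ∃ x, y = heredityIdem q n l * x}

/-- The standard module `Δ_n(s)`, for `s = n - 2 l`: the module `(T_n / J_{l+1}) e_l`, which is
the indecomposable projective module of the layer `J_l / J_{l+1}` of the heredity chain. -/
abbrev Standard (s : Weight n) : Type u :=
  ↥(Submodule.span (TL q n)
    {(heredityIdeal q n (s.cups + 1)).mkQ (heredityIdem q n s.cups)})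

/-- The dual `D(T_n) = Hom_k(T_n, k)` of the right regular module, with the left action
`(a f)(x) = f(x a)`. -/
def DualRegular (q : kˣ) (n : ℕ) : Type u := TL q n →ₗ[k] k

instance : AddCommGroup (DualRegular q n) := inferInstanceAs (AddCommGroup (TL q n →ₗ[k] k))

instance : FunLike (DualRegular q n) (TL q n) k :=
  inferInstanceAs (FunLike (TL q n →ₗ[k] k) (TL q n) k)

instance : Module (TL q n) (DualRegular q n) where
  smul a f := LinearMap.comp (show TL q n →ₗ[k] k from f) (LinearMap.mulRight k a)
  one_smul f := LinearMap.ext fun x => congrArg (show TL q n →ₗ[k] k from f) (mul_one x)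
  mul_smul a b f := LinearMap.ext fun x =>
    congrArg (show TL q n →ₗ[k] k from f) (mul_assoc x a b).symm
  smul_zero _ := rfl
  smul_add _ _ _ := rfl
  add_smul a b f := LinearMap.ext fun x =>
    (congrArg (show TL q n →ₗ[k] k from f) (mul_add x a b)).trans
      (map_add (show TL q n →ₗ[k] k from f) _ _)
  zero_smul f := LinearMap.ext fun x =>
    (congrArg (show TL q n →ₗ[k] k from f) (mul_zero x)).trans
      (map_zero (show TL q n →ₗ[k] k from f))

theorem dual_smul_apply (a : TL q n) (f : DualRegular q n) (x : TL q n) :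
    (a • f) x = f (x * a) := rfl

theorem dual_add_apply (f g : DualRegular q n) (x : TL q n) : (f + g) x = f x + g x := rfl

theorem dual_zero_apply (x : TL q n) : (0 : DualRegular q n) x = 0 := rfl

theorem heredityIdeal_mul_mem (l : ℕ) (a x : TL q n) (hx : x ∈ heredityIdeal q n l) :
    x * a ∈ heredityIdeal q n l := by
  induction hx using Submodule.span_induction with
  | mem y hy =>
    obtain ⟨z, rfl⟩ := hy
    exact Submodule.subset_span ⟨z * a, mul_assoc _ _ _⟩
  | zero => simp
  | add y z _ _ hy hz => rw [add_mul]; exact Submodule.add_mem _ hy hz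
  | smul c y _ hy =>
    rw [smul_eq_mul, mul_assoc]
    exact Submodule.smul_mem _ c hy

/-- The dual `D(e_l (T_n / J_{l+1}))` of the right standard module, realised as the submodule of
`D(T_n)` of those `f` that vanish on `J_{l+1}` and satisfy `f(e_l x) = f(x)` for all `x`. -/
def costandardSubmodule (s : Weight n) : Submodule (TL q n) (DualRegular q n) where
  carrier := {f | (∀ x ∈ heredityIdeal q n (s.cups + 1), f x = 0) ∧
    ∀ x, f (heredityIdem q n s.cups * x) = f x}
  add_mem' hf hg := ⟨fun x hx => by rw [dual_add_apply, hf.1 x hx, hg.1 x hx, add_zero],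
    fun x => by rw [dual_add_apply, dual_add_apply, hf.2, hg.2]⟩
  zero_mem' := ⟨fun _ _ => rfl, fun _ => rfl⟩
  smul_mem' a f hf := ⟨fun x hx => by
      rw [dual_smul_apply]
      exact hf.1 _ (heredityIdeal_mul_mem q n _ a x hx),
    fun x => by rw [dual_smul_apply, dual_smul_apply, mul_assoc, hf.2]⟩

/-- The costandard module `∇_n(s)`: the indecomposable injective module of the layer
`J_l / J_{l+1}` of the heredity chain, for `s = n - 2 l`. -/
abbrev Costandard (s : Weight n) : Type u := ↥(costandardSubmodule q n s)

/-! ## Tilting modules -/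

/-- `M` has a standard filtration in which `Δ_n(u)` occurs `m u` times. -/
def HasStandardFiltration (M : Type v) [AddCommGroup M] [Module (TL q n) M]
    (m : Weight n → ℕ) : Prop :=
  HasFiltration (TL q n) (fun s : Weight n => Standard q n s) M m

/-- `M` has a costandard filtration in which `∇_n(u)` occurs `m u` times. -/
def HasCostandardFiltration (M : Type v) [AddCommGroup M] [Module (TL q n) M]
    (m : Weight n → ℕ) : Prop :=
  HasFiltration (TL q n) (fun s : Weight n => Costandard q n s) M m

/-- `M` is a tilting module: it has a standard filtration and a costandard filtration. -/
def IsTilting (M : Type v) [AddCommGroup M] [Module (TL q n) M] : Prop :=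
  (∃ m, HasStandardFiltration q n M m) ∧ ∃ m, HasCostandardFiltration q n M m

/-- `M` is a full tilting module: it is tilting, and every indecomposable tilting module is
isomorphic to a direct summand of `M`. -/
def IsFullTilting (M : Type w) [AddCommGroup M] [Module (TL q n) M] : Prop :=
  IsTilting q n M ∧
    ∀ (X : Type v) [AddCommGroup X] [Module (TL q n) X],
      IsIndecomposable (TL q n) X → IsTilting q n X → IsSummand (TL q n) X M

/-- `X` is the indecomposable tilting module `T_n(s)`: it has a standard filtration in which
`Δ_n(s)` occurs once, and in which every other standard module `Δ_n(u)` that occurs has `u` lower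
than `s` in the heredity order, that is, `s < u` as numbers. -/
def IsIndecTiltingOfWeight (s : Weight n) (X : Type v) [AddCommGroup X] [Module (TL q n) X] :
    Prop :=
  IsIndecomposable (TL q n) X ∧ IsTilting q n X ∧
    ∃ m, HasStandardFiltration q n X m ∧ m s = 1 ∧ ∀ u : Weight n, m u ≠ 0 → s.1 ≤ u.1

end Algebra

end TLTilting

end

open TLTilting

universe u v

/-!
The proof compares dimensions. Let `l` be the number of cups of the weight `s = n - 2 l`, and let
`ballot n l` be `binom n l - binom n (l - 1)`. A straightening argument with the Temperley–Lieb
relations (`IsTLFamily.exists_finset_span`) shows that `Δ(s)` and `∇(s)` have dimension at most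
`ballot n l`. For a finite-dimensional module `M` put `g s = dim Hom(M, ∇(s))` and
`h s = dim Hom(Δ(s), M)`, realised by functionals on `M` (`stdFunctionals`) and vectors of `M`
(`costdVectors`). Splitting off the vectors of `e_l M`, for the largest `l` with `e_l M ≠ 0`, yields
`dim M ≤ ∑ ballot n l * g s` and `dim M ≤ ∑ ballot n l * h s`. Equality in the first bound makes
every cyclic module split off a standard module, so that `M` has a standard filtration with the
multiplicities `g`; equality in the second yields a costandard filtration in the same way. Both
equalities pass to direct summands.

In tensor space the vectors and functionals in question are determined by their values at the words
`1^a 2^{u-a} (12)^l`, where `u = n - 2 l` (`eq_zero_of_topWord`). Hence `g u` and `h u` are at most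
`u + 1` for `V^{⊗ n}`, and at most `1` if `s ≤ u` and `0` otherwise for `M(s, n)`. As the sums of the
ballot numbers weighted by these bounds are the dimensions `2 ^ n` and `binom n l`, all the bounds
are attained. The filtrations and the multiplicities follow. Moreover `M(s, n)` contains a copy of
`Δ(s)`, whose dimension is therefore exactly `ballot n l`, so that conversely the modules with a
standard filtration attain the first bound, with multiplicities `g`.

A homomorphism to a module with a costandard filtration extends along an inclusion whose cokernel
has a standard filtration (`HasCostandardFiltration.exists_extend`). By Fitting's lemma an
indecomposable tilting module is then a summand of every tilting module with the same top weight
(`IsIndecomposable.isSummand_of_top`). This gives the uniqueness of `T_n(s)` and, since the top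
weight of `M(s, n)` is `s`, the fullness of `V^{⊗ n}`. A summand of `M(s, n)` of least dimension
meeting `e_l M(s, n)` is `T_n(s)`, and it occurs only once because `e_l M(s, n)` is a line.
-/

open scoped TensorProduct

noncomputable section

namespace TLTilting

universe w x

/-! ### Filtrations with prescribed sections -/

section Filtrations

variable {A : Type u} [Ring A]

theorem nonempty_section_equiv_of_ker_eq {M : Type v} [AddCommGroup M] [Module A M]
    {Q : Type w} [AddCommGroup Q] [Module A Q] {N N' : Submodule A M} (f : N' →ₗ[A] Q)
    (hf : Function.Surjective f) (hker : LinearMap.ker f = N.submoduleOf N') :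
    Nonempty ((N' ⧸ N.submoduleOf N') ≃ₗ[A] Q) :=
  ⟨(Submodule.quotEquivOfEq _ _ hker.symm).trans (f.quotKerEquivOfSurjective hf)⟩

theorem nonempty_section_equiv_map {M : Type v} [AddCommGroup M] [Module A M] (K : Submodule A M)
    (N N' : Submodule A K) {Q : Type w} [AddCommGroup Q] [Module A Q]
    (h : Nonempty ((N' ⧸ N.submoduleOf N') ≃ₗ[A] Q)) :
    Nonempty ((N'.map K.subtype ⧸ (N.map K.subtype).submoduleOf (N'.map K.subtype)) ≃ₗ[A] Q) := by
  obtain ⟨φ⟩ := h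
  let ψ := Submodule.equivMapOfInjective K.subtype K.injective_subtype N'
  refine nonempty_section_equiv_of_ker_eq
    (φ.toLinearMap ∘ₗ (N.submoduleOf N').mkQ ∘ₗ ψ.symm.toLinearMap)
    (φ.surjective.comp ((Submodule.mkQ_surjective _).comp ψ.symm.surjective)) ?_
  ext y
  obtain ⟨z, rfl⟩ := ψ.surjective y
  have h₁ : ψ z ∈ (N.map K.subtype).submoduleOf (N'.map K.subtype) ↔
      ((z : K) : M) ∈ N.map K.subtype := Iff.rfl
  have h₂ : z ∈ N.submoduleOf N' ↔ (z : K) ∈ N := Iff.rfl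
  rw [LinearMap.mem_ker, LinearMap.comp_apply, LinearMap.comp_apply, LinearEquiv.coe_coe,
    LinearEquiv.coe_coe, LinearEquiv.symm_apply_apply, LinearEquiv.map_eq_zero_iff,
    Submodule.mkQ_apply, Submodule.Quotient.mk_eq_zero, h₁, h₂]
  constructor
  · intro h
    exact ⟨_, h, rfl⟩
  · rintro ⟨t, ht, htz⟩
    have : t = (z : K) := Subtype.ext htz
    exact this ▸ ht

theorem nonempty_section_equiv_submoduleOf {M : Type v} [AddCommGroup M] [Module A M]
    (K N N' : Submodule A M) (hK : N' ≤ K) {Q : Type w} [AddCommGroup Q] [Module A Q]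
    (h : Nonempty ((N' ⧸ N.submoduleOf N') ≃ₗ[A] Q)) :
    Nonempty ((N'.submoduleOf K ⧸ (N.submoduleOf K).submoduleOf (N'.submoduleOf K)) ≃ₗ[A] Q) := by
  obtain ⟨φ⟩ := h
  let ψ := Submodule.submoduleOfEquivOfLe hK
  refine nonempty_section_equiv_of_ker_eq
    (φ.toLinearMap ∘ₗ (N.submoduleOf N').mkQ ∘ₗ ψ.toLinearMap)
    (φ.surjective.comp ((Submodule.mkQ_surjective _).comp ψ.surjective)) ?_
  ext y
  simp only [LinearMap.mem_ker, LinearMap.comp_apply, LinearEquiv.coe_coe,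
    LinearEquiv.map_eq_zero_iff, Submodule.mkQ_apply, Submodule.Quotient.mk_eq_zero]
  rfl

variable {ι : Type} {D : ι → Type w} [∀ i, AddCommGroup (D i)] [∀ i, Module A (D i)]

theorem HasFiltration.of_subsingleton (M : Type v) [AddCommGroup M] [Module A M]
    [Subsingleton M] : HasFiltration A D M 0 :=
  ⟨0, fun _ => ⊥, Fin.elim0, fun _ _ _ => le_rfl, rfl, Subsingleton.elim _ _,
    fun j => j.elim0, fun i => by simp⟩

theorem card_fiber_snoc [DecidableEq ι] {r : ℕ} (lab : Fin r → ι) (i j : ι) :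
    Nat.card {t : Fin (r + 1) // Fin.snoc (α := fun _ => ι) lab i t = j} =
      Nat.card {t : Fin r // lab t = j} + Pi.single (M := fun _ => ℕ) i 1 j := by
  simp only [Nat.card_eq_fintype_card, Fintype.card_subtype, Finset.card_filter,
    Fin.sum_univ_castSucc, Fin.snoc_castSucc, Fin.snoc_last, Pi.single_apply, eq_comm]

theorem HasFiltration.snoc [DecidableEq ι] {M : Type v} [AddCommGroup M] [Module A M]
    (K : Submodule A M) {m : ι → ℕ} {i : ι} (hK : HasFiltration A D K m)
    (hi : Nonempty ((M ⧸ K) ≃ₗ[A] D i)) :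
    HasFiltration A D M (m + Pi.single i 1) := by
  obtain ⟨r, N, lab, hmono, h0, hlast, hsec, hm⟩ := hK
  have e₁ : ∀ j : Fin (r + 1), Fin.snoc (α := fun _ => Submodule A M)
      (fun j => (N j).map K.subtype) ⊤ j.castSucc = (N j).map K.subtype :=
    fun j => Fin.snoc_castSucc (α := fun _ => Submodule A M) _ _ _
  have e₂ : Fin.snoc (α := fun _ => Submodule A M)
      (fun j => (N j).map K.subtype) ⊤ (Fin.last (r + 1)) = ⊤ :=
    Fin.snoc_last (α := fun _ => Submodule A M) _ _
  refine ⟨r + 1, Fin.snoc (α := fun _ => Submodule A M) (fun j => (N j).map K.subtype) ⊤,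
    Fin.snoc (α := fun _ => ι) lab i, ?_, ?_, e₂, ?_, ?_⟩
  · refine Fin.monotone_iff_le_succ.2 fun j => ?_
    induction j using Fin.lastCases with
    | last => rw [Fin.succ_last, e₂]; exact le_top
    | cast j =>
      rw [Fin.succ_castSucc, e₁, e₁]
      exact Submodule.map_mono (hmono j.castSucc_lt_succ.le)
  · have : (0 : Fin (r + 1 + 1)) = (0 : Fin (r + 1)).castSucc := rfl
    rw [this, e₁, h0, Submodule.map_bot]
  · intro j
    induction j using Fin.lastCases with
    | last =>
      rw [Fin.snoc_last, Fin.succ_last, e₂, e₁, hlast, Submodule.map_subtype_top]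
      obtain ⟨φ⟩ := hi
      refine nonempty_section_equiv_of_ker_eq
        (φ.toLinearMap ∘ₗ K.mkQ ∘ₗ (⊤ : Submodule A M).subtype) ?_ ?_
      · refine φ.surjective.comp ((Submodule.mkQ_surjective _).comp fun y => ⟨⟨y, trivial⟩, rfl⟩)
      · ext y
        simp [Submodule.submoduleOf]
    | cast j =>
      rw [Fin.succ_castSucc, e₁, e₁, Fin.snoc_castSucc]
      exact nonempty_section_equiv_map K _ _ (hsec j)
  · intro j
    rw [card_fiber_snoc, Pi.add_apply, hm]

/-- Induction on a filtration, by removal of its topmost section. -/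
theorem HasFiltration.induction [DecidableEq ι]
    {P : ∀ (M : Type v) [AddCommGroup M] [Module A M], (ι → ℕ) → Prop}
    (zero : ∀ (M : Type v) [AddCommGroup M] [Module A M], Subsingleton M → P M 0)
    (snoc : ∀ (M : Type v) [AddCommGroup M] [Module A M] (K : Submodule A M) (m : ι → ℕ) (i : ι),
      P K m → Nonempty ((M ⧸ K) ≃ₗ[A] D i) → P M (m + Pi.single i 1))
    {M : Type v} [AddCommGroup M] [Module A M] {m : ι → ℕ} (h : HasFiltration A D M m) :
    P M m := by
  obtain ⟨r, N, lab, hmono, h0, hlast, hsec, hm⟩ := h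
  induction r generalizing M m with
  | zero =>
    have : m = 0 := funext fun i => by simp [hm i]
    subst this
    refine zero M ((Submodule.subsingleton_iff A).1 (subsingleton_of_bot_eq_top ?_))
    rw [← h0, ← hlast]
    rfl
  | succ r ih =>
    have hm' : m = (fun i => Nat.card {t : Fin r // lab t.castSucc = i}) +
        Pi.single (lab (Fin.last r)) 1 := by
      funext i
      rw [hm i, Pi.add_apply, ← card_fiber_snoc]
      congr! 4 with t
      induction t using Fin.lastCases <;> simp
    rw [hm']
    have hle : ∀ j : Fin (r + 1), N j.castSucc ≤ N (Fin.last r).castSucc :=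
      fun j => hmono (Fin.castSucc_le_castSucc_iff.2 (Fin.le_last j))
    refine snoc M (N (Fin.last r).castSucc) _ _
      (ih (fun j => (N j.castSucc).submoduleOf (N (Fin.last r).castSucc))
        (fun j => lab j.castSucc) ?_ ?_ ?_ ?_ fun i => rfl) ?_
    · exact fun a b hab => Submodule.comap_mono (hmono (Fin.castSucc_le_castSucc_iff.2 hab))
    · have : (0 : Fin (r + 1)).castSucc = 0 := rfl
      simp only [this, h0]
      simp [Submodule.submoduleOf]
    · exact Submodule.submoduleOf_self _
    · intro j
      exact nonempty_section_equiv_submoduleOf _ _ _ (hle j.succ) (hsec j.castSucc)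
    · obtain ⟨φ⟩ := hsec (Fin.last r)
      have htop : N (Fin.last r).succ = ⊤ := by rw [Fin.succ_last, hlast]
      let ψ : M →ₗ[A] N (Fin.last r).succ :=
        LinearMap.codRestrict _ LinearMap.id fun x => htop ▸ trivial
      refine ⟨(Submodule.quotEquivOfEq _ _ ?_).trans (LinearMap.quotKerEquivOfSurjective
        (φ.toLinearMap ∘ₗ ((N (Fin.last r).castSucc).submoduleOf _).mkQ ∘ₗ ψ) ?_)⟩
      · ext y
        rw [LinearMap.mem_ker, LinearMap.comp_apply, LinearMap.comp_apply, LinearEquiv.coe_coe,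
          LinearEquiv.map_eq_zero_iff, Submodule.mkQ_apply, Submodule.Quotient.mk_eq_zero]
        rfl
      · exact φ.surjective.comp ((Submodule.mkQ_surjective _).comp fun y => ⟨y.1, rfl⟩)

/-- A filtration of `M / N` whose preimage is prolonged at the bottom by the section `N`. -/
theorem HasFiltration.cons [DecidableEq ι] {M : Type v} [AddCommGroup M] [Module A M]
    (N : Submodule A M) {m : ι → ℕ} {i : ι} (hi : Nonempty (N ≃ₗ[A] D i))
    (hN : HasFiltration A D (M ⧸ N) m) :
    HasFiltration A D M (m + Pi.single i 1) := by
  revert hi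
  have := HasFiltration.induction (A := A) (D := D)
    (P := fun (Q : Type v) [AddCommGroup Q] [Module A Q] m =>
      ∀ (M : Type v) [AddCommGroup M] [Module A M] (π : M →ₗ[A] Q), Function.Surjective π →
        Nonempty (LinearMap.ker π ≃ₗ[A] D i) → HasFiltration A D M (m + Pi.single i 1))
    ?_ ?_ hN
  · intro hi
    refine this M N.mkQ (Submodule.mkQ_surjective N) ?_
    rw [Submodule.ker_mkQ]
    exact hi
  · intro Q _ _ hQ M _ _ π _ ⟨φ⟩
    refine HasFiltration.snoc ⊥ (HasFiltration.of_subsingleton _) ⟨?_⟩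
    have htop : LinearMap.ker π = ⊤ := LinearMap.ker_eq_top.2 (Subsingleton.elim _ _)
    exact ((Submodule.quotEquivOfEqBot ⊥ rfl).trans
      ((LinearEquiv.ofTop _ htop).symm)).trans φ
  · intro Q _ _ K m j ih ⟨φ⟩ M _ _ π hπ ⟨ψ⟩
    rw [add_right_comm]
    refine HasFiltration.snoc (K.comap π) (ih (K.comap π) (π.restrict fun x hx => hx) ?_ ⟨?_⟩)
      ⟨?_⟩
    · rintro ⟨y, hy⟩
      obtain ⟨x, rfl⟩ := hπ y
      exact ⟨⟨x, hy⟩, rfl⟩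
    · have hle : LinearMap.ker π ≤ K.comap π := fun x hx => by
        simp [LinearMap.mem_ker.1 hx]
      refine ((LinearEquiv.ofEq _ _ ?_).trans (Submodule.submoduleOfEquivOfLe hle)).trans ψ
      ext y
      simp [Submodule.submoduleOf, LinearMap.restrict_apply]
    · refine (Submodule.quotEquivOfEq _ _ ?_).trans ((LinearMap.quotKerEquivOfSurjective
        (K.mkQ ∘ₗ π) ((Submodule.mkQ_surjective K).comp hπ)).trans φ)
      rw [LinearMap.ker_comp, Submodule.ker_mkQ]

end Filtrations

/-! ### Spanning sets for cyclic modules generated by cup vectors -/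

section Spanning

/-- The number `binom m l - binom m (l - 1)` of half diagrams with `m` points and `l ≤ m / 2` cups,
in the form of its branching recursion; it is `0` for `m < 2 * l`. -/
def ballot : ℕ → ℕ → ℕ
  | _, 0 => 1
  | 0, _ + 1 => 0
  | m + 1, l + 1 => if 2 * (l + 1) ≤ m + 1 then ballot m (l + 1) + ballot m l else 0

theorem ballot_zero_right (m : ℕ) : ballot m 0 = 1 := by cases m <;> rfl

theorem ballot_succ_succ {m l : ℕ} (h : 2 * (l + 1) ≤ m + 1) :
    ballot (m + 1) (l + 1) = ballot m (l + 1) + ballot m l := by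
  rw [ballot, if_pos h]

theorem ballot_pos {m l : ℕ} (h : 2 * l ≤ m) : 0 < ballot m l := by
  induction m generalizing l with
  | zero =>
    obtain rfl : l = 0 := by omega
    exact Nat.one_pos
  | succ m ih =>
    cases l with
    | zero => exact Nat.one_pos
    | succ l =>
      rw [ballot_succ_succ h]
      exact Nat.add_pos_right _ (ih (by omega))

theorem ballot_eq_zero {m l : ℕ} (h : m < 2 * l) : ballot m l = 0 := by
  cases l with
  | zero => omega
  | succ l =>
    cases m with
    | zero => rfl
    | succ m => rw [ballot, if_neg (by omega)]

theorem sum_ballot {m L : ℕ} (h : 2 * L ≤ m + 1) :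
    ∑ l ∈ Finset.range (L + 1), ballot m l = m.choose L := by
  induction m generalizing L with
  | zero =>
    obtain rfl : L = 0 := by omega
    rfl
  | succ m ih =>
    have key : ∀ K, 2 * K ≤ m + 1 →
        ∑ l ∈ Finset.range (K + 1), ballot (m + 1) l = (m + 1).choose K := by
      intro K hK
      cases K with
      | zero => simp [ballot_zero_right]
      | succ K =>
        have hs : ∀ l ∈ Finset.range (K + 1), ballot (m + 1) (l + 1) =
            ballot m (l + 1) + ballot m l := fun l hl =>
          ballot_succ_succ (by have := Finset.mem_range.1 hl; omega)
        rw [Finset.sum_range_succ', ballot_zero_right, Finset.sum_congr rfl hs,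
          Finset.sum_add_distrib, ih (L := K) (by omega), Nat.choose_succ_succ, ← ih hK,
          Finset.sum_range_succ' _ (K + 1), ballot_zero_right]
        omega
    by_cases h' : 2 * L ≤ m + 1
    · exact key L h'
    · obtain ⟨K, rfl⟩ : ∃ K, L = K + 1 := ⟨L - 1, by omega⟩
      rw [Finset.sum_range_succ, ballot_eq_zero (l := K + 1) (by omega), add_zero,
        key K (by omega)]
      exact Nat.choose_symm_of_eq_add (by omega)

variable {k : Type u} [Field k] {A : Type v} [Ring A] [Algebra k A]

/-- A sequence `W` in an algebra whose terms `W 1, …, W (N - 1)` satisfy the Temperley–Lieb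
relations with loop parameter `δ`, all its other terms being `0`. -/
structure IsTLFamily (δ : k) (N : ℕ) (W : ℕ → A) : Prop where
  zero : W 0 = 0
  sq : ∀ i, W i * W i = δ • W i
  comm : ∀ i j, i + 2 ≤ j → Commute (W i) (W j)
  braid_up : ∀ i, i + 1 < N → W i * W (i + 1) * W i = W i
  braid_down : ∀ i, 1 ≤ i → W (i + 1) * W i * W (i + 1) = W (i + 1)

/-- The span of the subalgebra generated by `W 0, …, W (m - 1)`. -/
def initialSpan (W : ℕ → A) (m : ℕ) : Submodule k A :=
  Subalgebra.toSubmodule (Algebra.adjoin k (W '' Set.Iio m))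

theorem mem_initialSpan {W : ℕ → A} {i m : ℕ} (h : i < m) :
    W i ∈ initialSpan (k := k) W m :=
  Algebra.subset_adjoin ⟨i, h, rfl⟩

theorem span_le_initialSpan {W : ℕ → A} {i m : ℕ} (h : i < m) :
    Submodule.span k {W i} ≤ initialSpan (k := k) W m :=
  (Submodule.span_singleton_le_iff_mem _ _).2 (mem_initialSpan h)

theorem initialSpan_mono (W : ℕ → A) {l m : ℕ} (h : l ≤ m) :
    initialSpan (k := k) W l ≤ initialSpan W m :=
  Algebra.adjoin_mono (Set.image_mono (Set.Iio_subset_Iio h))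

theorem one_le_initialSpan (W : ℕ → A) (m : ℕ) : 1 ≤ initialSpan (k := k) W m :=
  Submodule.one_le.2 (one_mem (Algebra.adjoin k (W '' Set.Iio m)))

theorem initialSpan_mul_self (W : ℕ → A) (m : ℕ) :
    initialSpan (k := k) W m * initialSpan W m = initialSpan W m :=
  (Algebra.adjoin k (W '' Set.Iio m)).isIdempotentElem_toSubmodule

theorem initialSpan_zero (W : ℕ → A) : initialSpan (k := k) W 0 = 1 := by
  simp [initialSpan, Algebra.toSubmodule_bot]

variable {M : Type w} [AddCommGroup M] [Module k M] [Module A M] [IsScalarTower k A M]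

theorem span_smul_span_le_iff {a : A} {x : M} {P : Submodule k M} :
    Submodule.span k {a} • Submodule.span k {x} ≤ P ↔ a • x ∈ P := by
  refine ⟨fun h => h (Submodule.smul_mem_smul (Submodule.mem_span_singleton_self a)
    (Submodule.mem_span_singleton_self x)), fun h => Submodule.smul_le.2 fun b hb y hy => ?_⟩
  obtain ⟨c, rfl⟩ := Submodule.mem_span_singleton.1 hb
  obtain ⟨d, rfl⟩ := Submodule.mem_span_singleton.1 hy
  rw [smul_assoc, smul_algebra_smul_comm]
  exact P.smul_mem _ (P.smul_mem _ h)

theorem mul_smul_submodule (I J : Submodule k A) (X : Submodule k M) :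
    (I * J) • X = I • J • X :=
  Submodule.smul_assoc I J X

theorem smul_mono_right (I : Submodule k A) {X Y : Submodule k M} (h : X ≤ Y) :
    I • X ≤ I • Y :=
  Submodule.smul_mono le_rfl h

/-- The vectors `W (b + i) ⋯ W (b + 2) W (b + 1) x`. -/
def descend (W : ℕ → A) (b : ℕ) (x : M) : ℕ → M
  | 0 => x
  | i + 1 => W (b + 1 + i) • descend W b x i

theorem descend_mem (W : ℕ → A) (b : ℕ) (x : M) (i : ℕ) :
    descend W b x i ∈ initialSpan (k := k) W (b + 1 + i) • Submodule.span k {x} := by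
  induction i with
  | zero =>
    rw [← one_smul A (descend W b x 0)]
    exact Submodule.smul_mem_smul (Submodule.one_le.1 (one_le_initialSpan W _))
      (Submodule.mem_span_singleton_self x)
  | succ i ih =>
    have h := Submodule.smul_mem_smul (mem_initialSpan (k := k) (W := W)
      (Nat.lt_succ_self (b + 1 + i))) (Submodule.smul_mono_left
        (initialSpan_mono (k := k) W (b + 1 + i).le_succ) ih)
    rwa [← mul_smul_submodule, initialSpan_mul_self] at h

namespace IsTLFamily

variable {δ : k} {N : ℕ} {W : ℕ → A}

theorem span_mul_initialSpan (hW : IsTLFamily δ N W) {m j : ℕ} (h : m + 1 ≤ j) :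
    Submodule.span k {W j} * initialSpan W m = initialSpan W m * Submodule.span k {W j} := by
  refine Submodule.mul_comm_of_commute fun a ha b hb => ?_
  obtain ⟨c, rfl⟩ := Submodule.mem_span_singleton.1 ha
  refine Commute.smul_left ?_ c
  refine Algebra.commute_of_mem_adjoin_of_forall_mem_commute (R := k) hb ?_
  rintro _ ⟨i, hi, rfl⟩
  exact (hW.comm i j (by have := Set.mem_Iio.1 hi; omega)).symm

theorem span_mul_span_self (hW : IsTLFamily δ N W) (m : ℕ) :
    Submodule.span k {W m} * Submodule.span k {W m} ≤ Submodule.span k {W m} := by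
  rw [Submodule.span_mul_span, Set.singleton_mul_singleton, hW.sq,
    Submodule.span_singleton_le_iff_mem]
  exact Submodule.smul_mem _ _ (Submodule.mem_span_singleton_self _)

theorem span_mul_span_mul_span (hW : IsTLFamily δ N W) (m : ℕ) :
    Submodule.span k {W (m + 1)} * Submodule.span k {W m} * Submodule.span k {W (m + 1)} ≤
      Submodule.span k {W (m + 1)} := by
  rw [Submodule.span_mul_span, Set.singleton_mul_singleton, Submodule.span_mul_span,
    Set.singleton_mul_singleton, Submodule.span_singleton_le_iff_mem]
  rcases Nat.eq_zero_or_pos m with rfl | hm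
  · simp [hW.zero]
  · rw [hW.braid_down m hm]
    exact Submodule.mem_span_singleton_self _

theorem span_sandwich (hW : IsTLFamily δ N W) {m : ℕ} (h : initialSpan (k := k) W (m + 1) ≤ initialSpan W m ⊔
      initialSpan W m * Submodule.span k {W m} * initialSpan W m) :
    Submodule.span k {W (m + 1)} * initialSpan W (m + 1) * Submodule.span k {W (m + 1)} ≤
      initialSpan W m * Submodule.span k {W (m + 1)} := by
  have hc := hW.span_mul_initialSpan (le_refl (m + 1))
  have hww := hW.span_mul_span_self (m + 1)
  have hwvw := hW.span_mul_span_mul_span m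
  have hRR := initialSpan_mul_self (k := k) W m
  generalize Submodule.span k {W (m + 1)} = w at *
  generalize Submodule.span k {W m} = v at *
  generalize initialSpan (k := k) W m = R at *
  generalize initialSpan (k := k) W (m + 1) = S at *
  have e : w * (R * v * R) * w = R * (w * v * w) * R := calc
    w * (R * v * R) * w = (w * R) * v * (R * w) := by simp only [mul_assoc]
    _ = (R * w) * v * (w * R) := by rw [hc]
    _ = R * (w * v * w) * R := by simp only [mul_assoc]
  calc w * S * w ≤ w * (R ⊔ R * v * R) * w := by gcongr
    _ = R * (w * w) ⊔ R * (w * v * w) * R := by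
      rw [Submodule.mul_sup, Submodule.sup_mul, e, hc, mul_assoc]
    _ ≤ R * w ⊔ R * w * R := sup_le_sup (by gcongr) (by gcongr)
    _ = R * w := by rw [mul_assoc, hc, ← mul_assoc, hRR, sup_idem]

/-- Every element of the algebra on `W 0, …, W m` is a combination of products in which `W m`
occurs at most once. -/
theorem initialSpan_succ_le (hW : IsTLFamily δ N W) (m : ℕ) :
    initialSpan (k := k) W (m + 1) ≤ initialSpan W m ⊔
      initialSpan W m * Submodule.span k {W m} * initialSpan W m := by
  have hwSw : Submodule.span k {W m} * initialSpan W m * Submodule.span k {W m} ≤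
      initialSpan W m * Submodule.span k {W m} * initialSpan W m := by
    cases m with
    | zero => simp [hW.zero]
    | succ m =>
      refine (hW.span_sandwich (initialSpan_succ_le hW m)).trans ?_
      calc initialSpan W m * Submodule.span k {W (m + 1)}
          = initialSpan W m * Submodule.span k {W (m + 1)} * 1 := (mul_one _).symm
        _ ≤ _ := by
          gcongr
          · exact initialSpan_mono W m.le_succ
          · exact one_le_initialSpan W _
  have hSS := initialSpan_mul_self (k := k) W m
  have h1 : (1 : Submodule k A) ≤ initialSpan W m ⊔
      initialSpan W m * Submodule.span k {W m} * initialSpan W m :=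
    (one_le_initialSpan W m).trans le_sup_left
  have hw : Submodule.span k {W m} ≤
      initialSpan W m * Submodule.span k {W m} * initialSpan W m := by
    calc Submodule.span k {W m} = 1 * Submodule.span k {W m} * 1 := by rw [one_mul, mul_one]
      _ ≤ _ := by gcongr <;> exact one_le_initialSpan W m
  have hwm := Submodule.mem_span_singleton_self (R := k) (W m)
  have hgen : ∀ i < m, W i ∈ initialSpan (k := k) W m := fun i hi => mem_initialSpan hi
  rw [initialSpan]
  generalize Submodule.span k {W m} = w at *
  generalize initialSpan (k := k) W m = S at *
  have hmul : (S ⊔ S * w * S) * (S ⊔ S * w * S) ≤ S ⊔ S * w * S := by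
    have e₁ : S * (S * w * S) = S * w * S := by rw [← mul_assoc, ← mul_assoc, hSS]
    have e₂ : S * w * S * S = S * w * S := by rw [mul_assoc, hSS]
    have e₃ : S * w * S * (S * w * S) ≤ S * w * S := calc
      S * w * S * (S * w * S) = S * (w * (S * S) * w) * S := by simp only [mul_assoc]
      _ ≤ S * (S * w * S) * S := by rw [hSS]; gcongr
      _ = S * w * S := by rw [e₁, e₂]
    rw [Submodule.mul_sup, Submodule.sup_mul, Submodule.sup_mul, hSS, e₁, e₂]
    exact sup_le le_rfl (sup_le le_sup_right (e₃.trans le_sup_right))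
  have hle : Algebra.adjoin k (W '' Set.Iio (m + 1)) ≤
      (S ⊔ S * w * S).toSubalgebra (h1 (Submodule.one_le.1 le_rfl))
        fun a b ha hb => hmul (Submodule.mul_mem_mul ha hb) := by
    refine Algebra.adjoin_le ?_
    rintro _ ⟨i, hi, rfl⟩
    rcases Nat.lt_succ_iff_lt_or_eq.1 hi with h | rfl
    · exact (le_sup_left : S ≤ _) (hgen i h)
    · exact (le_sup_right : S * w * S ≤ S ⊔ S * w * S) (hw hwm)
  exact hle

theorem initialSpan_smul_span_le (hW : IsTLFamily δ N W) {m : ℕ} {Z : Submodule k M} {x : M}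
    (hZ : initialSpan (k := k) W m • Z ≤ Z) (hx : ∀ i < m, W i • x ∈ Z) :
    initialSpan (k := k) W m • Submodule.span k {x} ≤ Submodule.span k {x} ⊔ Z := by
  induction m with
  | zero => rw [initialSpan_zero, Submodule.one_smul]; exact le_sup_left
  | succ m ih =>
    have hmono := initialSpan_mono (k := k) W m.le_succ
    have h := ih ((Submodule.smul_mono_left hmono).trans hZ) fun i hi => hx i (by omega)
    have hwX := span_smul_span_le_iff.2 (hx m m.lt_succ_self)
    have hwZ := (Submodule.smul_mono_left (span_le_initialSpan m.lt_succ_self)).trans hZ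
    have hRZ := (Submodule.smul_mono_left hmono).trans hZ
    refine (Submodule.smul_mono_left (hW.initialSpan_succ_le m)).trans ?_
    rw [Submodule.sup_smul, mul_smul_submodule, mul_smul_submodule]
    refine sup_le h (le_trans ?_ le_sup_right)
    refine (smul_mono_right _ (smul_mono_right _ h)).trans
      ((smul_mono_right _ ?_).trans hRZ)
    rw [Submodule.smul_sup]
    exact sup_le hwX hwZ

/-- A vector fixed up to the factor `δ` by `W b` is generated under `W 0, …, W b` by means of
`W 0, …, W (b - 1)` alone. -/
theorem initialSpan_succ_smul_span_le (hW : IsTLFamily δ N W) (hδ : δ ≠ 0) {b : ℕ} (hb : 1 ≤ b)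
    {Z : Submodule k M} {x : M} (hZ : initialSpan (k := k) W (b + 1) • Z ≤ Z)
    (hx : W b • x - δ • x ∈ Z) :
    initialSpan (k := k) W (b + 1) • Submodule.span k {x} ≤
      initialSpan (k := k) W b • Submodule.span k {x} ⊔ Z := by
  obtain ⟨b, rfl⟩ : ∃ c, b = c + 1 := ⟨b - 1, by omega⟩
  have hwX : Submodule.span k {W (b + 1)} • Submodule.span k {x} ≤ Submodule.span k {x} ⊔ Z := by
    refine span_smul_span_le_iff.2 ?_
    rw [← sub_add_cancel (W (b + 1) • x) (δ • x)]
    exact add_mem (Submodule.mem_sup_right hx) (Submodule.mem_sup_left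
      (Submodule.smul_mem _ _ (Submodule.mem_span_singleton_self x)))
  have hXw : Submodule.span k {x} ≤ Submodule.span k {W (b + 1)} • Submodule.span k {x} ⊔ Z := by
    refine (Submodule.span_singleton_le_iff_mem _ _).2 ?_
    have e : x = δ⁻¹ • (W (b + 1) • x) - δ⁻¹ • (W (b + 1) • x - δ • x) := by
      rw [← smul_sub, sub_sub_cancel, smul_smul, inv_mul_cancel₀ hδ, one_smul]
    nth_rewrite 2 [e]
    exact sub_mem (Submodule.mem_sup_left (Submodule.smul_mem _ _ (Submodule.smul_mem_smul
      (Submodule.mem_span_singleton_self _) (Submodule.mem_span_singleton_self _))))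
      (Submodule.mem_sup_right (Submodule.smul_mem _ _ hx))
  have hwSw := hW.span_sandwich (hW.initialSpan_succ_le b)
  have hwZ := (Submodule.smul_mono_left (span_le_initialSpan (b + 1).lt_succ_self)).trans hZ
  have hSZ := (Submodule.smul_mono_left (initialSpan_mono W (b + 1).le_succ)).trans hZ
  have hRS := initialSpan_mono (k := k) W b.le_succ
  have hSS := initialSpan_mul_self (k := k) W (b + 1)
  refine (Submodule.smul_mono_left (hW.initialSpan_succ_le (b + 1))).trans ?_
  rw [Submodule.sup_smul]
  refine sup_le le_sup_left ?_
  generalize Submodule.span k {W (b + 1)} = w at *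
  generalize initialSpan (k := k) W (b + 1) = S at *
  generalize initialSpan (k := k) W b = R at *
  generalize Submodule.span k {x} = X at *
  calc (S * w * S) • X ≤ (S * w * S) • (w • X ⊔ Z) := smul_mono_right _ hXw
    _ = S • (w * S * w) • X ⊔ S • w • S • Z := by
      rw [Submodule.smul_sup]; simp only [mul_smul_submodule]
    _ ≤ S • (R * w) • X ⊔ S • w • Z :=
      sup_le_sup (smul_mono_right _ (Submodule.smul_mono_left hwSw))
        (smul_mono_right _ (smul_mono_right _ hSZ))
    _ ≤ S • S • (X ⊔ Z) ⊔ Z := by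
      refine sup_le_sup ?_ ((smul_mono_right _ hwZ).trans hSZ)
      rw [mul_smul_submodule]
      exact smul_mono_right _ ((smul_mono_right _ hwX).trans (Submodule.smul_mono_left hRS))
    _ ≤ S • X ⊔ Z := by
      rw [← mul_smul_submodule, hSS, Submodule.smul_sup]
      exact sup_le (sup_le_sup le_rfl hSZ) le_sup_right

section Descend

variable {b m : ℕ} {Z : Submodule k M} {x : M}

theorem smul_descend_mem_of_lt {E : Type w} [AddCommGroup E] [Module k E] [Module A E]
    {Z : Submodule k E} {x : E} (hW : IsTLFamily δ N W) (hZ : ∀ i < m, ∀ z ∈ Z, W i • z ∈ Z)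
    (hx : ∀ j, b + 1 < j → j < m → W j • x ∈ Z) (i j : ℕ) (hij : b + 1 + i < j) (hj : j < m) :
    W j • descend W b x i ∈ Z := by
  induction i with
  | zero => exact hx j hij hj
  | succ i ih =>
    rw [descend, ← mul_smul, ← (hW.comm (b + 1 + i) j (by omega)).eq, mul_smul]
    exact hZ _ (by omega) _ (ih (by omega))

theorem smul_descend_sub_mem (hW : IsTLFamily δ N W) (hδ : δ ≠ 0) (hmN : m ≤ N)
    (hZ : ∀ i < m, ∀ z ∈ Z, W i • z ∈ Z) (hx : W b • x - δ • x ∈ Z) (i : ℕ) (hi : b + 1 + i < m) :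
    W (b + i) • descend W b x (i + 1) - descend W b x i ∈ Z := by
  cases i with
  | zero =>
    have e : δ • (W b • W (b + 1) • x - x) =
        (W b • x - δ • x) - W b • W (b + 1) • (W b • x - δ • x) := by
      have h : W b • W (b + 1) • W b • x = W b • x := by
        rw [← mul_smul, ← mul_smul, hW.braid_up b (by omega)]
      rw [smul_sub (W (b + 1)), smul_sub (W b), h, smul_sub]
      simp only [smul_algebra_smul_comm]
      abel
    have h : δ⁻¹ • δ • (W b • W (b + 1) • x - x) ∈ Z := by
      refine Z.smul_mem _ ?_
      rw [e]
      exact sub_mem hx (hZ _ (by omega) _ (hZ _ (by omega) _ hx))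
    rwa [smul_smul, inv_mul_cancel₀ hδ, one_smul] at h
  | succ i =>
    have h : W (b + (i + 1)) • descend W b x (i + 1 + 1) = descend W b x (i + 1) := by
      rw [descend, descend, ← mul_smul, ← mul_smul]
      have := hW.braid_up (b + 1 + i) (by omega)
      rw [show b + (i + 1) = b + 1 + i by omega, show b + 1 + (i + 1) = b + 1 + i + 1 by omega,
        this]
    rw [h, sub_self]
    exact Z.zero_mem

theorem smul_descend_mem_of_add_lt (hW : IsTLFamily δ N W) (hδ : δ ≠ 0) (hmN : m ≤ N)
    (hZ : ∀ i < m, ∀ z ∈ Z, W i • z ∈ Z) (hx : W b • x - δ • x ∈ Z)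
    (hx' : ∀ j, b + 1 < j → j < m → W j • x ∈ Z) (i t : ℕ) (h : b + i + 2 + t < m) :
    W (b + i) • descend W b x (i + 2 + t) ∈ Z := by
  induction t with
  | zero =>
    rw [add_zero, descend, ← mul_smul, (hW.comm (b + i) (b + 1 + (i + 1)) (by omega)).eq, mul_smul,
      ← sub_add_cancel (W (b + i) • descend W b x (i + 1)) (descend W b x i), smul_add]
    exact add_mem (hZ _ (by omega) _ (hW.smul_descend_sub_mem hδ hmN hZ hx i (by omega)))
      (hW.smul_descend_mem_of_lt hZ hx' _ _ (by omega) (by omega))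
  | succ t ih =>
    rw [← add_assoc, descend, ← mul_smul, (hW.comm (b + i) (b + 1 + (i + 2 + t)) (by omega)).eq,
      mul_smul]
    exact hZ _ (by omega) _ (ih (by omega))

theorem smul_descend_sub_smul_mem (hW : IsTLFamily δ N W) (hZ : ∀ i < m, ∀ z ∈ Z, W i • z ∈ Z)
    {j : ℕ} (hj : j < b) (hx : W j • x - δ • x ∈ Z) (i : ℕ) (hi : b + i < m) :
    W j • descend W b x i - δ • descend W b x i ∈ Z := by
  induction i with
  | zero => exact hx
  | succ i ih =>
    have e : W j • descend W b x (i + 1) - δ • descend W b x (i + 1) =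
        W (b + 1 + i) • (W j • descend W b x i - δ • descend W b x i) := by
      rw [descend, ← mul_smul, (hW.comm j (b + 1 + i) (by omega)).eq, mul_smul, smul_sub,
        smul_algebra_smul_comm]
    rw [e]
    exact hZ _ (by omega) _ (ih (by omega))

theorem span_smul_initialSpan_smul_le (hW : IsTLFamily δ N W) (hδ : δ ≠ 0) (hb : 1 ≤ b)
    (hZ : initialSpan (k := k) W m • Z ≤ Z) (hx : W b • x - δ • x ∈ Z)
    (hx' : ∀ j, b + 1 < j → j < m → W j • x ∈ Z) (c : ℕ) (hc : b + 1 + c < m) :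
    Submodule.span k {W (b + 1 + c)} • initialSpan (k := k) W (b + 1 + c) • Submodule.span k {x} ≤
      initialSpan (k := k) W (b + 1 + c) • Submodule.span k {descend W b x (c + 1)} ⊔ Z := by
  have hZ' : ∀ i ≤ m, initialSpan (k := k) W i • Z ≤ Z := fun i hi =>
    (Submodule.smul_mono_left (initialSpan_mono W hi)).trans hZ
  have hwZ : ∀ i < m, Submodule.span k {W i} • Z ≤ Z := fun i hi =>
    (Submodule.smul_mono_left (span_le_initialSpan hi)).trans hZ
  induction c with
  | zero =>
    refine (smul_mono_right _ (hW.initialSpan_succ_smul_span_le hδ hb (hZ' _ hc.le) hx)).trans ?_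
    rw [Submodule.smul_sup, ← mul_smul_submodule, hW.span_mul_initialSpan le_rfl,
      mul_smul_submodule]
    refine sup_le_sup ((smul_mono_right _ (span_smul_span_le_iff.2 ?_)).trans
      (Submodule.smul_mono_left (initialSpan_mono W (by omega)))) (hwZ _ hc)
    exact Submodule.mem_span_singleton_self _
  | succ c ih =>
    have ih := ih (by omega)
    have hN := hW.initialSpan_succ_le (k := k) (b + 1 + c)
    have hcomm := hW.span_mul_initialSpan (m := b + 1 + c) (j := b + 1 + (c + 1)) (by omega)
    have hwX : Submodule.span k {W (b + 1 + (c + 1))} • Submodule.span k {x} ≤ Z :=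
      span_smul_span_le_iff.2 (hx' _ (by omega) hc)
    have hwY : Submodule.span k {W (b + 1 + (c + 1))} •
        Submodule.span k {descend W b x (c + 1)} ≤
        Submodule.span k {descend W b x (c + 1 + 1)} :=
      span_smul_span_le_iff.2 (Submodule.mem_span_singleton_self _)
    have hRZ := hZ' (b + 1 + c) (by omega)
    have hwZ := hwZ _ hc
    have hRR := initialSpan_mul_self (k := k) W (b + 1 + c)
    have hRS := initialSpan_mono (k := k) W (b + 1 + c).le_succ
    rw [show b + 1 + (c + 1) = b + 1 + c + 1 by omega] at *
    generalize Submodule.span k {descend W b x (c + 1 + 1)} = Y' at *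
    generalize Submodule.span k {descend W b x (c + 1)} = Y at *
    generalize Submodule.span k {W (b + 1 + c + 1)} = w at *
    generalize Submodule.span k {W (b + 1 + c)} = v at *
    generalize initialSpan (k := k) W (b + 1 + c + 1) = S at *
    generalize initialSpan (k := k) W (b + 1 + c) = R at *
    generalize Submodule.span k {x} = X at *
    calc w • S • X ≤ w • (R ⊔ R * v * R) • X := smul_mono_right _ (Submodule.smul_mono_left hN)
      _ = R • w • X ⊔ R • w • v • R • X := by
        rw [Submodule.sup_smul, Submodule.smul_sup, ← mul_smul_submodule, hcomm,
          ← mul_smul_submodule, ← mul_assoc, ← mul_assoc, hcomm]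
        simp only [mul_smul_submodule]
      _ ≤ R • Z ⊔ R • w • (R • Y ⊔ Z) :=
        sup_le_sup (smul_mono_right _ hwX) (smul_mono_right _ (smul_mono_right _ ih))
      _ = R • Z ⊔ (R • w • Y ⊔ R • w • Z) := by
        rw [Submodule.smul_sup, Submodule.smul_sup, ← mul_smul_submodule w, hcomm,
          ← mul_smul_submodule, ← mul_assoc, hRR, mul_smul_submodule]
      _ ≤ Z ⊔ (S • Y' ⊔ Z) :=
        sup_le_sup hRZ (sup_le_sup (Submodule.smul_mono hRS hwY)
          ((smul_mono_right _ hwZ).trans hRZ))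
      _ ≤ S • Y' ⊔ Z := sup_le le_sup_right le_rfl

end Descend

/-- Let `Z` be a subspace stable under `W 0, …, W (m - 1)`. If modulo `Z` the vector `x` is an
eigenvector with eigenvalue `δ` of the `l` elements `W 1, W 3, …, W (2 l - 1)` and is annihilated by
`W i` for `2 l < i < m`, then the space generated by `x` has dimension at most `ballot m l`
modulo `Z`. -/
theorem exists_finset_span (hW : IsTLFamily δ N W) (hδ : δ ≠ 0) {m l : ℕ} (hmN : m ≤ N)
    (hl : 2 * l ≤ m) {Z : Submodule k M} {x : M} (hZ : initialSpan (k := k) W m • Z ≤ Z)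
    (hx : ∀ j < l, W (2 * j + 1) • x - δ • x ∈ Z)
    (hx' : ∀ j, 2 * l < j → j < m → W j • x ∈ Z) :
    ∃ S : Finset M, S.card ≤ ballot m l ∧
      initialSpan (k := k) W m • Submodule.span k {x} ≤ Submodule.span k (S : Set M) ⊔ Z := by
  classical
  induction m generalizing l Z x with
  | zero =>
    obtain rfl : l = 0 := by omega
    refine ⟨{x}, by simp [ballot_zero_right], ?_⟩
    rw [Finset.coe_singleton, initialSpan_zero, Submodule.one_smul]
    exact le_sup_left
  | succ m ih =>
    have hZm := (Submodule.smul_mono_left (initialSpan_mono W m.le_succ)).trans hZ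
    rcases Nat.eq_zero_or_pos l with rfl | hl0
    · refine ⟨{x}, by simp [ballot_zero_right], ?_⟩
      rw [Finset.coe_singleton]
      refine hW.initialSpan_smul_span_le hZ fun i hi => ?_
      rcases Nat.eq_zero_or_pos i with rfl | hi0
      · rw [hW.zero, zero_smul]
        exact Z.zero_mem
      · exact hx' i (by omega) hi
    obtain ⟨l, rfl⟩ : ∃ c, l = c + 1 := ⟨l - 1, by omega⟩
    rw [ballot_succ_succ hl]
    rcases hl.eq_or_lt with hlm | hlm
    · obtain rfl : m = 2 * l + 1 := by omega
      obtain ⟨S, hS, hspan⟩ := ih (l := l) (by omega) (by omega) hZm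
        (fun j hj => hx j (by omega)) (fun j h₁ h₂ => by omega)
      refine ⟨S, hS.trans (Nat.le_add_left _ _), ?_⟩
      exact (hW.initialSpan_succ_smul_span_le hδ (by omega) hZ (hx l (by omega))).trans
        (sup_le hspan le_sup_right)
    · obtain ⟨c, rfl⟩ : ∃ c, m = 2 * l + 1 + 1 + c := ⟨m - (2 * l + 1 + 1), by omega⟩
      have hZi : ∀ i < 2 * l + 1 + 1 + c + 1, ∀ z ∈ Z, W i • z ∈ Z := fun i hi z hz =>
        hZ (Submodule.smul_mem_smul (mem_initialSpan hi) hz)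
      have hxb := hx l (by omega)
      have hxb' : ∀ j, 2 * l + 1 + 1 < j → j < 2 * l + 1 + 1 + c + 1 → W j • x ∈ Z :=
        fun j h₁ h₂ => hx' j (by omega) h₂
      obtain ⟨S₁, hS₁, hspan₁⟩ := ih (l := l + 1) (by omega) (by omega) hZm hx
        (fun j h₁ h₂ => hx' j h₁ (by omega))
      have hYZ := hW.span_smul_initialSpan_smul_le hδ (by omega) hZ hxb hxb' c (by omega)
      have hZ' : initialSpan (k := k) W (2 * l + 1 + 1 + c) •
          (Z ⊔ initialSpan (k := k) W (2 * l + 1 + 1 + c) • Submodule.span k {x}) ≤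
          Z ⊔ initialSpan (k := k) W (2 * l + 1 + 1 + c) • Submodule.span k {x} := by
        rw [Submodule.smul_sup, ← mul_smul_submodule, initialSpan_mul_self]
        exact sup_le_sup_right hZm _
      have hy : ∀ j, 2 * l < j → j < 2 * l + 1 + 1 + c →
          W j • descend W (2 * l + 1) x (c + 1) ∈
            Z ⊔ initialSpan (k := k) W (2 * l + 1 + 1 + c) • Submodule.span k {x} := by
        intro j h₁ h₂
        obtain ⟨i, rfl⟩ : ∃ i, j = 2 * l + 1 + i := ⟨j - (2 * l + 1), by omega⟩
        rcases (show i ≤ c by omega).eq_or_lt with rfl | hic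
        · rw [← sub_add_cancel (W (2 * l + 1 + i) • descend W (2 * l + 1) x (i + 1))
            (descend W (2 * l + 1) x i)]
          exact add_mem
            (Submodule.mem_sup_left (hW.smul_descend_sub_mem hδ hmN hZi hxb i (by omega)))
            (Submodule.mem_sup_right (descend_mem W (2 * l + 1) x i))
        · obtain ⟨t, rfl⟩ : ∃ t, c = i + 1 + t := ⟨c - (i + 1), by omega⟩
          refine Submodule.mem_sup_left ?_
          rw [show i + 1 + t + 1 = i + 2 + t by omega]
          exact hW.smul_descend_mem_of_add_lt hδ hmN hZi hxb hxb' i t (by omega)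
      obtain ⟨S₂, hS₂, hspan₂⟩ := ih (l := l) (by omega) (by omega) hZ'
        (fun j hj => Submodule.mem_sup_left (hW.smul_descend_sub_smul_mem hZi (by omega)
          (hx j (by omega)) (c + 1) (by omega))) hy
      refine ⟨S₁ ∪ S₂, (Finset.card_union_le _ _).trans (Nat.add_le_add hS₁ hS₂), ?_⟩
      refine (Submodule.smul_mono_left (hW.initialSpan_succ_le _)).trans ?_
      rw [Submodule.sup_smul, mul_smul_submodule, mul_smul_submodule, Finset.coe_union,
        Submodule.span_union]
      have hspan₂' := hspan₂.trans (sup_le_sup_left (sup_le_sup_left hspan₁ _) _)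
      refine sup_le (hspan₁.trans (sup_le_sup_right le_sup_left _)) ?_
      refine (smul_mono_right _ hYZ).trans ?_
      rw [Submodule.smul_sup, ← mul_smul_submodule, initialSpan_mul_self]
      refine sup_le (hspan₂'.trans ?_) (hZm.trans le_sup_right)
      exact sup_le (le_sup_right.trans le_sup_left)
        (sup_le le_sup_right (sup_le_sup_right le_sup_left _))

end IsTLFamily

end Spanning

/-! ### The heredity idempotents and the dimensions of standard and costandard modules -/

section HeredityChain

variable {k : Type u} [Field k] {q : kˣ} {n : ℕ}

theorem TL.induction {P : TL q n → Prop} (algebraMap : ∀ r, P (algebraMap k (TL q n) r))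
    (gen : ∀ i, P (TL.gen q n i)) (mul : ∀ a b, P a → P b → P (a * b))
    (add : ∀ a b, P a → P b → P (a + b)) (a : TL q n) : P a := by
  obtain ⟨a, rfl⟩ := TL.mk_surjective q n a
  induction a using FreeAlgebra.induction with
  | grade0 r => rw [AlgHom.commutes]; exact algebraMap r
  | grade1 i => exact gen i
  | mul a b ha hb => rw [map_mul]; exact mul _ _ ha hb
  | add a b ha hb => rw [map_add]; exact add _ _ ha hb

theorem TL.gen_sq (i : Fin (n - 1)) :
    TL.gen q n i * TL.gen q n i = ((q : k) + (q : k)⁻¹) • TL.gen q n i := by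
  have := RingQuot.mkAlgHom_rel k (TLRel.sq (q := q) (n := n) i)
  rwa [map_mul, map_smul] at this

theorem TL.gen_braid (i j : Fin (n - 1)) (h : (i : ℕ) + 1 = j ∨ (j : ℕ) + 1 = i) :
    TL.gen q n i * TL.gen q n j * TL.gen q n i = TL.gen q n i := by
  have := RingQuot.mkAlgHom_rel k (TLRel.braid (q := q) (n := n) i j h)
  rwa [map_mul, map_mul] at this

theorem TL.gen_comm (i j : Fin (n - 1)) (h : ¬ ((i : ℕ) + 1 = j ∨ (j : ℕ) + 1 = i)) :
    TL.gen q n i * TL.gen q n j = TL.gen q n j * TL.gen q n i := by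
  have := RingQuot.mkAlgHom_rel k (TLRel.comm (q := q) (n := n) i j h)
  rwa [map_mul, map_mul] at this

theorem TL.U_of_lt {i : ℕ} (h : 1 ≤ i ∧ i < n) : TL.U q n i = TL.gen q n ⟨i - 1, by omega⟩ :=
  dif_pos h

theorem TL.U_eq_zero {i : ℕ} (h : ¬ (1 ≤ i ∧ i < n)) : TL.U q n i = 0 := dif_neg h

theorem TL.U_comm (i j : ℕ) (h : i + 2 ≤ j) : Commute (TL.U q n i) (TL.U q n j) := by
  by_cases hi : 1 ≤ i ∧ i < n
  · by_cases hj : 1 ≤ j ∧ j < n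
    · rw [TL.U_of_lt hi, TL.U_of_lt hj]
      exact TL.gen_comm _ _ (by simp only; omega)
    · rw [TL.U_eq_zero hj]
      exact Commute.zero_right _
  · rw [TL.U_eq_zero hi]
    exact Commute.zero_left _

theorem TL.U_braid (i j : ℕ) (h : i + 1 = j ∨ j + 1 = i) (hj : 1 ≤ j ∧ j < n) :
    TL.U q n i * TL.U q n j * TL.U q n i = TL.U q n i := by
  by_cases hi : 1 ≤ i ∧ i < n
  · rw [TL.U_of_lt hi, TL.U_of_lt hj]
    exact TL.gen_braid _ _ (by simp only; omega)
  · rw [TL.U_eq_zero hi, mul_zero]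

variable (q n) in
/-- The generators of `T_n` numbered from the right: `W_i = U_{n-i}`. In this numbering the
idempotent `e_l` is a multiple of `W₁ W₃ ⋯ W_{2l-1}`. -/
def TL.W (i : ℕ) : TL q n := TL.U q n (n - i)

theorem TL.W_eq_zero {i : ℕ} (h : n ≤ i) : TL.W q n i = 0 := TL.U_eq_zero (by omega)

theorem TL.gen_eq_W (i : Fin (n - 1)) : TL.gen q n i = TL.W q n (n - (i + 1)) := by
  have := i.2
  rw [TL.W, TL.U_of_lt (by omega)]
  congr 1
  ext
  simp only
  omega

variable (q n) in
theorem TL.isTLFamily_W : IsTLFamily ((q : k) + (q : k)⁻¹) n (TL.W q n) where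
  zero := TL.U_eq_zero (by omega)
  sq i := by
    by_cases h : 1 ≤ n - i ∧ n - i < n
    · rw [TL.W, TL.U_of_lt h, TL.gen_sq]
    · rw [TL.W, TL.U_eq_zero h, mul_zero, smul_zero]
  comm i j h := by
    by_cases hj : j < n
    · exact (TL.U_comm (n - j) (n - i) (by omega)).symm
    · rw [TL.W_eq_zero (not_lt.1 hj)]
      exact Commute.zero_right _
  braid_up i h := TL.U_braid _ _ (by omega) (by omega)
  braid_down i h := by
    by_cases hi : i + 1 < n
    · exact TL.U_braid _ _ (by omega) (by omega)
    · rw [TL.W_eq_zero (not_lt.1 hi), mul_zero]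

theorem IsTLFamily.op {A : Type v} [Ring A] [Algebra k A] {δ : k} {N : ℕ} {W : ℕ → A}
    (hW : IsTLFamily δ N W) : IsTLFamily δ N fun i => MulOpposite.op (W i) where
  zero := by rw [hW.zero, MulOpposite.op_zero]
  sq i := by rw [← MulOpposite.op_mul, hW.sq, MulOpposite.op_smul]
  comm i j h := (hW.comm i j h).op
  braid_up i h := by
    rw [← MulOpposite.op_mul, ← MulOpposite.op_mul, ← mul_assoc, hW.braid_up i h]
  braid_down i h := by
    rw [← MulOpposite.op_mul, ← MulOpposite.op_mul, ← mul_assoc, hW.braid_down i h]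

theorem mem_initialSpan_W (a : TL q n) : a ∈ initialSpan (k := k) (TL.W q n) n := by
  induction a using TL.induction with
  | algebraMap r => exact Subalgebra.algebraMap_mem _ r
  | gen i =>
    rw [TL.gen_eq_W]
    exact mem_initialSpan (by have := i.2; omega)
  | mul a b ha hb => exact Subalgebra.mul_mem _ ha hb
  | add a b ha hb => exact Subalgebra.add_mem _ ha hb

theorem op_mem_initialSpan_W (a : TL q n) :
    MulOpposite.op a ∈ initialSpan (k := k) (fun i => MulOpposite.op (TL.W q n i)) n := by
  induction a using TL.induction with
  | algebraMap r => exact Subalgebra.algebraMap_mem _ r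
  | gen i =>
    rw [TL.gen_eq_W]
    exact mem_initialSpan (W := fun i => MulOpposite.op (TL.W q n i)) (by have := i.2; omega)
  | mul a b ha hb => exact Subalgebra.mul_mem _ hb ha
  | add a b ha hb => exact Subalgebra.add_mem _ ha hb

theorem heredityIdem_zero : heredityIdem q n 0 = 1 := by simp [heredityIdem]

theorem heredityIdem_eq_zero {l : ℕ} (h : n < 2 * l) : heredityIdem q n l = 0 :=
  if_neg (by omega)

theorem heredityIdem_succ {l : ℕ} (h : 2 * (l + 1) ≤ n) :
    heredityIdem q n (l + 1) =
      ((q : k) + (q : k)⁻¹)⁻¹ • (heredityIdem q n l * TL.W q n (2 * l + 1)) := by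
  rw [heredityIdem, heredityIdem, if_pos h, if_pos (by omega), List.range_succ, List.map_append,
    List.prod_append, List.map_singleton, List.prod_singleton, smul_mul_assoc, smul_smul,
    ← pow_succ', TL.W, show n - 1 - 2 * l = n - (2 * l + 1) by omega]

theorem W_commute_heredityIdem {l j : ℕ} (h : 2 * l < j) :
    Commute (TL.W q n j) (heredityIdem q n l) := by
  by_cases hl : 2 * l ≤ n
  · induction l with
    | zero => rw [heredityIdem_zero]; exact Commute.one_right _
    | succ l ih =>
      rw [heredityIdem_succ hl]
      exact Commute.smul_right ((ih (by omega) (by omega)).mul_right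
        ((TL.isTLFamily_W q n).comm _ _ (by omega)).symm) _
  · rw [heredityIdem_eq_zero (by omega)]
    exact Commute.zero_right _

theorem W_mul_heredityIdem {l j : ℕ} (hj : j < l) :
    TL.W q n (2 * j + 1) * heredityIdem q n l =
      ((q : k) + (q : k)⁻¹) • heredityIdem q n l := by
  by_cases hl : 2 * l ≤ n
  · induction l with
    | zero => omega
    | succ l ih =>
      rw [heredityIdem_succ hl, mul_smul_comm, smul_comm]
      congr 1
      rcases Nat.lt_succ_iff_lt_or_eq.1 hj with h | rfl
      · rw [← mul_assoc, ih h (by omega), smul_mul_assoc]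
      · rw [← mul_assoc, (W_commute_heredityIdem (by omega)).eq, mul_assoc,
          (TL.isTLFamily_W q n).sq, mul_smul_comm]
  · rw [heredityIdem_eq_zero (by omega), mul_zero, smul_zero]

theorem heredityIdem_mul_W {l j : ℕ} (hj : j < l) :
    heredityIdem q n l * TL.W q n (2 * j + 1) =
      ((q : k) + (q : k)⁻¹) • heredityIdem q n l := by
  by_cases hl : 2 * l ≤ n
  · induction l with
    | zero => omega
    | succ l ih =>
      rw [heredityIdem_succ hl, smul_mul_assoc, smul_comm]
      congr 1
      rcases Nat.lt_succ_iff_lt_or_eq.1 hj with h | rfl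
      · rw [mul_assoc, ((TL.isTLFamily_W q n).comm (2 * j + 1) (2 * l + 1) (by omega)).symm.eq,
          ← mul_assoc, ih h (by omega), smul_mul_assoc]
      · rw [mul_assoc, (TL.isTLFamily_W q n).sq, mul_smul_comm]
  · rw [heredityIdem_eq_zero (by omega), zero_mul, smul_zero]

theorem heredityIdem_mul_self (hq : (q : k) + (q : k)⁻¹ ≠ 0) (l : ℕ) :
    heredityIdem q n l * heredityIdem q n l = heredityIdem q n l := by
  by_cases hl : 2 * l ≤ n
  · induction l with
    | zero => rw [heredityIdem_zero, one_mul]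
    | succ l ih =>
      have h : heredityIdem q n l * TL.W q n (2 * l + 1) *
          (heredityIdem q n l * TL.W q n (2 * l + 1)) =
          ((q : k) + (q : k)⁻¹) • (heredityIdem q n l * TL.W q n (2 * l + 1)) := by
        rw [mul_assoc, ← mul_assoc (TL.W q n _), (W_commute_heredityIdem (by omega)).eq,
          mul_assoc, (TL.isTLFamily_W q n).sq, ← mul_assoc, ih (by omega), mul_smul_comm]
      rw [heredityIdem_succ hl, smul_mul_smul_comm, h, smul_smul, mul_assoc, inv_mul_cancel₀ hq,
        mul_one]
  · rw [heredityIdem_eq_zero (by omega), mul_zero]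

theorem heredityIdem_mul_succ (hq : (q : k) + (q : k)⁻¹ ≠ 0) (l : ℕ) :
    heredityIdem q n l * heredityIdem q n (l + 1) = heredityIdem q n (l + 1) := by
  by_cases hl : 2 * (l + 1) ≤ n
  · rw [heredityIdem_succ hl, mul_smul_comm, ← mul_assoc, heredityIdem_mul_self hq]
  · rw [heredityIdem_eq_zero (l := l + 1) (by omega), mul_zero]

theorem heredityIdem_mem (l : ℕ) : heredityIdem q n l ∈ heredityIdeal q n l :=
  Submodule.subset_span ⟨1, (mul_one _).symm⟩

theorem mul_mem_heredityIdeal {l : ℕ} (a : TL q n) {x : TL q n} (hx : x ∈ heredityIdeal q n l) :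
    a * x ∈ heredityIdeal q n l :=
  Submodule.smul_mem _ a hx

theorem heredityIdeal_succ_le (hq : (q : k) + (q : k)⁻¹ ≠ 0) (l : ℕ) :
    heredityIdeal q n (l + 1) ≤ heredityIdeal q n l := by
  refine Submodule.span_le.2 ?_
  rintro _ ⟨x, rfl⟩
  rw [← heredityIdem_mul_succ hq, mul_assoc]
  exact heredityIdeal_mul_mem q n l _ _ (heredityIdem_mem l)

theorem heredityIdeal_antitone (hq : (q : k) + (q : k)⁻¹ ≠ 0) : Antitone (heredityIdeal q n) :=
  antitone_nat_of_succ_le (heredityIdeal_succ_le hq)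

theorem W_mul_heredityIdem_mem (hq : (q : k) + (q : k)⁻¹ ≠ 0) {l j : ℕ} (hj : 2 * l < j) :
    TL.W q n j * heredityIdem q n l ∈ heredityIdeal q n (l + 1) := by
  induction j, Nat.succ_le_of_lt hj using Nat.le_induction with
  | base =>
    by_cases hn : 2 * (l + 1) ≤ n
    · have h : heredityIdem q n l * TL.W q n (2 * l + 1) =
          ((q : k) + (q : k)⁻¹) • heredityIdem q n (l + 1) := by
        rw [heredityIdem_succ hn, smul_smul, mul_inv_cancel₀ hq, one_smul]
      rw [(W_commute_heredityIdem (Nat.lt_succ_self _)).eq, Nat.succ_eq_add_one, h]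
      exact Submodule.smul_of_tower_mem _ _ (heredityIdem_mem _)
    · rw [TL.W_eq_zero (by omega), zero_mul]
      exact Submodule.zero_mem _
  | succ j hj' ih =>
    have ih := ih (by omega)
    rw [← (TL.isTLFamily_W q n).braid_down j (by omega), mul_assoc,
      (W_commute_heredityIdem (by omega)).eq, mul_assoc, ← mul_assoc (TL.W q n j)]
    exact mul_mem_heredityIdeal _ (heredityIdeal_mul_mem q n _ _ _ ih)

theorem heredityIdem_mul_W_mem (hq : (q : k) + (q : k)⁻¹ ≠ 0) {l j : ℕ} (hj : 2 * l < j) :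
    heredityIdem q n l * TL.W q n j ∈ heredityIdeal q n (l + 1) := by
  rw [← (W_commute_heredityIdem hj).eq]
  exact W_mul_heredityIdem_mem hq hj

/-- The heredity ideals are idempotent, in the form: `J_l` annihilates a vector whose multiples by
`J_l` are annihilated by `J_l`. -/
theorem smul_eq_zero_of_heredityIdeal {M : Type v} [AddCommGroup M] [Module (TL q n) M]
    (hq : (q : k) + (q : k)⁻¹ ≠ 0) {l : ℕ} {x : M}
    (h : ∀ a ∈ heredityIdeal q n l, ∀ b ∈ heredityIdeal q n l, a • b • x = 0)
    {a : TL q n} (ha : a ∈ heredityIdeal q n l) : a • x = 0 := by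
  induction ha using Submodule.span_induction with
  | mem y hy =>
    obtain ⟨z, rfl⟩ := hy
    rw [← heredityIdem_mul_self hq, mul_assoc, mul_smul]
    exact h _ (heredityIdem_mem l) _ (heredityIdeal_mul_mem q n l _ _ (heredityIdem_mem l))
  | zero => exact zero_smul _ _
  | add y z _ _ hy hz => rw [add_smul, hy, hz, add_zero]
  | smul c y _ hy => rw [smul_eq_mul, mul_smul, hy, smul_zero]

theorem smul_eq_zero_of_heredityIdem {M : Type v} [AddCommGroup M] [Module (TL q n) M] {l : ℕ}
    (h : ∀ x : M, heredityIdem q n l • x = 0) {a : TL q n} (ha : a ∈ heredityIdeal q n l) (x : M) :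
    a • x = 0 := by
  induction ha using Submodule.span_induction with
  | mem y hy =>
    obtain ⟨z, rfl⟩ := hy
    rw [mul_smul, h]
  | zero => exact zero_smul _ _
  | add y z _ _ hy hz => rw [add_smul, hy, hz, add_zero]
  | smul c y _ hy => rw [smul_eq_mul, mul_smul, hy, smul_zero]

theorem exists_finset_span_standard (hq : (q : k) + (q : k)⁻¹ ≠ 0) {l : ℕ} (hl : 2 * l ≤ n) :
    ∃ S : Finset (TL q n), S.card ≤ ballot n l ∧ ∀ a : TL q n, a * heredityIdem q n l ∈
      Submodule.span k (S : Set (TL q n)) ⊔ (heredityIdeal q n (l + 1)).restrictScalars k := by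
  obtain ⟨S, hS, hspan⟩ := (TL.isTLFamily_W q n).exists_finset_span (M := TL q n) hq le_rfl hl
    (Z := (heredityIdeal q n (l + 1)).restrictScalars k) (x := heredityIdem q n l)
    (Submodule.smul_le.2 fun a _ x hx => mul_mem_heredityIdeal a hx)
    (fun j hj => by
      rw [smul_eq_mul, W_mul_heredityIdem hj, sub_self]
      exact Submodule.zero_mem _)
    (fun j h₁ _ => W_mul_heredityIdem_mem hq h₁)
  exact ⟨S, hS, fun a => hspan (Submodule.smul_mem_smul (mem_initialSpan_W a)
    (Submodule.mem_span_singleton_self _))⟩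

theorem exists_finset_span_costandard (hq : (q : k) + (q : k)⁻¹ ≠ 0) {l : ℕ} (hl : 2 * l ≤ n) :
    ∃ S : Finset (TL q n), S.card ≤ ballot n l ∧ ∀ a : TL q n, heredityIdem q n l * a ∈
      Submodule.span k (S : Set (TL q n)) ⊔ (heredityIdeal q n (l + 1)).restrictScalars k := by
  obtain ⟨S, hS, hspan⟩ := (TL.isTLFamily_W q n).op.exists_finset_span (M := TL q n) hq le_rfl hl
    (Z := (heredityIdeal q n (l + 1)).restrictScalars k) (x := heredityIdem q n l)
    (Submodule.smul_le.2 fun a _ x hx => heredityIdeal_mul_mem q n _ a.unop x hx)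
    (fun j hj => by
      rw [op_smul_eq_mul, heredityIdem_mul_W hj, sub_self]
      exact Submodule.zero_mem _)
    (fun j h₁ _ => heredityIdem_mul_W_mem hq h₁)
  exact ⟨S, hS, fun a => hspan (Submodule.smul_mem_smul (op_mem_initialSpan_W a)
    (Submodule.mem_span_singleton_self _))⟩

theorem Weight.two_mul_cups_le (s : Weight n) : 2 * s.cups ≤ n := by
  rw [Weight.cups]
  omega

theorem Weight.val_add_two_mul_cups (s : Weight n) : s.1 + 2 * s.cups = n := by
  have := s.2
  rw [Weight.cups]
  omega

theorem Weight.ext_cups {s t : Weight n} (h : s.cups = t.cups) : s = t := by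
  have hs := s.val_add_two_mul_cups
  have ht := t.val_add_two_mul_cups
  exact Subtype.ext (by omega)

theorem finite_finrank_of_le_span {R : Type v} [Ring R] [Algebra k R] {M : Type w}
    [AddCommGroup M] [Module R M] [Module k M] [IsScalarTower k R M] (P : Submodule R M)
    (S : Finset M) (h : ∀ y ∈ P, y ∈ Submodule.span k (S : Set M)) :
    Module.Finite k P ∧ Module.finrank k P ≤ S.card := by
  have hle : P.restrictScalars k ≤ Submodule.span k (S : Set M) := h
  have hfin : Module.Finite k (Submodule.span k (S : Set M)) := Module.Finite.span_finset k S
  exact ⟨Submodule.finiteDimensional_of_le hle,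
    (Submodule.finrank_mono hle).trans (finrank_span_finset_le_card S)⟩

theorem finite_finrank_standard (hq : (q : k) + (q : k)⁻¹ ≠ 0) (s : Weight n) :
    Module.Finite k (Standard q n s) ∧
      Module.finrank k (Standard q n s) ≤ ballot n s.cups := by
  classical
  obtain ⟨S, hS, hspan⟩ := exists_finset_span_standard hq s.two_mul_cups_le
  have h := finite_finrank_of_le_span (k := k)
    (Submodule.span (TL q n) {(heredityIdeal q n (s.cups + 1)).mkQ (heredityIdem q n s.cups)})
    (S.image (heredityIdeal q n (s.cups + 1)).mkQ) ?_
  · exact ⟨h.1, h.2.trans (Finset.card_image_le.trans hS)⟩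
  · intro y hy
    obtain ⟨a, rfl⟩ := Submodule.mem_span_singleton.1 hy
    obtain ⟨b, hb, c, hc, hbc⟩ := Submodule.mem_sup.1 (hspan a)
    have e : a • (heredityIdeal q n (s.cups + 1)).mkQ (heredityIdem q n s.cups) =
        (heredityIdeal q n (s.cups + 1)).mkQ b := by
      rw [← map_smul, smul_eq_mul, ← hbc, map_add,
        show (heredityIdeal q n (s.cups + 1)).mkQ c = 0 from
          (Submodule.Quotient.mk_eq_zero _).2 hc, add_zero]
    rw [e, Finset.coe_image]
    exact Submodule.apply_mem_span_image_of_mem_span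
      ((heredityIdeal q n (s.cups + 1)).mkQ.restrictScalars k) hb

instance : Module k (DualRegular q n) := inferInstanceAs (Module k (TL q n →ₗ[k] k))

instance : IsScalarTower k (TL q n) (DualRegular q n) where
  smul_assoc c a f := LinearMap.ext fun x => by
    change f (x * c • a) = c * f (x * a)
    rw [mul_smul_comm]
    exact map_smul (show TL q n →ₗ[k] k from f) c (x * a)

theorem finite_finrank_costandard (hq : (q : k) + (q : k)⁻¹ ≠ 0) (s : Weight n) :
    Module.Finite k (Costandard q n s) ∧
      Module.finrank k (Costandard q n s) ≤ ballot n s.cups := by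
  classical
  obtain ⟨S, hS, hspan⟩ := exists_finset_span_costandard hq s.two_mul_cups_le
  let ρ : Costandard q n s →ₗ[k] (S → k) :=
    { toFun f a := f.1 a
      map_add' f g := rfl
      map_smul' c f := rfl }
  have hρ : Function.Injective ρ := by
    refine (injective_iff_map_eq_zero ρ).2 fun f hf => Subtype.ext (LinearMap.ext fun a => ?_)
    let F : TL q n →ₗ[k] k := f.1
    have hle : Submodule.span k (S : Set (TL q n)) ⊔
        (heredityIdeal q n (s.cups + 1)).restrictScalars k ≤ LinearMap.ker F := by
      refine sup_le (Submodule.span_le.2 fun a ha => ?_) fun a ha => f.2.1 a ha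
      exact congrFun hf ⟨a, ha⟩
    exact (f.2.2 a).symm.trans (hle (hspan a))
  refine ⟨Module.Finite.of_injective ρ hρ, (LinearMap.finrank_le_finrank_of_injective hρ).trans ?_⟩
  rw [Module.finrank_fintype_fun_eq_card, Fintype.card_coe]
  exact hS

end HeredityChain

/-! ### A dimension criterion for standard filtrations -/

section FiniteDimensional

variable {k : Type u} [Field k] {R : Type v} [Ring R] [Algebra k R]
  {M : Type w} [AddCommGroup M] [Module R M] [Module k M] [IsScalarTower k R M]

theorem finite_submodule [Module.Finite k M] (N : Submodule R M) : Module.Finite k N :=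
  Module.Finite.of_injective (N.subtype.restrictScalars k) N.injective_subtype

theorem finite_quotient [Module.Finite k M] (N : Submodule R M) : Module.Finite k (M ⧸ N) :=
  Module.Finite.of_surjective (N.mkQ.restrictScalars k) N.mkQ_surjective

theorem finrank_range_add_finrank_ker' [Module.Finite k M] {N : Type x} [AddCommGroup N]
    [Module R N] [Module k N] [IsScalarTower k R N] (f : M →ₗ[R] N) :
    Module.finrank k (LinearMap.range f) + Module.finrank k (LinearMap.ker f) =
      Module.finrank k M :=
  LinearMap.finrank_range_add_finrank_ker (f.restrictScalars k)

theorem finrank_quotient_add_finrank' [Module.Finite k M] (N : Submodule R M) :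
    Module.finrank k (M ⧸ N) + Module.finrank k N = Module.finrank k M := by
  have h := LinearMap.finrank_range_add_finrank_ker (N.mkQ.restrictScalars k)
  have h' : LinearMap.range (N.mkQ.restrictScalars k) = ⊤ :=
    LinearMap.range_eq_top.2 N.mkQ_surjective
  rw [h', finrank_top] at h
  have e : LinearMap.ker (N.mkQ.restrictScalars k) = N.restrictScalars k := by
    ext x
    simp
  rw [e] at h
  exact h

end FiniteDimensional

section StandardCriterion

variable {k : Type u} [Field k] {q : kˣ} {n : ℕ}

instance : Fintype (Weight n) :=
  Fintype.ofInjective (fun s : Weight n => (⟨s.1, Nat.lt_succ_of_le s.2.1⟩ : Fin (n + 1)))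
    fun _ _ h => Subtype.ext (congrArg Fin.val h)

theorem Weight.exists_cups_eq {l : ℕ} (h : 2 * l ≤ n) : ∃ s : Weight n, s.cups = l :=
  ⟨⟨n - 2 * l, by omega⟩, by simp only [Weight.cups]; omega⟩

/-- The dimension of a module with standard (or costandard) multiplicities `g`. -/
def weightedSum (g : Weight n → ℕ) : ℕ := ∑ s : Weight n, ballot n s.cups * g s

theorem weightedSum_mono {g g' : Weight n → ℕ} (h : g ≤ g') : weightedSum g ≤ weightedSum g' :=
  Finset.sum_le_sum fun s _ => Nat.mul_le_mul_left _ (h s)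

theorem weightedSum_add (g g' : Weight n → ℕ) :
    weightedSum (g + g') = weightedSum g + weightedSum g' := by
  simp only [weightedSum, Pi.add_apply, mul_add, Finset.sum_add_distrib]

theorem weightedSum_single (s : Weight n) :
    weightedSum (Pi.single s 1) = ballot n s.cups := by
  simp [weightedSum, Pi.single_apply]

theorem weightedSum_add_le {g g' : Weight n → ℕ} {s : Weight n} (h : g ≤ g') (hs : g s + 1 ≤ g' s) :
    weightedSum g + ballot n s.cups ≤ weightedSum g' := by
  rw [← weightedSum_single, ← weightedSum_add]
  refine weightedSum_mono fun t => ?_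
  by_cases hts : t = s
  · subst hts
    simpa using hs
  · simpa [hts] using h t

theorem eq_of_le_of_weightedSum_le {g g' : Weight n → ℕ} (h : g ≤ g')
    (hsum : weightedSum g' ≤ weightedSum g) : g = g' := by
  have h' := (Finset.sum_eq_sum_iff_of_le fun s (_ : s ∈ Finset.univ) =>
    Nat.mul_le_mul_left (ballot n s.cups) (h s)).1 (le_antisymm (weightedSum_mono h) hsum)
  exact funext fun s => Nat.eq_of_mul_eq_mul_left (ballot_pos s.two_mul_cups_le)
    (h' s (Finset.mem_univ s))

variable (q n) in
/-- The functionals `φ` on `M` with `φ ∘ e_l = φ` that vanish on `J_{l+1} M`; this space is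
isomorphic to `Hom(M, ∇(n - 2 l))`. The additive structure of the dual is written out in the form
in which subspaces of it are recognised as vector spaces. -/
def stdFunctionals (l : ℕ) (M : Type v) [AddCommGroup M] [Module (TL q n) M] [Module k M]
    [IsScalarTower k (TL q n) M] :
    @Submodule k (M →ₗ[k] k) _ AddCommGroup.toAddCommMonoid inferInstance where
  carrier := {φ | (∀ x, φ (heredityIdem q n l • x) = φ x) ∧
    ∀ a ∈ heredityIdeal q n (l + 1), ∀ x : M, φ (a • x) = 0}
  add_mem' hφ hψ := ⟨fun x => by rw [LinearMap.add_apply, LinearMap.add_apply, hφ.1, hψ.1],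
    fun a ha x => by rw [LinearMap.add_apply, hφ.2 a ha, hψ.2 a ha, add_zero]⟩
  zero_mem' := ⟨fun _ => rfl, fun _ _ _ => rfl⟩
  smul_mem' c φ hφ := ⟨fun x => by rw [LinearMap.smul_apply, LinearMap.smul_apply, hφ.1],
    fun a ha x => by rw [LinearMap.smul_apply, hφ.2 a ha, smul_zero]⟩

variable (q n) in
/-- The dimensions of the spaces `Hom(M, ∇(s))`. -/
def stdDim (M : Type v) [AddCommGroup M] [Module (TL q n) M] [Module k M]
    [IsScalarTower k (TL q n) M] (s : Weight n) : ℕ :=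
  Module.finrank k (stdFunctionals q n s.cups M)

variable {M : Type v} [AddCommGroup M] [Module (TL q n) M] [Module k M]
  [IsScalarTower k (TL q n) M]
  {N : Type w} [AddCommGroup N] [Module (TL q n) N] [Module k N]
  [IsScalarTower k (TL q n) N]
  {Q : Type x} [AddCommGroup Q] [Module (TL q n) Q] [Module k Q]
  [IsScalarTower k (TL q n) Q]

/-- Composition with a module homomorphism, on the spaces `stdFunctionals`. -/
def stdPullback (l : ℕ) (f : M →ₗ[TL q n] N) :
    stdFunctionals q n l N →ₗ[k] stdFunctionals q n l M where
  toFun φ := ⟨φ.1 ∘ₗ f.restrictScalars k, fun x => by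
      simpa using φ.2.1 (f x), fun a ha x => by
      simpa using φ.2.2 a ha (f x)⟩
  map_add' _ _ := rfl
  map_smul' _ _ := rfl

theorem stdPullback_apply (l : ℕ) (f : M →ₗ[TL q n] N) (φ : stdFunctionals q n l N) (x : M) :
    (stdPullback l f φ).1 x = φ.1 (f x) := rfl

theorem stdPullback_injective (l : ℕ) {f : M →ₗ[TL q n] N} (hf : Function.Surjective f) :
    Function.Injective (stdPullback l f) := by
  intro φ ψ h
  refine Subtype.ext (LinearMap.ext fun y => ?_)
  obtain ⟨x, rfl⟩ := hf y
  rw [← stdPullback_apply, ← stdPullback_apply, h]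

theorem stdDim_le_of_surjective [Module.Finite k M] {f : M →ₗ[TL q n] N}
    (hf : Function.Surjective f) : stdDim q n N ≤ stdDim q n M := fun _ =>
  LinearMap.finrank_le_finrank_of_injective (stdPullback_injective _ hf)

theorem stdDim_congr [Module.Finite k M] [Module.Finite k N] (f : M ≃ₗ[TL q n] N) :
    stdDim q n M = stdDim q n N :=
  le_antisymm (stdDim_le_of_surjective (f := f.symm.toLinearMap) f.symm.surjective)
    (stdDim_le_of_surjective (f := f.toLinearMap) f.surjective)

/-- Left exactness of the functors `Hom(-, ∇(s))`. -/
theorem stdDim_le_add [Module.Finite k M] [Module.Finite k N] [Module.Finite k Q]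
    {f : N →ₗ[TL q n] M} {g : M →ₗ[TL q n] Q} (hg : Function.Surjective g)
    (hfg : LinearMap.ker g ≤ LinearMap.range f) : stdDim q n M ≤ stdDim q n N + stdDim q n Q := by
  intro s
  have hadd := LinearMap.finrank_range_add_finrank_ker (stdPullback (k := k) s.cups f)
  refine hadd.symm.trans_le (Nat.add_le_add (Submodule.finrank_le _) ?_)
  have hle : LinearMap.ker (stdPullback (k := k) s.cups f) ≤
      LinearMap.range (stdPullback s.cups g) := by
    intro φ hφ
    obtain ⟨σ, hσ⟩ := LinearMap.exists_rightInverse_of_surjective (g.restrictScalars k)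
      (LinearMap.range_eq_top.2 hg)
    have hσ' : ∀ x, φ.1 (σ (g x)) = φ.1 x := fun x => by
      have hx : σ (g x) - x ∈ LinearMap.ker g := by
        rw [LinearMap.mem_ker, map_sub, sub_eq_zero]
        exact LinearMap.congr_fun hσ (g x)
      obtain ⟨y, hy⟩ := hfg hx
      rw [← sub_eq_zero, ← map_sub, ← hy, ← stdPullback_apply, LinearMap.mem_ker.1 hφ]
      rfl
    refine ⟨⟨φ.1 ∘ₗ σ, fun y => ?_, fun a ha y => ?_⟩, Subtype.ext (LinearMap.ext hσ')⟩
    · obtain ⟨x, rfl⟩ := hg y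
      rw [LinearMap.comp_apply, LinearMap.comp_apply, ← map_smul, hσ', hσ', φ.2.1]
    · obtain ⟨x, rfl⟩ := hg y
      rw [LinearMap.comp_apply, ← map_smul, hσ', φ.2.2 a ha]
  exact (Submodule.finrank_mono hle).trans (LinearMap.finrank_range_le _)

theorem stdDim_add_le_of_splitting [Module.Finite k M] {i : N →ₗ[TL q n] M} {j : Q →ₗ[TL q n] M}
    {f : M →ₗ[TL q n] N} {g : M →ₗ[TL q n] Q} (hfi : ∀ x, f (i x) = x) (hgi : ∀ x, g (i x) = 0)
    (hfj : ∀ x, f (j x) = 0) (hgj : ∀ x, g (j x) = x) :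
    stdDim q n N + stdDim q n Q ≤ stdDim q n M := by
  intro s
  have := Module.Finite.of_surjective (f.restrictScalars k) fun x => ⟨i x, hfi x⟩
  have := Module.Finite.of_surjective (g.restrictScalars k) fun x => ⟨j x, hgj x⟩
  let F := (stdPullback (k := k) s.cups f).coprod (stdPullback (k := k) s.cups g)
  have hF : Function.Injective F := by
    refine (injective_iff_map_eq_zero F).2 ?_
    rintro ⟨φ, ψ⟩ h0
    have h1 : ∀ x, φ.1 (f x) + ψ.1 (g x) = 0 :=
      fun x => congrArg (fun θ : stdFunctionals q n s.cups M => θ.1 x) h0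
    refine Prod.ext (Subtype.ext (LinearMap.ext fun x => ?_))
      (Subtype.ext (LinearMap.ext fun x => ?_))
    · simpa [hfi, hgi] using h1 (i x)
    · simpa [hfj, hgj] using h1 (j x)
  have hle := LinearMap.finrank_le_finrank_of_injective hF
  rwa [Module.finrank_prod] at hle

/-- In a nonzero module let `l` be maximal with `e_l M ≠ 0`. -/
theorem exists_top_weight (hq : (q : k) + (q : k)⁻¹ ≠ 0) (M : Type v) [AddCommGroup M]
    [Module (TL q n) M] [Nontrivial M] :
    ∃ s : Weight n, (∀ x : M, heredityIdem q n (s.cups + 1) • x = 0) ∧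
      ∃ x : M, x ≠ 0 ∧ heredityIdem q n s.cups • x = x := by
  classical
  have hex : ∃ l, ∀ x : M, heredityIdem q n l • x = 0 :=
    ⟨n + 1, fun x => by rw [heredityIdem_eq_zero (by omega), zero_smul]⟩
  obtain ⟨l, hl⟩ : ∃ l, Nat.find hex = l + 1 := by
    refine ⟨Nat.find hex - 1, (Nat.succ_pred_eq_of_pos (Nat.pos_of_ne_zero fun h => ?_)).symm⟩
    obtain ⟨x, hx⟩ := exists_ne (0 : M)
    have := Nat.find_spec hex x
    rw [h, heredityIdem_zero, one_smul] at this
    exact hx this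
  have h := Nat.find_min hex (m := l) (by omega)
  push Not at h
  obtain ⟨x, hx⟩ := h
  obtain ⟨s, rfl⟩ := Weight.exists_cups_eq (n := n) (l := l) (by
    by_contra hn
    exact hx (by rw [heredityIdem_eq_zero (by omega), zero_smul]))
  refine ⟨s, ?_, heredityIdem q n s.cups • x, hx, ?_⟩
  · rw [← hl]
    exact Nat.find_spec hex
  · rw [← mul_smul, heredityIdem_mul_self hq]

/-- If `e_{l+1}` annihilates `M` then a linear functional on `M` extends from `e_l M` to an element
of `stdFunctionals`. -/
def stdFunctionalOfTop (hq : (q : k) + (q : k)⁻¹ ≠ 0) {l : ℕ}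
    (h : ∀ x : M, heredityIdem q n (l + 1) • x = 0) (φ : M →ₗ[k] k) :
    stdFunctionals q n l M :=
  ⟨φ ∘ₗ (Algebra.lsmul k k M (heredityIdem q n l)),
    fun x => by
      simp only [LinearMap.comp_apply, Algebra.lsmul_coe]
      rw [← mul_smul, heredityIdem_mul_self hq],
    fun a ha x => by
      simp only [LinearMap.comp_apply, Algebra.lsmul_coe]
      rw [smul_eq_zero_of_heredityIdem h ha, smul_zero, map_zero]⟩

theorem stdFunctionalOfTop_apply (hq : (q : k) + (q : k)⁻¹ ≠ 0) {l : ℕ}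
    (h : ∀ x : M, heredityIdem q n (l + 1) • x = 0) (φ : M →ₗ[k] k) (x : M) :
    (stdFunctionalOfTop hq h φ).1 x = φ (heredityIdem q n l • x) := rfl

/-- At the top weight `s` a nonzero vector of `e_l M` is detected by `Hom(M, ∇(s))`, so its loss in a
quotient lowers the dimension. -/
theorem stdDim_lt_of_surjective [Module.Finite k M] (hq : (q : k) + (q : k)⁻¹ ≠ 0) {s : Weight n}
    (h : ∀ x : M, heredityIdem q n (s.cups + 1) • x = 0) {f : M →ₗ[TL q n] N}
    (hf : Function.Surjective f) {x : M} (hx : x ≠ 0) (hex : heredityIdem q n s.cups • x = x)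
    (hfx : f x = 0) : stdDim q n N s + 1 ≤ stdDim q n M s := by
  have hinj := stdPullback_injective (k := k) s.cups hf
  rw [stdDim, stdDim, ← LinearMap.finrank_range_of_inj hinj]
  refine Submodule.finrank_lt fun htop => ?_
  obtain ⟨φ, hφ⟩ := Module.Projective.exists_dual_ne_zero k hx
  have hmem : stdFunctionalOfTop hq h φ ∈ (⊤ : Submodule k _) := trivial
  rw [← htop] at hmem
  obtain ⟨ψ, hψ⟩ := hmem
  have h0 : (stdFunctionalOfTop hq h φ).1 x = 0 := by
    rw [← hψ, stdPullback_apply, hfx, map_zero]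
  rw [stdFunctionalOfTop_apply, hex] at h0
  exact hφ h0

theorem stdDim_submodule_le_of_top [Module.Finite k M] (hq : (q : k) + (q : k)⁻¹ ≠ 0)
    {s : Weight n} (h : ∀ x : M, heredityIdem q n (s.cups + 1) • x = 0)
    (P : Submodule (TL q n) M) : stdDim q n P s ≤ stdDim q n M s := by
  have hsurj : Function.Surjective (stdPullback (k := k) s.cups P.subtype) := by
    intro φ
    obtain ⟨Φ, hΦ⟩ := LinearMap.exists_extend (p := P.restrictScalars k) φ.1
    refine ⟨stdFunctionalOfTop hq h Φ, Subtype.ext (LinearMap.ext fun y => ?_)⟩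
    rw [stdPullback_apply, stdFunctionalOfTop_apply, ← map_smul, ← φ.2.1 y]
    exact LinearMap.congr_fun hΦ (heredityIdem q n s.cups • y)
  exact LinearMap.finrank_le_finrank_of_surjective hsurj

/-- The homomorphism from a standard module that takes the generator to `x`. -/
theorem exists_standard_hom {X : Type v} [AddCommGroup X] [Module (TL q n) X] (s : Weight n)
    {x : X} (hex : heredityIdem q n s.cups • x = x)
    (hJ : ∀ a ∈ heredityIdeal q n (s.cups + 1), a • x = 0) :
    ∃ π : Standard q n s →ₗ[TL q n] Submodule.span (TL q n) {x}, Function.Surjective π ∧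
      ∀ a : TL q n, (π (a • ⟨_, Submodule.mem_span_singleton_self _⟩) : X) = a • x := by
  let f : (TL q n ⧸ heredityIdeal q n (s.cups + 1)) →ₗ[TL q n] X :=
    (heredityIdeal q n (s.cups + 1)).liftQ (LinearMap.toSpanSingleton (TL q n) X x)
      fun a ha => hJ a ha
  have hf : ∀ a : TL q n, f (a • (heredityIdeal q n (s.cups + 1)).mkQ
      (heredityIdem q n s.cups)) = a • x := fun a => by
    rw [map_smul]
    change a • heredityIdem q n s.cups • x = a • x
    rw [hex]
  have hmem : ∀ y : Standard q n s, f y.1 ∈ Submodule.span (TL q n) {x} := by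
    rintro ⟨y, hy⟩
    obtain ⟨a, rfl⟩ := Submodule.mem_span_singleton.1 hy
    rw [hf]
    exact Submodule.smul_mem _ a (Submodule.mem_span_singleton_self x)
  refine ⟨(f ∘ₗ Submodule.subtype _).codRestrict _ hmem, ?_, hf⟩
  rintro ⟨y, hy⟩
  obtain ⟨a, rfl⟩ := Submodule.mem_span_singleton.1 hy
  exact ⟨⟨_, Submodule.smul_mem _ a (Submodule.mem_span_singleton_self _)⟩, Subtype.ext (hf a)⟩

theorem finrank_span_le_ballot (hq : (q : k) + (q : k)⁻¹ ≠ 0) (s : Weight n) {x : M}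
    (hex : heredityIdem q n s.cups • x = x)
    (hJ : ∀ a ∈ heredityIdeal q n (s.cups + 1), a • x = 0) :
    Module.finrank k (Submodule.span (TL q n) {x}) ≤ ballot n s.cups := by
  obtain ⟨π, hπ, -⟩ := exists_standard_hom s hex hJ
  have := (finite_finrank_standard hq s).1
  exact (LinearMap.finrank_le_finrank_of_surjective (f := π.restrictScalars k) hπ).trans
    (finite_finrank_standard hq s).2

theorem standard_equiv_of_finrank_eq (hq : (q : k) + (q : k)⁻¹ ≠ 0) (s : Weight n) {x : M}
    (hex : heredityIdem q n s.cups • x = x)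
    (hJ : ∀ a ∈ heredityIdeal q n (s.cups + 1), a • x = 0)
    (hrank : ballot n s.cups ≤ Module.finrank k (Submodule.span (TL q n) {x})) :
    Nonempty (Submodule.span (TL q n) {x} ≃ₗ[TL q n] Standard q n s) ∧
      ∀ a : TL q n, a • x = 0 → a * heredityIdem q n s.cups ∈ heredityIdeal q n (s.cups + 1) := by
  obtain ⟨π, hπ, hπx⟩ := exists_standard_hom s hex hJ
  have hfin := (finite_finrank_standard hq s).1
  have hfin' : Module.Finite k (Submodule.span (TL q n) {x}) :=
    Module.Finite.of_surjective (π.restrictScalars k) hπ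
  have heq : Module.finrank k (Standard q n s) = Module.finrank k (Submodule.span (TL q n) {x}) :=
    le_antisymm ((finite_finrank_standard hq s).2.trans hrank)
      (LinearMap.finrank_le_finrank_of_surjective (f := π.restrictScalars k) hπ)
  have hinj : Function.Injective π :=
    (LinearMap.injective_iff_surjective_of_finrank_eq_finrank (f := π.restrictScalars k) heq).2 hπ
  refine ⟨⟨(LinearEquiv.ofBijective π ⟨hinj, hπ⟩).symm⟩, fun a ha => ?_⟩
  have h0 : a • (⟨_, Submodule.mem_span_singleton_self _⟩ : Standard q n s) = 0 :=
    hinj (Subtype.ext (by rw [hπx, ha, map_zero]; rfl))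
  exact (Submodule.Quotient.mk_eq_zero _).1 (congrArg Subtype.val h0)

variable (M) in
/-- The dimension of `M` is bounded by that of a module with the standard multiplicities
`dim Hom(M, ∇(s))`. -/
theorem finrank_le_weightedSum_stdDim [Module.Finite k M] (hq : (q : k) + (q : k)⁻¹ ≠ 0) :
    Module.finrank k M ≤ weightedSum (stdDim q n M) := by
  induction hd : Module.finrank k M using Nat.strong_induction_on generalizing M with
  | _ d ih =>
    subst hd
    rcases subsingleton_or_nontrivial M with hM | hM
    · rw [Module.finrank_zero_of_subsingleton]
      exact Nat.zero_le _
    obtain ⟨s, h, x, hx, hex⟩ := exists_top_weight (n := n) hq M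
    have hJ : ∀ a ∈ heredityIdeal q n (s.cups + 1), a • x = 0 :=
      fun a ha => smul_eq_zero_of_heredityIdem h ha x
    have hfin := finite_quotient (k := k) (Submodule.span (TL q n) {x})
    have hfin' := finite_submodule (k := k) (Submodule.span (TL q n) {x})
    have hadd := finrank_quotient_add_finrank' (k := k) (Submodule.span (TL q n) {x})
    have hnt : Nontrivial (Submodule.span (TL q n) {x}) :=
      ⟨⟨x, Submodule.mem_span_singleton_self x⟩, 0, fun h0 => hx (congrArg Subtype.val h0)⟩
    have hpos := Module.finrank_pos (R := k) (M := Submodule.span (TL q n) {x})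
    have hih := ih _ (by omega) (M ⧸ Submodule.span (TL q n) {x}) rfl
    have hle := finrank_span_le_ballot hq s hex hJ
    have hsum := weightedSum_add_le
      (stdDim_le_of_surjective (Submodule.span (TL q n) {x}).mkQ_surjective)
      (stdDim_lt_of_surjective hq h (Submodule.mkQ_surjective _) hx hex
        ((Submodule.Quotient.mk_eq_zero _).2 (Submodule.mem_span_singleton_self x)))
    omega

variable (q n) in
/-- The bound `finrank_le_weightedSum_stdDim` is attained by `M`. This is the case exactly
for the modules with a standard filtration. -/
def IsStdGood (M : Type v) [AddCommGroup M] [Module (TL q n) M] [Module k M]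
    [IsScalarTower k (TL q n) M] : Prop :=
  weightedSum (stdDim q n M) ≤ Module.finrank k M

theorem IsStdGood.of_isCompl [Module.Finite k M] (hq : (q : k) + (q : k)⁻¹ ≠ 0)
    (h : IsStdGood q n M) {P P' : Submodule (TL q n) M} (hP : IsCompl P P') : IsStdGood q n P := by
  have hfin := finite_submodule (k := k) P'
  have h₁ := weightedSum_mono (stdDim_add_le_of_splitting (k := k) (i := P.subtype)
    (j := P'.subtype) (f := P.projectionOnto P' hP) (g := P'.projectionOnto P hP.symm)
    (by simp) (by simp) (by simp) (by simp))
  have h₂ := finrank_le_weightedSum_stdDim (n := n) P' hq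
  have h₃ := finrank_range_add_finrank_ker' (k := k) (P.projectionOnto P' hP)
  rw [Submodule.range_projectionOnto, Submodule.ker_projectionOnto] at h₃
  have h₄ : Module.finrank k (⊤ : Submodule (TL q n) P) = Module.finrank k P :=
    (Submodule.topEquiv.restrictScalars k).finrank_eq
  rw [weightedSum_add] at h₁
  unfold IsStdGood at *
  omega

/-- In a module attaining the bound, a nonzero vector of `e_l M`, for the largest possible `l`,
generates a standard module, and the quotient by it attains the bound again. -/
theorem IsStdGood.top_step [Module.Finite k M] (hq : (q : k) + (q : k)⁻¹ ≠ 0)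
    (hM : IsStdGood q n M) {s : Weight n}
    (h : ∀ x : M, heredityIdem q n (s.cups + 1) • x = 0) {x : M} (hx : x ≠ 0)
    (hex : heredityIdem q n s.cups • x = x) :
    Nonempty (Submodule.span (TL q n) {x} ≃ₗ[TL q n] Standard q n s) ∧
      (∀ a : TL q n, a • x = 0 →
        a * heredityIdem q n s.cups ∈ heredityIdeal q n (s.cups + 1)) ∧
      Module.finrank k (Submodule.span (TL q n) {x}) = ballot n s.cups ∧
      IsStdGood q n (M ⧸ Submodule.span (TL q n) {x}) := by
  have hJ : ∀ a ∈ heredityIdeal q n (s.cups + 1), a • x = 0 :=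
    fun a ha => smul_eq_zero_of_heredityIdem h ha x
  have hfin := finite_quotient (k := k) (Submodule.span (TL q n) {x})
  have hadd := finrank_quotient_add_finrank' (k := k) (Submodule.span (TL q n) {x})
  have hle := finrank_span_le_ballot hq s hex hJ
  have hsum := weightedSum_add_le
    (stdDim_le_of_surjective (Submodule.span (TL q n) {x}).mkQ_surjective)
    (stdDim_lt_of_surjective hq h (Submodule.mkQ_surjective _) hx hex
        ((Submodule.Quotient.mk_eq_zero _).2 (Submodule.mem_span_singleton_self x)))
  have hquot := finrank_le_weightedSum_stdDim (n := n) (M ⧸ Submodule.span (TL q n) {x}) hq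
  unfold IsStdGood at *
  have h₁ := standard_equiv_of_finrank_eq hq s hex hJ (by omega)
  exact ⟨h₁.1, h₁.2, by omega, by omega⟩

theorem IsStdGood.hasStandardFiltration [Module.Finite k M] (hq : (q : k) + (q : k)⁻¹ ≠ 0)
    (hM : IsStdGood q n M) : ∃ m, HasStandardFiltration q n M m := by
  induction hd : Module.finrank k M using Nat.strong_induction_on generalizing M with
  | _ d ih =>
    subst hd
    rcases subsingleton_or_nontrivial M with hM' | hM'
    · exact ⟨0, HasFiltration.of_subsingleton M⟩
    obtain ⟨s, h, x, hx, hex⟩ := exists_top_weight (n := n) hq M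
    obtain ⟨hiso, -, hrank, hgood⟩ := hM.top_step hq h hx hex
    have hfin := finite_quotient (k := k) (Submodule.span (TL q n) {x})
    have hadd := finrank_quotient_add_finrank' (k := k) (Submodule.span (TL q n) {x})
    have hpos := ballot_pos s.two_mul_cups_le
    obtain ⟨m, hm⟩ := ih _ (by omega) hgood rfl
    exact ⟨_, HasFiltration.cons _ hiso hm⟩

theorem stdDim_standard_of_ne (hq : (q : k) + (q : k)⁻¹ ≠ 0) {s t : Weight n} (h : t ≠ s) :
    stdDim q n (Standard q n s) t = 0 := by
  have hne : t.cups ≠ s.cups := fun h' => h (Weight.ext_cups h')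
  rw [stdDim]
  suffices hb : stdFunctionals q n t.cups (Standard q n s) = ⊥ by
    rw [hb, finrank_bot]
  refine (Submodule.eq_bot_iff _).2 fun φ hφ => LinearMap.ext ?_
  rintro ⟨y, hy⟩
  obtain ⟨a, rfl⟩ := Submodule.mem_span_singleton.1 hy
  rcases lt_or_gt_of_ne hne with hlt | hgt
  · have hmem : a * heredityIdem q n s.cups ∈ heredityIdeal q n (t.cups + 1) :=
      mul_mem_heredityIdeal a (heredityIdeal_antitone hq hlt (heredityIdem_mem s.cups))
    have h0 := hφ.2 _ hmem ⟨_, Submodule.mem_span_singleton_self _⟩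
    rw [LinearMap.zero_apply, ← h0]
    congr 1
    refine Subtype.ext ?_
    change a • _ = (a * heredityIdem q n s.cups) • (heredityIdeal q n (s.cups + 1)).mkQ
      (heredityIdem q n s.cups)
    rw [mul_smul, ← map_smul (heredityIdeal q n (s.cups + 1)).mkQ (heredityIdem q n s.cups),
      smul_eq_mul, heredityIdem_mul_self hq]
  · rw [LinearMap.zero_apply, ← hφ.1, ← map_zero φ]
    congr 1
    refine Subtype.ext ?_
    change heredityIdem q n t.cups • a • (heredityIdeal q n (s.cups + 1)).mkQ
      (heredityIdem q n s.cups) = 0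
    rw [← map_smul, ← map_smul]
    refine (Submodule.Quotient.mk_eq_zero _).2 ?_
    exact heredityIdeal_mul_mem q n _ _ _ (heredityIdeal_antitone hq hgt (heredityIdem_mem t.cups))

end StandardCriterion

/-! ### A dimension criterion for costandard filtrations -/

section CostandardCriterion

variable {k : Type u} [Field k] {q : kˣ} {n : ℕ}

variable (q n) in
/-- The vectors `x ∈ M` with `e_l x = x` and `J_{l+1} x = 0`; this space is isomorphic to
`Hom(Δ(n - 2 l), M)`. -/
def costdVectors (l : ℕ) (M : Type v) [AddCommGroup M] [Module (TL q n) M] [Module k M]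
    [IsScalarTower k (TL q n) M] : Submodule k M where
  carrier := {x | heredityIdem q n l • x = x ∧ ∀ a ∈ heredityIdeal q n (l + 1), a • x = 0}
  add_mem' hx hy := ⟨by rw [smul_add, hx.1, hy.1],
    fun a ha => by rw [smul_add, hx.2 a ha, hy.2 a ha, add_zero]⟩
  zero_mem' := ⟨smul_zero _, fun _ _ => smul_zero _⟩
  smul_mem' c x hx := ⟨by rw [smul_comm, hx.1], fun a ha => by
    rw [smul_comm, hx.2 a ha, smul_zero]⟩

variable (q n) in
/-- The dimensions of the spaces `Hom(Δ(s), M)`. -/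
def costdDim (M : Type v) [AddCommGroup M] [Module (TL q n) M] [Module k M]
    [IsScalarTower k (TL q n) M] (s : Weight n) : ℕ :=
  Module.finrank k (costdVectors q n s.cups M)

variable {M : Type v} [AddCommGroup M] [Module (TL q n) M] [Module k M]
  [IsScalarTower k (TL q n) M]
  {N : Type w} [AddCommGroup N] [Module (TL q n) N] [Module k N]
  [IsScalarTower k (TL q n) N]
  {Q : Type x} [AddCommGroup Q] [Module (TL q n) Q] [Module k Q]
  [IsScalarTower k (TL q n) Q]

/-- The restriction of a module homomorphism to the spaces `costdVectors`. -/
def costdPush (l : ℕ) (f : M →ₗ[TL q n] N) :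
    costdVectors q n l M →ₗ[k] costdVectors q n l N :=
  (f.restrictScalars k).restrict fun x hx =>
    ⟨by rw [LinearMap.restrictScalars_apply, ← map_smul, hx.1],
      fun a ha => by rw [LinearMap.restrictScalars_apply, ← map_smul, hx.2 a ha, map_zero]⟩

theorem costdPush_injective (l : ℕ) {f : M →ₗ[TL q n] N} (hf : Function.Injective f) :
    Function.Injective (costdPush (k := k) l f) :=
  fun _ _ h => Subtype.ext (hf (congrArg Subtype.val h))

theorem costdDim_le_of_injective [Module.Finite k N] {f : M →ₗ[TL q n] N}
    (hf : Function.Injective f) : costdDim q n M ≤ costdDim q n N := fun _ =>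
  LinearMap.finrank_le_finrank_of_injective (costdPush_injective _ hf)

theorem costdDim_add_le_of_splitting [Module.Finite k M] {i : N →ₗ[TL q n] M}
    {j : Q →ₗ[TL q n] M} {f : M →ₗ[TL q n] N} {g : M →ₗ[TL q n] Q} (hfi : ∀ x, f (i x) = x)
    (hgi : ∀ x, g (i x) = 0) (hfj : ∀ x, f (j x) = 0) (hgj : ∀ x, g (j x) = x) :
    costdDim q n N + costdDim q n Q ≤ costdDim q n M := by
  intro s
  have := Module.Finite.of_surjective (f.restrictScalars k) fun x => ⟨i x, hfi x⟩
  have := Module.Finite.of_surjective (g.restrictScalars k) fun x => ⟨j x, hgj x⟩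
  let F := (costdPush (k := k) s.cups i).coprod (costdPush (k := k) s.cups j)
  have hF : Function.Injective F := by
    refine (injective_iff_map_eq_zero F).2 ?_
    rintro ⟨x, y⟩ h0
    have h1 : i x.1 + j y.1 = 0 := congrArg Subtype.val h0
    refine Prod.ext (Subtype.ext ?_) (Subtype.ext ?_)
    · simpa [hfi, hfj] using congrArg f h1
    · simpa [hgi, hgj] using congrArg g h1
  have hle := LinearMap.finrank_le_finrank_of_injective hF
  rwa [Module.finrank_prod] at hle

/-- At the top weight `s` every vector of `e_l M` counts for `Hom(Δ(s), M)`, so its absence from a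
submodule lowers the dimension. -/
theorem costdDim_lt_of_injective [Module.Finite k M] {s : Weight n}
    (h : ∀ x : M, heredityIdem q n (s.cups + 1) • x = 0) {f : N →ₗ[TL q n] M}
    (hf : Function.Injective f) {x : M} (hex : heredityIdem q n s.cups • x = x)
    (hfx : x ∉ LinearMap.range f) : costdDim q n N s + 1 ≤ costdDim q n M s := by
  have hinj := costdPush_injective (k := k) s.cups hf
  rw [costdDim, costdDim, ← LinearMap.finrank_range_of_inj hinj]
  refine Submodule.finrank_lt fun htop => hfx ?_
  have hmem : (⟨x, hex, fun a ha => smul_eq_zero_of_heredityIdem h ha x⟩ :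
    costdVectors q n s.cups M) ∈ (⊤ : Submodule k _) := trivial
  rw [← htop] at hmem
  obtain ⟨y, hy⟩ := hmem
  exact ⟨y.1, congrArg Subtype.val hy⟩

/-- The homomorphism to a costandard module that corresponds to a linear functional on `e_l M`,
for `M` annihilated by `e_{l+1}`. -/
def homCostandard (hq : (q : k) + (q : k)⁻¹ ≠ 0) {s : Weight n}
    (h : ∀ x : M, heredityIdem q n (s.cups + 1) • x = 0) (φ : M →ₗ[k] k) :
    M →ₗ[TL q n] Costandard q n s where
  toFun x := ⟨(φ ∘ₗ (LinearMap.toSpanSingleton (TL q n) M x).restrictScalars k ∘ₗ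
      LinearMap.mulLeft k (heredityIdem q n s.cups) : TL q n →ₗ[k] k),
    fun a ha => by
      change φ ((heredityIdem q n s.cups * a) • x) = 0
      rw [mul_smul, smul_eq_zero_of_heredityIdem h ha, smul_zero, map_zero],
    fun a => by
      change φ ((heredityIdem q n s.cups * (heredityIdem q n s.cups * a)) • x) =
        φ ((heredityIdem q n s.cups * a) • x)
      rw [← mul_assoc, heredityIdem_mul_self hq]⟩
  map_add' x y := Subtype.ext (LinearMap.ext fun a => by
    change φ ((heredityIdem q n s.cups * a) • (x + y)) =
      φ ((heredityIdem q n s.cups * a) • x) + φ ((heredityIdem q n s.cups * a) • y)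
    rw [smul_add, map_add])
  map_smul' c x := Subtype.ext (LinearMap.ext fun a => by
    change φ ((heredityIdem q n s.cups * a) • c • x) = φ ((heredityIdem q n s.cups * (a * c)) • x)
    rw [← mul_smul, mul_assoc])

theorem homCostandard_apply (hq : (q : k) + (q : k)⁻¹ ≠ 0) {s : Weight n}
    (h : ∀ x : M, heredityIdem q n (s.cups + 1) • x = 0) (φ : M →ₗ[k] k) (x : M) (a : TL q n) :
    (homCostandard hq h φ x).1 a = φ ((heredityIdem q n s.cups * a) • x) := rfl

/-- A nonzero module has a nonzero homomorphism to a costandard module `∇(s)`, for its top weight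
`s`, whose kernel has a smaller space `Hom(Δ(s), -)`. -/
theorem exists_costandard_kernel [Module.Finite k M] (hq : (q : k) + (q : k)⁻¹ ≠ 0)
    [Nontrivial M] : ∃ (s : Weight n) (r : M →ₗ[TL q n] Costandard q n s),
      LinearMap.ker r ≠ ⊤ ∧
      weightedSum (costdDim q n (LinearMap.ker r)) + ballot n s.cups ≤
        weightedSum (costdDim q n M) := by
  obtain ⟨s, h, x, hx, hex⟩ := exists_top_weight (n := n) hq M
  obtain ⟨φ, hφ⟩ := Module.Projective.exists_dual_ne_zero k hx
  have hxr : homCostandard hq h φ x ≠ 0 := fun h0 => hφ <| by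
    have h1 : (homCostandard hq h φ x).1 1 = 0 := by rw [h0]; rfl
    rwa [homCostandard_apply, mul_one, hex] at h1
  have hxr' : x ∉ LinearMap.ker (homCostandard hq h φ) := hxr
  refine ⟨s, homCostandard hq h φ, fun htop => hxr' (htop ▸ trivial), weightedSum_add_le
    (costdDim_le_of_injective (Submodule.injective_subtype _))
    (costdDim_lt_of_injective h (Submodule.injective_subtype _) hex ?_)⟩
  rwa [Submodule.range_subtype]

variable (M) in
/-- The dimension of `M` is bounded by that of a module with the costandard multiplicities
`dim Hom(Δ(s), M)`. -/
theorem finrank_le_weightedSum_costdDim [Module.Finite k M] (hq : (q : k) + (q : k)⁻¹ ≠ 0) :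
    Module.finrank k M ≤ weightedSum (costdDim q n M) := by
  induction hd : Module.finrank k M using Nat.strong_induction_on generalizing M with
  | _ d ih =>
    subst hd
    rcases subsingleton_or_nontrivial M with hM | hM
    · rw [Module.finrank_zero_of_subsingleton]
      exact Nat.zero_le _
    obtain ⟨s, r, htop, hsum⟩ := exists_costandard_kernel (n := n) (M := M) hq
    have hadd := finrank_range_add_finrank_ker' (k := k) r
    have hfin := (finite_finrank_costandard hq s).1
    have hfin' := finite_submodule (k := k) (LinearMap.range r)
    have hfin'' := finite_submodule (k := k) (LinearMap.ker r)
    have hnt : Nontrivial (LinearMap.range r) :=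
      (Submodule.nontrivial_iff_ne_bot).2 fun hb => htop (LinearMap.ker_eq_top.2
        (LinearMap.range_eq_bot.1 hb))
    have hpos := Module.finrank_pos (R := k) (M := LinearMap.range r)
    have hih := ih _ (by omega) (LinearMap.ker r) rfl
    have hle : Module.finrank k (LinearMap.range r) ≤ Module.finrank k (Costandard q n s) :=
      Submodule.finrank_le ((LinearMap.range r).restrictScalars k)
    have hle' := (finite_finrank_costandard hq s).2
    omega

variable (q n) in
/-- The bound `finrank_le_weightedSum_costdDim` is attained by `M`. This is sufficient for the
existence of a costandard filtration. -/
def IsCostdGood (M : Type v) [AddCommGroup M] [Module (TL q n) M] [Module k M]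
    [IsScalarTower k (TL q n) M] : Prop :=
  weightedSum (costdDim q n M) ≤ Module.finrank k M

theorem IsCostdGood.of_isCompl [Module.Finite k M] (hq : (q : k) + (q : k)⁻¹ ≠ 0)
    (h : IsCostdGood q n M) {P P' : Submodule (TL q n) M} (hP : IsCompl P P') :
    IsCostdGood q n P := by
  have hfin := finite_submodule (k := k) P'
  have h₁ := weightedSum_mono (costdDim_add_le_of_splitting (k := k) (i := P.subtype)
    (j := P'.subtype) (f := P.projectionOnto P' hP) (g := P'.projectionOnto P hP.symm)
    (by simp) (by simp) (by simp) (by simp))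
  have h₂ := finrank_le_weightedSum_costdDim (n := n) P' hq
  have h₃ := finrank_range_add_finrank_ker' (k := k) (P.projectionOnto P' hP)
  rw [Submodule.range_projectionOnto, Submodule.ker_projectionOnto] at h₃
  have h₄ : Module.finrank k (⊤ : Submodule (TL q n) P) = Module.finrank k P :=
    (Submodule.topEquiv.restrictScalars k).finrank_eq
  rw [weightedSum_add] at h₁
  unfold IsCostdGood at *
  omega

theorem IsCostdGood.hasCostandardFiltration [Module.Finite k M]
    (hq : (q : k) + (q : k)⁻¹ ≠ 0) (hM : IsCostdGood q n M) :
    ∃ m, HasCostandardFiltration q n M m := by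
  induction hd : Module.finrank k M using Nat.strong_induction_on generalizing M with
  | _ d ih =>
    subst hd
    rcases subsingleton_or_nontrivial M with hM' | hM'
    · exact ⟨0, HasFiltration.of_subsingleton M⟩
    obtain ⟨s, r, htop, hsum⟩ := exists_costandard_kernel (n := n) (M := M) hq
    have hadd := finrank_range_add_finrank_ker' (k := k) r
    have hfin := (finite_finrank_costandard hq s).1
    have hfin' := finite_submodule (k := k) (LinearMap.ker r)
    have hle : Module.finrank k (LinearMap.range r) ≤ Module.finrank k (Costandard q n s) :=
      Submodule.finrank_le ((LinearMap.range r).restrictScalars k)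
    have hle' := (finite_finrank_costandard hq s).2
    have hker := finrank_le_weightedSum_costdDim (n := n) (LinearMap.ker r) hq
    have hpos := ballot_pos s.two_mul_cups_le
    unfold IsCostdGood at hM
    have hsurj : Function.Surjective r := by
      refine LinearMap.range_eq_top.1 ((Submodule.restrictScalars_eq_top_iff k _ _).1
        (Submodule.eq_top_of_finrank_eq (le_antisymm hle ?_)))
      change _ ≤ Module.finrank k (LinearMap.range r)
      omega
    obtain ⟨m, hm⟩ := ih (Module.finrank k (LinearMap.ker r)) (by omega) (M := LinearMap.ker r)
      (by unfold IsCostdGood; omega) rfl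
    exact ⟨_, HasFiltration.snoc _ hm ⟨LinearMap.quotKerEquivOfSurjective r hsurj⟩⟩

end CostandardCriterion

/-! ### Extension of homomorphisms into costandardly filtered modules -/

section Extension

variable {k : Type u} [Field k] {q : kˣ} {n : ℕ}

theorem smul_costandard_eq_zero {t : Weight n} {a : TL q n}
    (ha : a ∈ heredityIdeal q n (t.cups + 1)) (f : Costandard q n t) : a • f = 0 :=
  Subtype.ext (LinearMap.ext fun b => f.2.1 _ (mul_mem_heredityIdeal b ha))

/-- The lifting property of `HasCostandardFiltration.exists_lift` for a single costandard module. -/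
theorem exists_lift_costandard (hq : (q : k) + (q : k)⁻¹ ≠ 0) {t : Weight n} {E : Type w}
    [AddCommGroup E] [Module (TL q n) E] [Module k E] [IsScalarTower k (TL q n) E]
    (i : Costandard q n t →ₗ[TL q n] E) (hi : Function.Injective i) {l : ℕ} {x : E}
    (hx : heredityIdem q n l • x - x ∈ LinearMap.range i)
    (hJ : ∀ a ∈ heredityIdeal q n (l + 1), a • x ∈ LinearMap.range i) :
    ∃ y, heredityIdem q n l • (x + i y) = x + i y ∧
      ∀ a ∈ heredityIdeal q n (l + 1), a • (x + i y) = 0 := by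
  have hkill : ∀ b ≥ t.cups + 1, b ≥ l + 1 → ∀ a ∈ heredityIdeal q n b, a • x = 0 := by
    intro b hb hbl a ha
    refine smul_eq_zero_of_heredityIdeal hq (fun c hc d hd => ?_) ha
    obtain ⟨y, hy⟩ := hJ d (heredityIdeal_antitone hq hbl hd)
    rw [← hy, ← map_smul, smul_costandard_eq_zero (heredityIdeal_antitone hq hb hc), map_zero]
  rcases le_or_gt t.cups l with htl | htl
  · -- here `J_{l+1}` annihilates `x` already, and `e_l • x` is the required vector
    obtain ⟨y, hy⟩ := hx
    have hz : x + i y = heredityIdem q n l • x := by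
      rw [hy]
      abel
    refine ⟨y, by rw [hz, ← mul_smul, heredityIdem_mul_self hq], fun a ha => ?_⟩
    rw [hz, ← mul_smul]
    exact hkill (l + 1) (by omega) le_rfl _ (heredityIdeal_mul_mem q n _ _ _ ha)
  · -- `ψ` extends the functional `f ↦ f 1` from the image of the costandard module to `E`
    obtain ⟨ρ, hρ⟩ := LinearMap.exists_leftInverse_of_injective (i.restrictScalars k)
      (LinearMap.ker_eq_bot.2 hi)
    let ψ : E →ₗ[k] k :=
      { toFun z := (ρ z).1 1
        map_add' z z' := by rw [map_add]; rfl
        map_smul' c z := by rw [map_smul]; rfl }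
    have hψ : ∀ f, ψ (i f) = f.1 1 := fun f => by
      have h1 : ρ (i f) = f := LinearMap.congr_fun hρ f
      change (ρ (i f)).1 1 = f.1 1
      rw [h1]
    let y₀ : Costandard q n t :=
      ⟨(ψ ∘ₗ (LinearMap.toSpanSingleton (TL q n) E x).restrictScalars k ∘ₗ
          LinearMap.mulLeft k (heredityIdem q n t.cups) : TL q n →ₗ[k] k),
        fun a ha => by
          change ψ ((heredityIdem q n t.cups * a) • x) = 0
          rw [hkill (t.cups + 1) le_rfl (by omega) _ (mul_mem_heredityIdeal _ ha), map_zero],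
        fun a => by
          change ψ ((heredityIdem q n t.cups * (heredityIdem q n t.cups * a)) • x) =
            ψ ((heredityIdem q n t.cups * a) • x)
          rw [← mul_assoc, heredityIdem_mul_self hq]⟩
    have hy₀ : ∀ b, y₀.1 b = ψ ((heredityIdem q n t.cups * b) • x) := fun b => rfl
    have key : ∀ a : TL q n, a • x ∈ LinearMap.range i → a • (x + i (-y₀)) = 0 := by
      rintro a ⟨y, hy⟩
      rw [map_neg, ← sub_eq_add_neg, smul_sub, ← hy, ← map_smul, ← map_sub, sub_eq_zero.2, map_zero]
      refine Subtype.ext (LinearMap.ext fun b => ?_)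
      change y.1 b = y₀.1 (b * a)
      rw [hy₀, ← mul_assoc, mul_smul, ← hy, ← map_smul, hψ, ← y.2.2 b]
      change _ = y.1 (1 * (heredityIdem q n t.cups * b))
      rw [one_mul]
    refine ⟨-y₀, ?_, fun a ha => key a (hJ a ha)⟩
    have h1 := key (heredityIdem q n l - 1) (by rwa [sub_smul, one_smul])
    rwa [sub_smul, one_smul, sub_eq_zero] at h1

/-- The vanishing of `Ext¹(Δ(s), Y)` for a module `Y` with a costandard filtration: a homomorphism
from `Δ(s)` to `E / Y` lifts to `E`. -/
theorem HasCostandardFiltration.exists_lift (hq : (q : k) + (q : k)⁻¹ ≠ 0) {Y : Type v}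
    [AddCommGroup Y] [Module (TL q n) Y] {m : Weight n → ℕ}
    (hY : HasCostandardFiltration q n Y m) :
    ∀ (E : Type w) [AddCommGroup E] [Module (TL q n) E] [Module k E] [IsScalarTower k (TL q n) E]
      (i : Y →ₗ[TL q n] E), Function.Injective i → ∀ (l : ℕ) (x : E),
      heredityIdem q n l • x - x ∈ LinearMap.range i →
      (∀ a ∈ heredityIdeal q n (l + 1), a • x ∈ LinearMap.range i) →
      ∃ y, heredityIdem q n l • (x + i y) = x + i y ∧
        ∀ a ∈ heredityIdeal q n (l + 1), a • (x + i y) = 0 := by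
  refine HasFiltration.induction (A := TL q n) (D := fun s : Weight n => Costandard q n s)
    (P := fun (Y : Type v) [AddCommGroup Y] [Module (TL q n) Y] _ =>
      ∀ (E : Type w) [AddCommGroup E] [Module (TL q n) E] [Module k E]
        [IsScalarTower k (TL q n) E] (i : Y →ₗ[TL q n] E), Function.Injective i →
        ∀ (l : ℕ) (x : E), heredityIdem q n l • x - x ∈ LinearMap.range i →
        (∀ a ∈ heredityIdeal q n (l + 1), a • x ∈ LinearMap.range i) →
        ∃ y, heredityIdem q n l • (x + i y) = x + i y ∧
          ∀ a ∈ heredityIdeal q n (l + 1), a • (x + i y) = 0) ?_ ?_ hY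
  · intro Y _ _ hY E _ _ _ _ i hi l x hx hJ
    have h0 : LinearMap.range i = ⊥ := by
      rw [LinearMap.range_eq_bot]
      exact LinearMap.ext fun y => by rw [Subsingleton.elim y 0, map_zero, map_zero]
    rw [h0] at hx
    refine ⟨0, ?_, fun a ha => ?_⟩
    · rw [map_zero, add_zero]
      exact sub_eq_zero.1 hx
    · have h1 := hJ a ha
      rw [h0] at h1
      rw [map_zero, add_zero]
      exact h1
  · intro Y _ _ K m t ih ⟨φ⟩ E _ _ _ _ i hi l x hx hJ
    let p : E →ₗ[TL q n] E ⧸ K.map i := (K.map i).mkQ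
    have hp : ∀ z, p z = 0 ↔ z ∈ K.map i := fun z => Submodule.Quotient.mk_eq_zero _
    let i₁ : (Y ⧸ K) →ₗ[TL q n] E ⧸ K.map i := K.liftQ (p ∘ₗ i) fun y hy =>
      (hp _).2 (Submodule.mem_map_of_mem hy)
    have hi₁ : ∀ y, i₁ (K.mkQ y) = p (i y) := fun y => rfl
    have hinj : Function.Injective i₁ := by
      refine (injective_iff_map_eq_zero i₁).2 fun y' h0 => ?_
      obtain ⟨y, rfl⟩ := K.mkQ_surjective y'
      rw [hi₁, hp] at h0
      obtain ⟨y₂, hy₂, h2⟩ := h0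
      rw [hi h2] at hy₂
      exact (Submodule.Quotient.mk_eq_zero _).2 hy₂
    have hrange : ∀ z, z ∈ LinearMap.range i →
        p z ∈ LinearMap.range (i₁ ∘ₗ φ.symm.toLinearMap) := by
      rintro z ⟨y, rfl⟩
      refine ⟨φ (K.mkQ y), ?_⟩
      rw [LinearMap.comp_apply, LinearEquiv.coe_coe, LinearEquiv.symm_apply_apply, hi₁]
    have h1 := exists_lift_costandard hq (i₁ ∘ₗ φ.symm.toLinearMap)
      (hinj.comp φ.symm.injective) (l := l) (x := p x)
      (by rw [← map_smul, ← map_sub]; exact hrange _ hx)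
      (fun a ha => by rw [← map_smul]; exact hrange _ (hJ a ha))
    obtain ⟨f, hf1, hf2⟩ := h1
    obtain ⟨y₁, hy₁⟩ := K.mkQ_surjective (φ.symm f)
    have hf : p x + (i₁ ∘ₗ φ.symm.toLinearMap) f = p (x + i y₁) := by
      rw [map_add, ← hi₁, hy₁]
      rfl
    rw [hf, ← map_smul, ← sub_eq_zero, ← map_sub, hp] at hf1
    have hK : ∀ z, z ∈ K.map i → z ∈ LinearMap.range (i ∘ₗ K.subtype) := by
      rintro z ⟨y, hy, rfl⟩
      exact ⟨⟨y, hy⟩, rfl⟩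
    have h2 := ih E (i ∘ₗ K.subtype) (hi.comp K.injective_subtype) l (x + i y₁) (hK _ hf1)
      (fun a ha => hK _ ((hp _).1 (by rw [map_smul, ← hf, hf2 a ha])))
    obtain ⟨y₂, hy₂, hy₂'⟩ := h2
    have he : x + i y₁ + (i ∘ₗ K.subtype) y₂ = x + i (y₁ + y₂.1) := by
      rw [map_add, add_assoc]
      rfl
    rw [he] at hy₂ hy₂'
    exact ⟨_, hy₂, hy₂'⟩

/-- The extension of a partially defined homomorphism by one more vector. -/
theorem HasCostandardFiltration.exists_extend_singleton (hq : (q : k) + (q : k)⁻¹ ≠ 0)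
    {M : Type w} [AddCommGroup M] [Module (TL q n) M] [Module k M] [IsScalarTower k (TL q n) M]
    {Y : Type v} [AddCommGroup Y] [Module (TL q n) Y] [Module k Y] [IsScalarTower k (TL q n) Y]
    {m : Weight n → ℕ} (hY : HasCostandardFiltration q n Y m) (f : M →ₗ.[TL q n] Y) {l : ℕ} {x : M}
    (hx : heredityIdem q n l • x - x ∈ f.domain)
    (hJ : ∀ a ∈ heredityIdeal q n (l + 1), a • x ∈ f.domain)
    (hann : ∀ a : TL q n, a • x ∈ f.domain →
      a * heredityIdem q n l ∈ heredityIdeal q n (l + 1)) :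
    ∃ g : M →ₗ.[TL q n] Y, f ≤ g ∧ g.domain = f.domain ⊔ Submodule.span (TL q n) {x} := by
  let h : f.domain →ₗ[TL q n] Y × M := f.toFun.prod (-f.domain.subtype)
  let p : (Y × M) →ₗ[TL q n] (Y × M) ⧸ LinearMap.range h := (LinearMap.range h).mkQ
  have hp : ∀ z, p z = 0 ↔ z ∈ LinearMap.range h := fun z => Submodule.Quotient.mk_eq_zero _
  have hinj : Function.Injective (p ∘ₗ LinearMap.inl (TL q n) Y M) := by
    refine (injective_iff_map_eq_zero _).2 fun y hy => ?_
    obtain ⟨b, hb⟩ := (hp (y, 0)).1 hy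
    have hb1 : f b = y := congrArg Prod.fst hb
    have hb2 : -(b : M) = 0 := congrArg Prod.snd hb
    rw [← hb1, show b = 0 from Subtype.ext (neg_eq_zero.1 hb2)]
    exact f.map_zero
  have hrange : ∀ z ∈ f.domain,
      p (0, z) ∈ LinearMap.range (p ∘ₗ LinearMap.inl (TL q n) Y M) := by
    intro z hz
    refine ⟨f ⟨z, hz⟩, ?_⟩
    change p (f ⟨z, hz⟩, 0) = p (0, z)
    rw [← sub_eq_zero, ← map_sub, hp]
    exact ⟨⟨z, hz⟩, Prod.ext (sub_zero _).symm (zero_sub _).symm⟩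
  have hlift := hY.exists_lift hq ((Y × M) ⧸ LinearMap.range h)
    (p ∘ₗ LinearMap.inl (TL q n) Y M) hinj l (p (0, x)) ?_ ?_
  · obtain ⟨y, hy, hyJ⟩ := hlift
    have he : p (0, x) + (p ∘ₗ LinearMap.inl (TL q n) Y M) y = p (y, x) := by
      change p (0, x) + p (y, 0) = _
      rw [← map_add, Prod.mk_add_mk, zero_add, add_zero]
    rw [he] at hy hyJ
    -- on the intersection of the two domains the value at `a • x` is forced to be `-(a • y)`
    have hcomp : ∀ (a : TL q n) (z : f.domain), (z : M) = a • x → f z = a • -y := by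
      intro a z hz
      have h0 : p (a • y, a • x) = 0 := by
        have h1 := hyJ _ (hann a (hz ▸ z.2))
        rwa [mul_smul, hy, ← map_smul] at h1
      obtain ⟨b, hb⟩ := (hp _).1 h0
      have hb1 : f b = a • y := congrArg Prod.fst hb
      have hb2 : -(b : M) = a • x := congrArg Prod.snd hb
      have hzb : z = -b := Subtype.ext (hz.trans hb2.symm)
      rw [hzb, f.map_neg, hb1, smul_neg]
    have H : ∀ a : TL q n, a • x = 0 → a • -y = 0 := fun a ha => by
      rw [← hcomp a 0 ha.symm, f.map_zero]
    let g := LinearPMap.mkSpanSingleton' (σ := RingHom.id (TL q n)) x (-y) H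
    refine ⟨f.sup g fun z z' hzz => ?_, LinearPMap.left_le_sup _ _ _, rfl⟩
    obtain ⟨z', hz'⟩ := z'
    obtain ⟨a, rfl⟩ := Submodule.mem_span_singleton.1 hz'
    rw [hcomp a z hzz]
    exact (LinearPMap.mkSpanSingleton'_apply x (-y) H a hz').symm
  · rw [← map_smul, ← map_sub]
    have := hrange _ hx
    rwa [show heredityIdem q n l • ((0 : Y), x) - (0, x) =
      (0, heredityIdem q n l • x - x) from Prod.ext (by simp) rfl]
  · intro a ha
    rw [← map_smul]
    have := hrange _ (hJ a ha)
    rwa [show a • ((0 : Y), x) = (0, a • x) from Prod.ext (by simp) rfl]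

/-- Homomorphisms into a module with a costandard filtration extend along an inclusion whose
cokernel has a standard filtration. -/
theorem HasCostandardFiltration.exists_extend (hq : (q : k) + (q : k)⁻¹ ≠ 0)
    {M : Type w} [AddCommGroup M] [Module (TL q n) M] [Module k M] [IsScalarTower k (TL q n) M]
    {Y : Type v} [AddCommGroup Y] [Module (TL q n) Y] [Module k Y] [IsScalarTower k (TL q n) Y]
    {m : Weight n → ℕ} (hY : HasCostandardFiltration q n Y m)
    {Q : Type x} [AddCommGroup Q] [Module (TL q n) Q] [Module k Q] [IsScalarTower k (TL q n) Q]
    [Module.Finite k Q] (hQ : IsStdGood q n Q) (f : M →ₗ.[TL q n] Y) (π : M →ₗ[TL q n] Q)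
    (hπ : Function.Surjective π) (hker : LinearMap.ker π = f.domain) :
    ∃ g : M →ₗ[TL q n] Y, ∀ z : f.domain, g z = f z := by
  induction hd : Module.finrank k Q using Nat.strong_induction_on generalizing Q f with
  | _ d ih =>
    subst hd
    rcases subsingleton_or_nontrivial Q with hQ' | hQ'
    · have htop : ∀ z, z ∈ f.domain := fun z => by
        rw [← hker]
        exact Subsingleton.elim _ _
      exact ⟨f.toFun ∘ₗ LinearMap.codRestrict f.domain LinearMap.id htop, fun z => rfl⟩
    obtain ⟨s, h, x', hx', hex'⟩ := exists_top_weight (n := n) hq Q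
    obtain ⟨x, rfl⟩ := hπ x'
    obtain ⟨-, hann, hrank, hgood⟩ := hQ.top_step hq h hx' hex'
    have hmem : ∀ z, z ∈ f.domain ↔ π z = 0 := fun z => by rw [← hker, LinearMap.mem_ker]
    obtain ⟨g, hfg, hg⟩ := hY.exists_extend_singleton hq f (l := s.cups) (x := x)
      ((hmem _).2 (by rw [map_sub, map_smul, hex', sub_self]))
      (fun a ha => (hmem _).2 (by rw [map_smul]; exact smul_eq_zero_of_heredityIdem h ha _))
      (fun a ha => hann a (by rw [← map_smul]; exact (hmem _).1 ha))
    have hfin := finite_quotient (k := k) (Submodule.span (TL q n) {π x})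
    have hadd := finrank_quotient_add_finrank' (k := k) (Submodule.span (TL q n) {π x})
    have hpos := ballot_pos s.two_mul_cups_le
    have hker' : LinearMap.ker ((Submodule.span (TL q n) {π x}).mkQ ∘ₗ π) = g.domain := by
      rw [hg, LinearMap.ker_comp, Submodule.ker_mkQ, ← hker, sup_comm, ← Submodule.comap_map_eq,
        Submodule.map_span, Set.image_singleton]
    obtain ⟨g', hg'⟩ := ih _ (by omega) hgood g _
      ((Submodule.mkQ_surjective (Submodule.span (TL q n) {π x})).comp hπ) hker' rfl
    refine ⟨g', fun z => ?_⟩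
    rw [hg' ⟨z, hfg.1 z.2⟩]
    exact (hfg.2 rfl).symm

end Extension

/-! ### Comparison of tilting modules with a common top weight -/

section Comparison

theorem isSummand_of_comp_bijective {A : Type u} [Ring A] {X : Type v} [AddCommGroup X]
    [Module A X] {Y : Type w} [AddCommGroup Y] [Module A Y] (f : X →ₗ[A] Y) (g : Y →ₗ[A] X)
    (h : Function.Bijective (g ∘ₗ f)) : IsSummand A X Y := by
  have hf : Function.Injective f := Function.Injective.of_comp h.1
  refine ⟨LinearMap.range f, LinearMap.ker g, ⟨?_, ?_⟩, ⟨LinearEquiv.ofInjective f hf⟩⟩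
  · rw [Submodule.disjoint_def]
    rintro _ ⟨x, rfl⟩ hx
    rw [h.1 (show (g ∘ₗ f) x = (g ∘ₗ f) 0 by rw [map_zero]; exact hx), map_zero]
  · rw [codisjoint_iff, eq_top_iff]
    intro y _
    obtain ⟨x, hx⟩ := h.2 (g y)
    refine Submodule.mem_sup.2 ⟨f x, ⟨x, rfl⟩, y - f x, ?_, add_sub_cancel _ _⟩
    rw [LinearMap.mem_ker, map_sub, sub_eq_zero]
    exact hx.symm

/-- By Fitting's lemma an endomorphism of an indecomposable module of finite length that fixes a
nonzero vector is bijective. -/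
theorem IsIndecomposable.bijective_of_fixed {A : Type u} [Ring A] {X : Type v} [AddCommGroup X]
    [Module A X] [IsNoetherian A X] [IsArtinian A X] (hX : IsIndecomposable A X)
    (h : Module.End A X) {x : X} (hx : x ≠ 0) (hhx : h x = x) : Function.Bijective h := by
  obtain ⟨r, hr, hr1⟩ := ((LinearMap.eventually_isCompl_ker_pow_range_pow h).and
    (Filter.eventually_ge_atTop 1)).exists
  have hfix : ∀ j : ℕ, (h ^ j) x = x := fun j => by
    induction j with
    | zero => rfl
    | succ j ih => rw [pow_succ, Module.End.mul_apply, hhx, ih]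
  rcases hX.2 _ _ hr with h0 | h0
  · have hinj : Function.Injective h := by
      refine (injective_iff_map_eq_zero h).2 fun z hz => ?_
      have hmem : z ∈ LinearMap.ker (h ^ r) := by
        obtain ⟨j, rfl⟩ := Nat.exists_eq_add_of_le' hr1
        rw [LinearMap.mem_ker, pow_succ, Module.End.mul_apply, hz, map_zero]
      rw [h0] at hmem
      exact hmem
    exact IsArtinian.bijective_of_injective_endomorphism h hinj
  · have hmem : x ∈ LinearMap.range (h ^ r) := ⟨x, hfix r⟩
    rw [h0] at hmem
    exact absurd hmem hx

variable {k : Type u} [Field k] {q : kˣ} {n : ℕ}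

/-- A module with a standard filtration and top weight `s = n - 2 l` maps to every module with a
costandard filtration that `e_{l+1}` annihilates, a nonzero vector of `e_l X` being taken to an
arbitrary vector of `e_l Y`. -/
theorem IsStdGood.exists_hom_of_top (hq : (q : k) + (q : k)⁻¹ ≠ 0)
    {X : Type v} [AddCommGroup X] [Module (TL q n) X] [Module k X] [IsScalarTower k (TL q n) X]
    [Module.Finite k X] (hX : IsStdGood q n X)
    {Y : Type w} [AddCommGroup Y] [Module (TL q n) Y] [Module k Y] [IsScalarTower k (TL q n) Y]
    {m : Weight n → ℕ} (hY : HasCostandardFiltration q n Y m) {s : Weight n}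
    (hX' : ∀ x : X, heredityIdem q n (s.cups + 1) • x = 0)
    (hY' : ∀ y : Y, heredityIdem q n (s.cups + 1) • y = 0)
    {x : X} (hx : x ≠ 0) (hex : heredityIdem q n s.cups • x = x)
    {y : Y} (hey : heredityIdem q n s.cups • y = y) :
    ∃ f : X →ₗ[TL q n] Y, f x = y := by
  obtain ⟨-, hann, -, hgood⟩ := hX.top_step hq hX' hx hex
  have hfin := finite_quotient (k := k) (Submodule.span (TL q n) {x})
  have H : ∀ a : TL q n, a • x = 0 → a • y = 0 := fun a ha => by
    rw [← hey, ← mul_smul]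
    exact smul_eq_zero_of_heredityIdem hY' (hann a ha) y
  obtain ⟨f, hf⟩ := hY.exists_extend hq hgood
    (LinearPMap.mkSpanSingleton' (σ := RingHom.id (TL q n)) x y H) _ (Submodule.mkQ_surjective _)
    (Submodule.ker_mkQ _)
  refine ⟨f, ?_⟩
  rw [hf ⟨x, Submodule.mem_span_singleton_self x⟩]
  exact LinearPMap.mkSpanSingleton'_apply_self x y H _

/-- An indecomposable tilting module is a summand of every tilting module with the same top
weight. -/
theorem IsIndecomposable.isSummand_of_top (hq : (q : k) + (q : k)⁻¹ ≠ 0)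
    {X : Type v} [AddCommGroup X] [Module (TL q n) X] [Module k X] [IsScalarTower k (TL q n) X]
    [Module.Finite k X] (hind : IsIndecomposable (TL q n) X) (hX : IsStdGood q n X)
    {m : Weight n → ℕ} (hXc : HasCostandardFiltration q n X m)
    {Y : Type w} [AddCommGroup Y] [Module (TL q n) Y] [Module k Y] [IsScalarTower k (TL q n) Y]
    [Module.Finite k Y] (hY : IsStdGood q n Y) {m' : Weight n → ℕ}
    (hYc : HasCostandardFiltration q n Y m') {s : Weight n}
    (hX' : ∀ x : X, heredityIdem q n (s.cups + 1) • x = 0)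
    (hY' : ∀ y : Y, heredityIdem q n (s.cups + 1) • y = 0)
    {x : X} (hx : x ≠ 0) (hex : heredityIdem q n s.cups • x = x)
    {y : Y} (hy : y ≠ 0) (hey : heredityIdem q n s.cups • y = y) : IsSummand (TL q n) X Y := by
  obtain ⟨f, hf⟩ := hX.exists_hom_of_top hq hYc hX' hY' hx hex hey
  obtain ⟨g, hg⟩ := hY.exists_hom_of_top hq hXc hY' hX' hy hey hex
  have := isNoetherian_of_tower (R := k) (S := TL q n) (M := X) inferInstance
  have := isArtinian_of_tower (R := k) (S := TL q n) (M := X) inferInstance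
  exact isSummand_of_comp_bijective f g
    (hind.bijective_of_fixed (g ∘ₗ f) hx (by rw [LinearMap.comp_apply, hf, hg]))

end Comparison

/-! ### Coordinates of extremal vectors of tensor space -/

section Words

variable {k : Type u} [Field k] {q : kˣ} {n : ℕ}

/-- The word `1^a 2^{u-a} (12)^l`, where `u = n - 2 l`. -/
def topWord (s : Weight n) (a : ℕ) : Fin n → Fin 2 := fun j =>
  if (j : ℕ) < a ∨ (s.1 ≤ j ∧ ((j : ℕ) - s.1) % 2 = 0) then 0 else 1

theorem excess_topWord (s : Weight n) {a : ℕ} (ha : a ≤ s.1) :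
    excess (topWord s a) = 2 * a - s.1 := by
  let g : ℕ → ℤ := fun j => if j < a ∨ (s.1 ≤ j ∧ (j - s.1) % 2 = 0) then 1 else -1
  have e : ∀ j : Fin n, (if topWord s a j = 0 then (1 : ℤ) else -1) = g j := fun j => by
    simp only [topWord, g]
    split_ifs <;> simp_all
  have hr : Finset.range n = Finset.range (s.1 + 2 * s.cups) :=
    congrArg Finset.range s.val_add_two_mul_cups.symm
  rw [excess_eq_sum, Finset.sum_congr rfl fun j _ => e j, Fin.sum_univ_eq_sum_range g, hr,
    Finset.sum_range_add]
  have h₁ : ∀ b ≤ s.1, ∑ j ∈ Finset.range b, g j =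
      if b ≤ a then (b : ℤ) else 2 * a - b := by
    intro b
    induction b with
    | zero => simp
    | succ b ih =>
      intro hb
      rw [Finset.sum_range_succ, ih (by omega)]
      simp only [g]
      split_ifs <;> push_cast <;> omega
  have h₂ : ∀ l : ℕ, ∑ j ∈ Finset.range (2 * l), g (s.1 + j) = 0 := by
    intro l
    induction l with
    | zero => simp
    | succ l ih =>
      rw [Nat.mul_succ, Finset.sum_range_succ, Finset.sum_range_succ, ih]
      simp only [g]
      split_ifs <;> omega
  rw [h₁ _ le_rfl, h₂]
  split_ifs <;> omega

/-- The sum of the positions of the letter `1` in a word. -/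
def positionSum (w : Fin n → Fin 2) : ℕ := ∑ j, if w j = 0 then (j : ℕ) else 0

theorem positionSum_replace_lt (i : Fin (n - 1)) {w : Fin n → Fin 2} (h₁ : w (pos₁ i) = 1)
    (h₂ : w (pos₂ i) = 0) : positionSum (replace i 0 1 w) < positionSum w := by
  have key : ∀ v : Fin n → Fin 2, positionSum v =
      ((if v (pos₁ i) = 0 then (i : ℕ) else 0) + (if v (pos₂ i) = 0 then (i : ℕ) + 1 else 0)) +
      ∑ j ∈ (Finset.univ.erase (pos₁ i)).erase (pos₂ i), if v j = 0 then (j : ℕ) else 0 := by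
    intro v
    rw [positionSum, ← Finset.add_sum_erase _ _ (Finset.mem_univ (pos₁ i)), add_assoc,
      ← Finset.add_sum_erase _ _
        (Finset.mem_erase.2 ⟨(pos_ne i).symm, Finset.mem_univ (pos₂ i)⟩)]
    rfl
  have e₁ : (replace i 0 1 w) (pos₁ i) = 0 := by
    simp [replace, Function.update_of_ne (pos_ne i)]
  have e₂ : (replace i 0 1 w) (pos₂ i) = 1 := by simp [replace]
  rw [key, key w, e₁, e₂, h₁, h₂]
  have e₃ : ∑ j ∈ (Finset.univ.erase (pos₁ i)).erase (pos₂ i),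
      (if replace i 0 1 w j = 0 then (j : ℕ) else 0) =
      ∑ j ∈ (Finset.univ.erase (pos₁ i)).erase (pos₂ i), if w j = 0 then (j : ℕ) else 0 := by
    refine Finset.sum_congr rfl fun j hj => ?_
    simp only [Finset.mem_erase, Finset.mem_univ, and_true] at hj
    simp [replace, hj.1, hj.2]
  rw [e₃]
  simp

/-- Coordinates that satisfy the relations of an extremal vector of weight `s` and vanish at the
words `topWord s a` are zero: one examines a word of least `positionSum` in the support. -/
theorem eq_zero_of_topWord (s : Weight n) {f : (Fin n → Fin 2) → k}
    (h₁ : ∀ i : Fin (n - 1), (i : ℕ) + 1 < s.1 → coordGen q n i f = 0)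
    (h₂ : ∀ (i : Fin (n - 1)) (r : ℕ), r < s.cups → (i : ℕ) = s.1 + 2 * r →
      coordGen q n i f = ((q : k) + (q : k)⁻¹) • f)
    (h₀ : ∀ a ≤ s.1, f (topWord s a) = 0) (hq : (q : k) + (q : k)⁻¹ ≠ 0) : f = 0 := by
  classical
  by_contra hf
  obtain ⟨w₀, hw₀⟩ := Function.ne_iff.1 hf
  obtain ⟨w, hw, hmin⟩ := Finset.exists_min_image
    (Finset.univ.filter fun w : Fin n → Fin 2 => f w ≠ 0) positionSum ⟨w₀, by simpa using hw₀⟩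
  simp only [Finset.mem_filter, Finset.mem_univ, true_and] at hw hmin
  have hq0 : (q : k) ≠ 0 := q.ne_zero
  have hn := s.val_add_two_mul_cups
  have hmin' : ∀ i : Fin (n - 1), w (pos₁ i) = 1 → w (pos₂ i) = 0 → f (replace i 0 1 w) = 0 := by
    intro i hi₁ hi₂
    by_contra h
    exact absurd (hmin _ h) (not_le.2 (positionSum_replace_lt i hi₁ hi₂))
  have hhead : ∀ i : Fin (n - 1), (i : ℕ) + 1 < s.1 → w (pos₂ i) = 0 → w (pos₁ i) = 0 := by
    intro i hi hi₂
    rcases fin2_cases (w (pos₁ i)) with hi₁ | hi₁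
    · exact hi₁
    have h := congrFun (h₁ i hi) w
    rw [coordGen_expand, hi₁, hi₂, if_neg (by decide), if_pos rfl, hmin' i hi₁ hi₂,
      replace_self i 1 0 w hi₁ hi₂, zero_add] at h
    exact absurd h (mul_ne_zero (inv_ne_zero hq0) hw)
  have htail : ∀ (i : Fin (n - 1)) (r : ℕ), r < s.cups → (i : ℕ) = s.1 + 2 * r →
      w (pos₁ i) = 0 ∧ w (pos₂ i) = 1 := by
    intro i r hr hi
    have h := congrFun (h₂ i r hr hi) w
    rw [coordGen_expand, Pi.smul_apply, smul_eq_mul] at h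
    have hne : ((q : k) + (q : k)⁻¹) * f w ≠ 0 := mul_ne_zero hq hw
    rcases fin2_cases (w (pos₁ i)) with hi₁ | hi₁ <;> rcases fin2_cases (w (pos₂ i)) with hi₂ | hi₂
    · rw [hi₁, hi₂, if_pos rfl, if_pos rfl] at h
      exact absurd h.symm hne
    · exact ⟨hi₁, hi₂⟩
    · rw [hi₁, hi₂, if_neg (by decide), if_pos rfl, hmin' i hi₁ hi₂, replace_self i 1 0 w hi₁ hi₂,
        zero_add, add_mul, right_eq_add] at h
      exact absurd h (mul_ne_zero hq0 hw)
    · rw [hi₁, hi₂, if_neg (by decide), if_neg (by decide)] at h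
      exact absurd h.symm hne
  -- the head of `w` is weakly increasing, hence determined by the number `a` of its letters `1`
  let p : ℕ → Prop := fun a => s.1 ≤ a ∨ ∃ h : a < n, w ⟨a, h⟩ = 1
  have hex : ∃ a, p a := ⟨s.1, Or.inl le_rfl⟩
  have ha : Nat.find hex ≤ s.1 := Nat.find_min' hex (Or.inl le_rfl)
  have hbelow : ∀ j : Fin n, (j : ℕ) < Nat.find hex → w j = 0 := by
    intro j hj
    have h := Nat.find_min hex hj
    rcases fin2_cases (w j) with hj' | hj'
    · exact hj'
    · exact absurd (Or.inr ⟨j.2, hj'⟩) h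
  have habove : ∀ d : ℕ, ∀ h : Nat.find hex + d < n, Nat.find hex + d < s.1 →
      w ⟨Nat.find hex + d, h⟩ = 1 := by
    intro d
    induction d with
    | zero =>
      intro h hs
      rcases Nat.find_spec hex with h' | ⟨_, h'⟩
      · omega
      · exact h'
    | succ d ih =>
      intro h hs
      have h1 := ih (by omega) (by omega)
      rcases fin2_cases (w ⟨Nat.find hex + (d + 1), h⟩) with h2 | h2
      · have h3 := hhead ⟨Nat.find hex + d, by omega⟩ (by simp only; omega) h2
        have h4 : w ⟨Nat.find hex + d, by omega⟩ = 0 := h3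
        rw [h1] at h4
        exact absurd h4 (by decide)
      · exact h2
  refine hw ?_
  rw [← h₀ _ ha]
  congr 1
  funext j
  simp only [topWord]
  rcases lt_or_ge (j : ℕ) s.1 with hj | hj
  · rcases lt_or_ge (j : ℕ) (Nat.find hex) with hja | hja
    · rw [if_pos (Or.inl hja), hbelow j hja]
    · obtain ⟨d, hd⟩ := Nat.exists_eq_add_of_le hja
      rw [if_neg (by omega), ← habove d (by omega) (by omega)]
      congr 1
      exact Fin.ext hd
  · have hcases : ((j : ℕ) - s.1) % 2 = 0 ∨ ((j : ℕ) - s.1) % 2 = 1 := by omega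
    have hjn := j.2
    rcases hcases with hc | hc
    · rw [if_pos (Or.inr ⟨hj, hc⟩), ← (htail ⟨j, by omega⟩ (((j : ℕ) - s.1) / 2) (by omega)
        (by simp only; omega)).1]
      rfl
    · rw [if_neg (by omega), ← (htail ⟨j - 1, by omega⟩ (((j : ℕ) - s.1) / 2) (by omega)
        (by simp only; omega)).2]
      congr 1
      exact Fin.ext (by simp only [pos₂]; omega)

end Words

/-! ### The module structure of tensor space -/

section TensorSpace

variable {k : Type u} [Field k] {q : kˣ} {n : ℕ}

instance : IsScalarTower k (TL q n) (TensorSpace q n) where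
  smul_assoc c a x := by
    rw [smul_def, smul_def, map_smul, LinearMap.smul_apply]

instance : Module.Finite k (TensorSpace q n) := Module.Finite.of_basis (wordBasis q n)

theorem finrank_tensorSpace : Module.finrank k (TensorSpace q n) = 2 ^ n := by
  rw [Module.finrank_eq_card_basis (wordBasis q n)]
  simp

/-- The symmetry of `𝒰^q` makes the action on functionals the same as that on coordinates. -/
theorem localMatrix_symm (c d : Fin 2 × Fin 2) : localMatrix q c d = localMatrix q d c := by
  simp only [localMatrix]
  split_ifs <;> simp_all

theorem replace_eq_iff (i : Fin (n - 1)) (c : Fin 2 × Fin 2) (w w' : Fin n → Fin 2) :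
    replace i c.1 c.2 w' = w ↔
      c = (w (pos₁ i), w (pos₂ i)) ∧ ∀ j, j ≠ pos₁ i → j ≠ pos₂ i → w j = w' j := by
  constructor
  · rintro rfl
    refine ⟨Prod.ext ?_ ?_, fun j h₁ h₂ => ?_⟩
    · simp [replace, Function.update_of_ne (pos_ne i)]
    · simp [replace]
    · simp [replace, h₁, h₂]
  · rintro ⟨rfl, h⟩
    funext j
    simp only [replace, Function.update_apply]
    split_ifs with h₁ h₂
    · rw [h₁]
    · rw [h₂]
    · exact (h j h₂ h₁).symm

theorem gen_smul_wordBasis (i : Fin (n - 1)) (w : Fin n → Fin 2) :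
    TL.gen q n i • wordBasis q n w = ∑ c : Fin 2 × Fin 2,
      localMatrix q (w (pos₁ i), w (pos₂ i)) c • wordBasis q n (replace i c.1 c.2 w) := by
  classical
  refine (wordBasis q n).equivFun.injective (funext fun w' => ?_)
  rw [repr_smul, coordRep_gen, coordGen_apply, map_sum, Finset.sum_apply]
  simp only [map_smul, Pi.smul_apply, Module.Basis.equivFun_self, smul_eq_mul, mul_ite, mul_one,
    mul_zero, replace_eq_iff, eq_comm (a := w)]
  have hL : ∀ c, (c = (w' (pos₁ i), w' (pos₂ i)) ∧ ∀ j, j ≠ pos₁ i → j ≠ pos₂ i → w' j = w j) ↔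
    (c = (w' (pos₁ i), w' (pos₂ i)) ∧ ∀ j, j ≠ pos₁ i → j ≠ pos₂ i → w j = w' j) := fun c => by
    simp only [eq_comm]
  simp only [hL, ite_and, Finset.sum_ite_eq', Finset.mem_univ, if_true]
  split_ifs
  · exact localMatrix_symm _ _
  · rfl

variable (k) in
/-- The projection of coordinate space onto the words of excess `s`. -/
def restrictExcess (n : ℕ) (s : ℤ) : Module.End k ((Fin n → Fin 2) → k) where
  toFun f w := if excess w = s then f w else 0
  map_add' f g := funext fun w => by
    simp only [Pi.add_apply]
    split_ifs <;> simp
  map_smul' c f := funext fun w => by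
    simp only [Pi.smul_apply, RingHom.id_apply]
    split_ifs <;> simp

theorem restrictExcess_apply (s : ℤ) (f : (Fin n → Fin 2) → k) (w : Fin n → Fin 2) :
    restrictExcess k n s f w = if excess w = s then f w else 0 := rfl

theorem coordGen_commute_restrictExcess (s : ℤ) (i : Fin (n - 1)) :
    Commute (coordGen q n i) (restrictExcess k n s) := by
  refine LinearMap.ext fun f => funext fun w => ?_
  rw [Module.End.mul_apply, Module.End.mul_apply, restrictExcess_apply, coordGen_expand,
    coordGen_expand]
  rcases fin2_cases (w (pos₁ i)) with h₁ | h₁ <;> rcases fin2_cases (w (pos₂ i)) with h₂ | h₂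
  · simp [h₁, h₂]
  · simp only [h₁, h₂, restrictExcess_apply]
    rw [excess_replace i 0 1 w (by simp [*]) (by simp), excess_replace i 1 0 w (by simp [*])
      (by simp)]
    split_ifs <;> simp_all
  · simp only [h₁, h₂, restrictExcess_apply]
    rw [excess_replace i 0 1 w (by simp [*]) (by simp), excess_replace i 1 0 w (by simp [*])
      (by simp)]
    split_ifs <;> simp_all
  · simp [h₁, h₂]

theorem coordRep_commute_restrictExcess (s : ℤ) (a : TL q n) :
    Commute (coordRep q n a) (restrictExcess k n s) := by
  obtain ⟨a, rfl⟩ := TL.mk_surjective q n a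
  induction a using FreeAlgebra.induction with
  | grade0 r =>
    rw [AlgHom.commutes, AlgHom.commutes]
    exact Algebra.commutes r _
  | grade1 i =>
    have := coordRep_gen q n i
    rw [TL.gen] at this
    rw [this]
    exact coordGen_commute_restrictExcess s i
  | mul a b ha hb =>
    rw [map_mul, map_mul]
    exact ha.mul_left hb
  | add a b ha hb =>
    rw [map_add, map_add]
    exact ha.add_left hb

variable (q n) in
/-- The projection of tensor space onto the permutation module `M(s, n)`. -/
def excessProj (s : ℤ) : TensorSpace q n →ₗ[TL q n] permModule q n s where
  toFun x := ⟨(wordBasis q n).equivFun.symm (restrictExcess k n s ((wordBasis q n).equivFun x)),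
    fun w hw => by
      rw [← Module.Basis.equivFun_apply, LinearEquiv.apply_symm_apply, restrictExcess_apply,
        if_neg hw]⟩
  map_add' x y := Subtype.ext (by
    change (wordBasis q n).equivFun.symm _ =
      (wordBasis q n).equivFun.symm _ + (wordBasis q n).equivFun.symm _
    rw [map_add, map_add, map_add])
  map_smul' a x := Subtype.ext (by
    refine (wordBasis q n).equivFun.injective ?_
    change (wordBasis q n).equivFun ((wordBasis q n).equivFun.symm _) =
      (wordBasis q n).equivFun (a • (wordBasis q n).equivFun.symm _)
    rw [repr_smul, repr_smul, LinearEquiv.apply_symm_apply, LinearEquiv.apply_symm_apply]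
    exact (LinearMap.congr_fun (coordRep_commute_restrictExcess s a) _).symm)

theorem equivFun_excessProj (s : ℤ) (x : TensorSpace q n) :
    (wordBasis q n).equivFun (excessProj q n s x).1 =
      restrictExcess k n s ((wordBasis q n).equivFun x) :=
  LinearEquiv.apply_symm_apply _ _

theorem excessProj_apply_coe (s : ℤ) (x : permModule q n s) : excessProj q n s x.1 = x := by
  refine Subtype.ext ((wordBasis q n).equivFun.injective (funext fun w => ?_))
  rw [equivFun_excessProj, restrictExcess_apply]
  split_ifs with h
  · rfl
  · exact (x.2 w h).symm

theorem excessProj_wordBasis {s : ℤ} {w : Fin n → Fin 2} (h : excess w ≠ s) :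
    excessProj q n s (wordBasis q n w) = 0 := by
  classical
  refine Subtype.ext ((wordBasis q n).equivFun.injective (funext fun w' => ?_))
  rw [equivFun_excessProj, restrictExcess_apply, Module.Basis.equivFun_self]
  split_ifs with h₁ h₂
  · rw [h₂] at h
    exact absurd h₁ h
  · simp
  · simp

theorem permModule_isCompl (s : ℤ) :
    IsCompl (permModule q n s) (LinearMap.ker (excessProj q n s)) := by
  have h := LinearMap.isCompl_of_proj (f := excessProj q n s) (excessProj_apply_coe s)
  exact h

/-- The word whose letters `2` occupy the positions in `S`. -/
def wordOfFinset (S : Finset (Fin n)) : Fin n → Fin 2 := fun j => if j ∈ S then 1 else 0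

theorem wordOfFinset_injective : Function.Injective (wordOfFinset (n := n)) :=
  fun S S' h => Finset.ext fun j => by
    have := congrFun h j
    simp only [wordOfFinset] at this
    split_ifs at this <;> simp_all

theorem excess_wordOfFinset (S : Finset (Fin n)) : excess (wordOfFinset S) = n - 2 * S.card := by
  have h₁ : (Finset.univ.filter fun j => wordOfFinset S j = 1) = S := by
    ext j
    simp [wordOfFinset]
  have h₂ : (Finset.univ.filter fun j => wordOfFinset S j = 0) = Sᶜ := by
    ext j
    simp [wordOfFinset]
  have h₃ := S.card_compl
  have h₄ := S.card_le_univ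
  rw [Fintype.card_fin] at h₃ h₄
  rw [excess, h₁, h₂, h₃]
  omega

theorem wordBasis_mem_permModule (w : Fin n → Fin 2) :
    wordBasis q n w ∈ permModule q n (excess w) := fun w' hw' => by
  rw [Module.Basis.repr_self, Finsupp.single_apply, if_neg]
  rintro rfl
  exact hw' rfl

theorem card_le_finrank_of_basis_mem {ι : Type v} {E : Type w} [AddCommGroup E] [Module k E]
    [Module.Finite k E] (b : Module.Basis ι k E) (P : Submodule k E) (S : Finset ι)
    (h : ∀ i ∈ S, b i ∈ P) : S.card ≤ Module.finrank k P := by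
  have hv : LinearIndependent k fun i : S => b i.1 :=
    b.linearIndependent.comp _ Subtype.val_injective
  have hle : Submodule.span k (Set.range fun i : S => b i.1) ≤ P :=
    Submodule.span_le.2 (Set.range_subset_iff.2 fun i => h i.1 i.2)
  have h' := Submodule.finrank_mono hle
  rwa [finrank_span_eq_card hv, Fintype.card_coe] at h'

theorem choose_le_finrank_permModule (s : Weight n) :
    n.choose s.cups ≤ Module.finrank k (permModule q n s.1) := by
  classical
  have h := card_le_finrank_of_basis_mem (wordBasis q n) ((permModule q n s.1).restrictScalars k)
    ((Finset.powersetCard s.cups Finset.univ).image wordOfFinset) ?_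
  · rw [Finset.card_image_of_injective _ wordOfFinset_injective, Finset.card_powersetCard,
      Finset.card_univ, Fintype.card_fin] at h
    exact h
  · intro w hw
    obtain ⟨S, hS, rfl⟩ := Finset.mem_image.1 hw
    have h₁ := (Finset.mem_powersetCard.1 hS).2
    have h₂ := s.val_add_two_mul_cups
    have h₃ : excess (wordOfFinset S) = s.1 := by rw [excess_wordOfFinset, h₁]; omega
    have h₄ := wordBasis_mem_permModule (q := q) (wordOfFinset S)
    rw [h₃] at h₄
    exact h₄

end TensorSpace

/-! ### The dimension criteria for tensor space and permutation modules -/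

section Counting

variable {n : ℕ}

theorem sum_weight (F : ℕ → ℕ) :
    ∑ s : Weight n, F s.cups = ∑ l ∈ Finset.range (n / 2 + 1), F l := by
  refine Finset.sum_nbij (fun s : Weight n => s.cups) (fun s _ => ?_)
    (fun s _ t _ h => Weight.ext_cups h) (fun l hl => ?_) fun _ _ => rfl
  · have := s.two_mul_cups_le
    exact Finset.mem_range.2 (by omega)
  · have := Finset.mem_range.1 (Finset.mem_coe.1 hl)
    obtain ⟨s, hs⟩ := Weight.exists_cups_eq (n := n) (l := l) (by omega)
    exact ⟨s, Finset.mem_coe.2 (Finset.mem_univ s), hs⟩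

theorem weightedSum_ge (s : Weight n) :
    weightedSum (fun u : Weight n => if s.1 ≤ u.1 then 1 else 0) = n.choose s.cups := by
  have hs := s.two_mul_cups_le
  rw [← sum_ballot (m := n) (by omega), weightedSum]
  have e : ∀ u : Weight n, ballot n u.cups * (if s.1 ≤ u.1 then 1 else 0) =
      (fun l => ballot n l * if l ≤ s.cups then 1 else 0) u.cups := fun u => by
    have h₁ := s.val_add_two_mul_cups
    have h₂ := u.val_add_two_mul_cups
    have h₃ : s.1 ≤ u.1 ↔ u.cups ≤ s.cups := by omega
    simp only [h₃]
  refine (Finset.sum_congr rfl fun u _ => e u).trans ((sum_weight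
    fun l => ballot n l * if l ≤ s.cups then 1 else 0).trans ?_)
  simp only [mul_ite, mul_one, mul_zero]
  rw [← Finset.sum_filter]
  refine Finset.sum_congr ?_ fun _ _ => rfl
  ext l
  simp only [Finset.mem_filter, Finset.mem_range]
  omega

theorem weightedSum_succ : weightedSum (fun u : Weight n => u.1 + 1) = 2 ^ n := by
  have e : ∀ u : Weight n, ballot n u.cups * (u.1 + 1) =
      (fun l => ∑ j ∈ Finset.range (n + 1), if l ≤ j ∧ l + j ≤ n then ballot n l else 0) u.cups := by
    intro u
    have h := u.val_add_two_mul_cups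
    have hf : (Finset.range (n + 1)).filter (fun j => u.cups ≤ j ∧ u.cups + j ≤ n) =
        Finset.Icc u.cups (n - u.cups) := by
      ext j
      simp only [Finset.mem_filter, Finset.mem_range, Finset.mem_Icc]
      omega
    simp only
    rw [← Finset.sum_filter, hf, Finset.sum_const, Nat.card_Icc, smul_eq_mul, mul_comm]
    congr 1
    omega
  refine (Finset.sum_congr rfl fun u _ => e u).trans ((sum_weight fun l =>
    ∑ j ∈ Finset.range (n + 1), if l ≤ j ∧ l + j ≤ n then ballot n l else 0).trans ?_)
  rw [Finset.sum_comm, ← Nat.sum_range_choose]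
  refine Finset.sum_congr rfl fun j hj => ?_
  have hj' := Finset.mem_range.1 hj
  rw [← Finset.sum_filter]
  have hmin : n.choose j = n.choose (min j (n - j)) := by
    rcases min_cases j (n - j) with h | h
    · rw [h.1]
    · rw [h.1, Nat.choose_symm (by omega)]
  rw [hmin, ← sum_ballot (m := n) (by omega)]
  refine Finset.sum_congr ?_ fun _ _ => rfl
  ext l
  simp only [Finset.mem_filter, Finset.mem_range]
  omega

end Counting

section PermutationModules

variable {k : Type u} [Field k] {q : kˣ} {n : ℕ}

/-- Modulo `J_{l+1}` the idempotent `e_l` absorbs, up to the factor `q + q⁻¹`, the generators acting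
on its cups, and it is annihilated by those acting on its through strands; these are the hypotheses
of `eq_zero_of_topWord`. -/
theorem eq_zero_of_mem_costdVectors (hq : (q : k) + (q : k)⁻¹ ≠ 0) (t : Weight n)
    {y : TensorSpace q n} (hy : y ∈ costdVectors q n t.cups (TensorSpace q n))
    (h₀ : ∀ a ≤ t.1, (wordBasis q n).equivFun y (topWord t a) = 0) : y = 0 := by
  have hn := t.val_add_two_mul_cups
  have hgen : ∀ i : Fin (n - 1), coordGen q n i ((wordBasis q n).equivFun y) =
      (wordBasis q n).equivFun (TL.W q n (n - (i + 1)) • heredityIdem q n t.cups • y) := fun i => by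
    rw [hy.1, ← TL.gen_eq_W, repr_smul, coordRep_gen]
  refine (wordBasis q n).equivFun.map_eq_zero_iff.1
    (eq_zero_of_topWord t (fun i hi => ?_) (fun i r hr hi => ?_) h₀ hq)
  · rw [hgen, ← mul_smul, hy.2 _ (W_mul_heredityIdem_mem hq (by omega)), map_zero]
  · have hi' : n - ((i : ℕ) + 1) = 2 * (t.cups - r - 1) + 1 := by omega
    rw [hgen, hi', ← mul_smul, W_mul_heredityIdem (by omega), smul_assoc, hy.1, map_smul]

theorem eq_zero_of_mem_stdFunctionals (hq : (q : k) + (q : k)⁻¹ ≠ 0) (t : Weight n)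
    {φ : TensorSpace q n →ₗ[k] k} (hφ : φ ∈ stdFunctionals q n t.cups (TensorSpace q n))
    (h₀ : ∀ a ≤ t.1, φ (wordBasis q n (topWord t a)) = 0) : φ = 0 := by
  have hn := t.val_add_two_mul_cups
  have hgen : ∀ i : Fin (n - 1), coordGen q n i (fun w => φ (wordBasis q n w)) =
      fun w => φ ((heredityIdem q n t.cups * TL.W q n (n - (i + 1))) • wordBasis q n w) :=
    fun i => funext fun w => by
      rw [mul_smul, hφ.1, ← TL.gen_eq_W, gen_smul_wordBasis, map_sum, coordGen_apply]
      simp only [map_smul, smul_eq_mul]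
  have hzero : (fun w => φ (wordBasis q n w)) = 0 := by
    refine eq_zero_of_topWord t (fun i hi => ?_) (fun i r hr hi => ?_) h₀ hq
    · rw [hgen]
      exact funext fun w => hφ.2 _ (heredityIdem_mul_W_mem hq (by omega)) _
    · have hi' : n - ((i : ℕ) + 1) = 2 * (t.cups - r - 1) + 1 := by omega
      rw [hgen, hi', heredityIdem_mul_W (by omega)]
      refine funext fun w => ?_
      rw [smul_assoc, map_smul, hφ.1]
      rfl
  exact (wordBasis q n).ext fun w => congrFun hzero w

theorem costdDim_tensorSpace_le (hq : (q : k) + (q : k)⁻¹ ≠ 0) (t : Weight n) :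
    costdDim q n (TensorSpace q n) t ≤ t.1 + 1 := by
  let F : costdVectors q n t.cups (TensorSpace q n) →ₗ[k] (Fin (t.1 + 1) → k) :=
    { toFun y a := (wordBasis q n).equivFun y.1 (topWord t a)
      map_add' y z := by
        funext a
        simp
      map_smul' c y := by
        funext a
        simp }
  have hF : Function.Injective F := (injective_iff_map_eq_zero F).2 fun y hy =>
    Subtype.ext (eq_zero_of_mem_costdVectors hq t y.2 fun a ha =>
      congrFun hy ⟨a, Nat.lt_succ_of_le ha⟩)
  have h := LinearMap.finrank_le_finrank_of_injective hF
  rwa [Module.finrank_fin_fun] at h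

theorem stdDim_tensorSpace_le (hq : (q : k) + (q : k)⁻¹ ≠ 0) (t : Weight n) :
    stdDim q n (TensorSpace q n) t ≤ t.1 + 1 := by
  let F : stdFunctionals q n t.cups (TensorSpace q n) →ₗ[k] (Fin (t.1 + 1) → k) :=
    { toFun φ a := φ.1 (wordBasis q n (topWord t a))
      map_add' _ _ := rfl
      map_smul' _ _ := rfl }
  have hF : Function.Injective F := (injective_iff_map_eq_zero F).2 fun φ hφ =>
    Subtype.ext (eq_zero_of_mem_stdFunctionals hq t φ.2 fun a ha =>
      congrFun hφ ⟨a, Nat.lt_succ_of_le ha⟩)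
  have h := LinearMap.finrank_le_finrank_of_injective hF
  rwa [Module.finrank_fin_fun] at h

theorem excess_topWord_ne {s t : Weight n} {a : ℕ} (ha : a ≤ t.1)
    (h : s.1 ≤ t.1 → a ≠ (s.1 + t.1) / 2) : excess (topWord t a) ≠ s.1 := by
  rw [excess_topWord t ha]
  have hs := s.2.2
  have ht := t.2.2
  omega

/-- Only one of the words `topWord t a` has excess `s`, and none if `t < s`. -/
theorem costdDim_permModule_le (hq : (q : k) + (q : k)⁻¹ ≠ 0) (s t : Weight n) :
    costdDim q n (permModule q n s.1) t ≤ if s.1 ≤ t.1 then 1 else 0 := by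
  have key : ∀ y : costdVectors q n t.cups (permModule q n s.1),
      (s.1 ≤ t.1 → (wordBasis q n).equivFun y.1.1 (topWord t ((s.1 + t.1) / 2)) = 0) → y = 0 := by
    intro y hy
    refine Subtype.ext (Subtype.ext (eq_zero_of_mem_costdVectors hq t
      (costdPush t.cups (permModule q n s.1).subtype y).2 fun a ha => ?_))
    by_cases h : s.1 ≤ t.1 ∧ a = (s.1 + t.1) / 2
    · rw [h.2]
      exact hy h.1
    · exact y.1.2 _ (excess_topWord_ne ha fun h₁ h₂ => h ⟨h₁, h₂⟩)
  split_ifs with hst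
  · let F : costdVectors q n t.cups (permModule q n s.1) →ₗ[k] k :=
      { toFun y := (wordBasis q n).equivFun y.1.1 (topWord t ((s.1 + t.1) / 2))
        map_add' y z := by simp
        map_smul' c y := congrFun
          (map_smul (wordBasis q n).equivFun c y.1.1) (topWord t ((s.1 + t.1) / 2)) }
    have hF : Function.Injective F :=
      (injective_iff_map_eq_zero F).2 fun y hy => key y fun _ => hy
    have h := LinearMap.finrank_le_finrank_of_injective hF
    rwa [Module.finrank_self] at h
  · have hsub : Subsingleton (costdVectors q n t.cups (permModule q n s.1)) :=
      subsingleton_of_forall_eq 0 fun y => key y fun h => absurd h hst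
    exact (Module.finrank_zero_of_subsingleton (R := k)).le

theorem stdDim_permModule_le (hq : (q : k) + (q : k)⁻¹ ≠ 0) (s t : Weight n) :
    stdDim q n (permModule q n s.1) t ≤ if s.1 ≤ t.1 then 1 else 0 := by
  have hsurj : Function.Surjective (excessProj q n s.1) :=
    fun y => ⟨y.1, excessProj_apply_coe _ y⟩
  have key : ∀ φ : stdFunctionals q n t.cups (permModule q n s.1),
      (s.1 ≤ t.1 →
        φ.1 (excessProj q n s.1 (wordBasis q n (topWord t ((s.1 + t.1) / 2)))) = 0) →
      φ = 0 := by
    intro φ hφ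
    refine stdPullback_injective t.cups hsurj (Eq.trans (Subtype.ext
      (eq_zero_of_mem_stdFunctionals hq t (stdPullback t.cups (excessProj q n s.1) φ).2
        fun a ha => ?_)) (map_zero _).symm)
    rw [stdPullback_apply]
    by_cases h : s.1 ≤ t.1 ∧ a = (s.1 + t.1) / 2
    · rw [h.2]
      exact hφ h.1
    · rw [excessProj_wordBasis (excess_topWord_ne ha fun h₁ h₂ => h ⟨h₁, h₂⟩), map_zero]
  split_ifs with hst
  · let F : stdFunctionals q n t.cups (permModule q n s.1) →ₗ[k] k :=
      { toFun φ := φ.1 (excessProj q n s.1 (wordBasis q n (topWord t ((s.1 + t.1) / 2))))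
        map_add' _ _ := rfl
        map_smul' _ _ := rfl }
    have hF : Function.Injective F :=
      (injective_iff_map_eq_zero F).2 fun φ hφ => key φ fun _ => hφ
    have h := LinearMap.finrank_le_finrank_of_injective hF
    rwa [Module.finrank_self] at h
  · have hsub : Subsingleton (stdFunctionals q n t.cups (permModule q n s.1)) :=
      subsingleton_of_forall_eq 0 fun φ => key φ fun h => absurd h hst
    exact (Module.finrank_zero_of_subsingleton (R := k)).le

theorem isStdGood_tensorSpace (hq : (q : k) + (q : k)⁻¹ ≠ 0) :
    IsStdGood q n (TensorSpace q n) := by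
  rw [IsStdGood, finrank_tensorSpace, ← weightedSum_succ]
  exact weightedSum_mono fun t => stdDim_tensorSpace_le hq t

theorem isCostdGood_tensorSpace (hq : (q : k) + (q : k)⁻¹ ≠ 0) :
    IsCostdGood q n (TensorSpace q n) := by
  rw [IsCostdGood, finrank_tensorSpace, ← weightedSum_succ]
  exact weightedSum_mono fun t => costdDim_tensorSpace_le hq t

instance (s : ℤ) : Module.Finite k (permModule q n s) := finite_submodule _

theorem stdDim_permModule (hq : (q : k) + (q : k)⁻¹ ≠ 0) (s : Weight n) :
    stdDim q n (permModule q n s.1) = fun t => if s.1 ≤ t.1 then 1 else 0 := by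
  refine eq_of_le_of_weightedSum_le (fun t => stdDim_permModule_le hq s t) ?_
  rw [weightedSum_ge]
  exact (choose_le_finrank_permModule s).trans (finrank_le_weightedSum_stdDim _ hq)

theorem isStdGood_permModule (hq : (q : k) + (q : k)⁻¹ ≠ 0) (s : Weight n) :
    IsStdGood q n (permModule q n s.1) := by
  rw [IsStdGood, stdDim_permModule hq, weightedSum_ge]
  exact choose_le_finrank_permModule s

theorem isCostdGood_permModule (hq : (q : k) + (q : k)⁻¹ ≠ 0) (s : Weight n) :
    IsCostdGood q n (permModule q n s.1) := by
  refine (weightedSum_mono fun t => costdDim_permModule_le hq s t).trans ?_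
  rw [weightedSum_ge]
  exact choose_le_finrank_permModule s

end PermutationModules

/-! ### Multiplicities in standard filtrations -/

section Multiplicities

variable {k : Type u} [Field k] {q : kˣ} {n : ℕ}

variable {M : Type v} [AddCommGroup M] [Module (TL q n) M] [Module k M]
  [IsScalarTower k (TL q n) M]

/-- The least weight `s = n - 2 l` with `Hom(M, ∇(s)) ≠ 0` is the one for which `l` is maximal with
`e_l M ≠ 0`. -/
theorem exists_top_of_stdDim [Module.Finite k M] (hq : (q : k) + (q : k)⁻¹ ≠ 0) {s : Weight n}
    (hs : stdDim q n M s ≠ 0) (hmin : ∀ u, stdDim q n M u ≠ 0 → s.1 ≤ u.1) :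
    (∀ x : M, heredityIdem q n (s.cups + 1) • x = 0) ∧
      ∃ x : M, x ≠ 0 ∧ heredityIdem q n s.cups • x = x := by
  have hnt : Nontrivial M := by
    by_contra h
    rw [not_nontrivial_iff_subsingleton] at h
    refine hs ?_
    have hsub : Subsingleton (stdFunctionals q n s.cups M) :=
      ⟨fun φ ψ => Subtype.ext (LinearMap.ext fun x => by
        rw [Subsingleton.elim x 0, map_zero, map_zero])⟩
    exact Module.finrank_zero_of_subsingleton
  obtain ⟨t, h, x, hx, hex⟩ := exists_top_weight (n := n) hq M
  have hlt := stdDim_lt_of_surjective hq h (Submodule.mkQ_surjective (Submodule.span (TL q n) {x}))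
    hx hex ((Submodule.Quotient.mk_eq_zero _).2 (Submodule.mem_span_singleton_self x))
  have hst := hmin t (by omega)
  rcases eq_or_ne s t with rfl | hne
  · exact ⟨h, x, hx, hex⟩
  refine absurd ?_ hs
  have hcups : t.cups + 1 ≤ s.cups := by
    have h₁ := s.val_add_two_mul_cups
    have h₂ := t.val_add_two_mul_cups
    have h₃ : s.1 ≠ t.1 := fun h => hne (Subtype.ext h)
    omega
  have hsub : Subsingleton (stdFunctionals q n s.cups M) := by
    refine subsingleton_of_forall_eq 0 fun φ => Subtype.ext (LinearMap.ext fun y => ?_)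
    rw [← φ.2.1, smul_eq_zero_of_heredityIdem h
      (heredityIdeal_antitone hq hcups (heredityIdem_mem s.cups)), map_zero]
    rfl
  exact Module.finrank_zero_of_subsingleton

theorem permModule_top (hq : (q : k) + (q : k)⁻¹ ≠ 0) (s : Weight n) :
    (∀ x : permModule q n s.1, heredityIdem q n (s.cups + 1) • x = 0) ∧
      ∃ x : permModule q n s.1, x ≠ 0 ∧ heredityIdem q n s.cups • x = x := by
  refine exists_top_of_stdDim hq ?_ fun u hu => ?_
  · simp [stdDim_permModule hq]
  · by_contra h
    simp [stdDim_permModule hq, h] at hu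

/-- The spanning set that bounds the dimension of `Δ(s)` is a basis, because `M(s, n)` contains a
copy of `Δ(s)` of the full dimension; this copy also bounds `Hom(Δ(s), ∇(s))`. -/
theorem finrank_standard_and_stdDim (hq : (q : k) + (q : k)⁻¹ ≠ 0) (s : Weight n) :
    Module.finrank k (Standard q n s) = ballot n s.cups ∧
      stdDim q n (Standard q n s) ≤ Pi.single s 1 := by
  obtain ⟨h, x, hx, hex⟩ := permModule_top hq s
  obtain ⟨⟨f⟩, -, hrank, -⟩ := (isStdGood_permModule hq s).top_step hq h hx hex
  have hfin := (finite_finrank_standard hq s).1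
  have hfin' := finite_submodule (k := k) (Submodule.span (TL q n) {x})
  refine ⟨by rw [← hrank, (f.restrictScalars k).finrank_eq], fun t => ?_⟩
  rcases eq_or_ne t s with rfl | hts
  · rw [Pi.single_eq_same, ← stdDim_congr f]
    refine (stdDim_submodule_le_of_top hq h _).trans ?_
    simp [stdDim_permModule hq]
  · rw [stdDim_standard_of_ne hq hts]
    exact Nat.zero_le _

theorem HasStandardFiltration.finite_and_finrank (hq : (q : k) + (q : k)⁻¹ ≠ 0)
    {m : Weight n → ℕ} (h : HasStandardFiltration q n M m) :
    Module.Finite k M ∧ Module.finrank k M = weightedSum m ∧ stdDim q n M ≤ m := by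
  have key := HasFiltration.induction (A := TL q n) (D := fun s : Weight n => Standard q n s)
    (P := fun (M : Type v) [AddCommGroup M] [Module (TL q n) M] m =>
      ∀ [Module k M] [IsScalarTower k (TL q n) M],
        Module.Finite k M ∧ Module.finrank k M = weightedSum m ∧ stdDim q n M ≤ m) ?_ ?_ h
  · exact key
  · intro M _ _ hM _ _
    have hfin : Module.Finite k M := inferInstance
    refine ⟨hfin, ?_, fun t => ?_⟩
    · rw [Module.finrank_zero_of_subsingleton]
      simp [weightedSum]
    · have hsub : Subsingleton (stdFunctionals q n t.cups M) :=
        ⟨fun φ ψ => Subtype.ext (LinearMap.ext fun x => by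
          rw [Subsingleton.elim x 0, map_zero, map_zero])⟩
      exact (Module.finrank_zero_of_subsingleton (R := k)).le
  · intro M _ _ K m s ih ⟨f⟩ _ _
    obtain ⟨hK, hrank, hdim⟩ := ih
    have hS := (finite_finrank_standard hq s).1
    have hS' := finrank_standard_and_stdDim hq s
    have hQ : Module.Finite k (M ⧸ K) := Module.Finite.equiv (f.symm.restrictScalars k)
    have hM : Module.Finite k M := by
      have h₁ : Module.Finite k (K.restrictScalars k) := hK
      have h₂ : Module.Finite k (M ⧸ K.restrictScalars k) :=
        Module.Finite.equiv (Submodule.Quotient.restrictScalarsEquiv k K).symm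
      exact Module.Finite.of_submodule_quotient (K.restrictScalars k)
    refine ⟨hM, ?_, ?_⟩
    · rw [← finrank_quotient_add_finrank' K, (f.restrictScalars k).finrank_eq, hS'.1, hrank,
        weightedSum_add, weightedSum_single, add_comm]
    · refine (stdDim_le_add (f := K.subtype) K.mkQ_surjective ?_).trans (add_le_add hdim ?_)
      · rw [Submodule.ker_mkQ, Submodule.range_subtype]
      · rw [stdDim_congr f]
        exact hS'.2

/-- The multiplicities in a standard filtration are determined by the module. -/
theorem HasStandardFiltration.stdDim_eq (hq : (q : k) + (q : k)⁻¹ ≠ 0)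
    {m : Weight n → ℕ} (h : HasStandardFiltration q n M m) : stdDim q n M = m := by
  obtain ⟨hfin, hrank, hdim⟩ := h.finite_and_finrank hq
  exact eq_of_le_of_weightedSum_le hdim (hrank ▸ finrank_le_weightedSum_stdDim M hq)

theorem HasStandardFiltration.isStdGood (hq : (q : k) + (q : k)⁻¹ ≠ 0)
    {m : Weight n → ℕ} (h : HasStandardFiltration q n M m) : IsStdGood q n M := by
  rw [IsStdGood, h.stdDim_eq hq, (h.finite_and_finrank hq).2.1]

theorem IsStdGood.hasStandardFiltration_stdDim [Module.Finite k M]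
    (hq : (q : k) + (q : k)⁻¹ ≠ 0) (h : IsStdGood q n M) :
    HasStandardFiltration q n M (stdDim q n M) := by
  obtain ⟨m, hm⟩ := h.hasStandardFiltration hq
  rwa [hm.stdDim_eq hq]

end Multiplicities

/-! ### Indecomposable tilting modules as summands of permutation modules -/

section Summands

variable {A : Type u} [Ring A] {M : Type w} [AddCommGroup M] [Module A M]

/-- A decomposition of a summand refines a decomposition of the whole module. -/
theorem isCompl_map_subtype {P Q : Submodule A M} (h : IsCompl P Q) {B C : Submodule A P}
    (hBC : IsCompl B C) : IsCompl (B.map P.subtype) (C.map P.subtype ⊔ Q) := by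
  refine ⟨?_, ?_⟩
  · rw [Submodule.disjoint_def]
    rintro _ ⟨b, hb, rfl⟩ hx
    obtain ⟨_, ⟨c, hc, rfl⟩, z, hz, hcz⟩ := Submodule.mem_sup.1 hx
    have hzP : z ∈ P := by
      rw [← sub_eq_iff_eq_add'.2 hcz.symm]
      exact P.sub_mem b.2 c.2
    have hz0 := Submodule.disjoint_def.1 h.1 z hzP hz
    rw [hz0, add_zero] at hcz
    have hcb : c = b := Subtype.ext hcz
    rw [hcb] at hc
    rw [Submodule.disjoint_def.1 hBC.1 b hb hc, map_zero]
  · rw [codisjoint_iff, ← sup_assoc, ← Submodule.map_sup, hBC.sup_eq_top, Submodule.map_top,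
      Submodule.range_subtype, h.sup_eq_top]

theorem IsSummand.of_isCompl {X : Type v} [AddCommGroup X] [Module A X] {P Q : Submodule A M}
    (h : IsCompl P Q) (hX : IsSummand A X P) : IsSummand A X M := by
  obtain ⟨B, C, hBC, ⟨f⟩⟩ := hX
  exact ⟨_, _, isCompl_map_subtype h hBC,
    ⟨f.trans (Submodule.equivMapOfInjective P.subtype P.injective_subtype B)⟩⟩

theorem IsIndecomposable.equiv_of_isSummand {X : Type v} [AddCommGroup X] [Module A X]
    [Nontrivial X] (hM : IsIndecomposable A M) (hX : IsSummand A X M) : Nonempty (X ≃ₗ[A] M) := by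
  obtain ⟨P, Q, hPQ, ⟨f⟩⟩ := hX
  rcases hM.2 P Q hPQ with rfl | rfl
  · exact absurd f.toEquiv.subsingleton (not_subsingleton X)
  · exact ⟨f.trans (LinearEquiv.ofTop P (by simpa using hPQ.sup_eq_top))⟩

end Summands

section TiltingModules

variable {k : Type u} [Field k] {q : kˣ} {n : ℕ}

/-- A summand of least dimension among those meeting `e_l M`. -/
theorem exists_minimal_summand {M : Type v} [AddCommGroup M] [Module (TL q n) M] [Module k M]
    [IsScalarTower k (TL q n) M] [Module.Finite k M] {l : ℕ} {x : M} (hx : x ≠ 0)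
    (hex : heredityIdem q n l • x = x) :
    ∃ P Q : Submodule (TL q n) M, IsCompl P Q ∧ IsIndecomposable (TL q n) P ∧
      ∃ y : P, y ≠ 0 ∧ heredityIdem q n l • y = y := by
  classical
  let p : ℕ → Prop := fun d => ∃ P Q : Submodule (TL q n) M, IsCompl P Q ∧
    Module.finrank k P = d ∧ ∃ y ∈ P, y ≠ 0 ∧ heredityIdem q n l • y = y
  have hp : ∃ d, p d := ⟨_, ⊤, ⊥, isCompl_top_bot, rfl, x, trivial, hx, hex⟩
  obtain ⟨P, Q, hPQ, hd, y, hyP, hy, hey⟩ := Nat.find_spec hp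
  have hfin := finite_submodule (k := k) P
  -- a summand of `P` meeting `e_l M` has the dimension of `P`, so its complement vanishes
  have hstep : ∀ B C : Submodule (TL q n) P, IsCompl B C →
      (∃ z ∈ B, z ≠ 0 ∧ heredityIdem q n l • z = z) → C = ⊥ := by
    rintro B C hBC ⟨z, hzB, hz, hez⟩
    have hfinB := finite_submodule (k := k) B
    have hfinC := finite_submodule (k := k) C
    have hmin : Nat.find hp ≤ Module.finrank k (B.map P.subtype) :=
      Nat.find_min' hp ⟨_, _, isCompl_map_subtype hPQ hBC, rfl, z.1, ⟨z, hzB, rfl⟩,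
        fun h => hz (Subtype.ext h), congrArg Subtype.val hez⟩
    have he : Module.finrank k (B.map P.subtype) = Module.finrank k B :=
      ((Submodule.equivMapOfInjective P.subtype P.injective_subtype B).restrictScalars
        k).finrank_eq.symm
    have hq := finrank_quotient_add_finrank' (k := k) B
    have hq' : Module.finrank k (P ⧸ B) = Module.finrank k C :=
      ((Submodule.quotientEquivOfIsCompl B C hBC).restrictScalars k).finrank_eq
    have h0 : Module.finrank k C = 0 := by omega
    have hsub : Subsingleton C := Module.finrank_zero_iff.1 h0
    exact (Submodule.subsingleton_iff_eq_bot).1 hsub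
  refine ⟨P, Q, hPQ, ⟨⟨⟨y, hyP⟩, 0, fun h => hy (congrArg Subtype.val h)⟩, fun B C hBC => ?_⟩,
    ⟨y, hyP⟩, fun h => hy (congrArg Subtype.val h), Subtype.ext hey⟩
  obtain ⟨b, hb, c, hc, hbc⟩ := Submodule.mem_sup.1
    (hBC.sup_eq_top ▸ Submodule.mem_top : (⟨y, hyP⟩ : P) ∈ B ⊔ C)
  have hebc : (heredityIdem q n l • b - b) = -(heredityIdem q n l • c - c) := by
    have h : heredityIdem q n l • (⟨y, hyP⟩ : P) = ⟨y, hyP⟩ := Subtype.ext hey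
    rw [← hbc, smul_add] at h
    rw [neg_sub, sub_eq_sub_iff_add_eq_add, h, add_comm]
  have heb : heredityIdem q n l • b - b = 0 :=
    Submodule.disjoint_def.1 hBC.1 _ (B.sub_mem (B.smul_mem _ hb) hb)
      (hebc ▸ C.neg_mem (C.sub_mem (C.smul_mem _ hc) hc))
  have hec : heredityIdem q n l • c - c = 0 := by
    rw [heb] at hebc
    exact neg_eq_zero.1 hebc.symm
  by_cases hb0 : b = 0
  · left
    refine hstep C B hBC.symm ⟨c, hc, fun hc0 => hy ?_, sub_eq_zero.1 hec⟩
    rw [hb0, hc0, add_zero] at hbc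
    exact (congrArg Subtype.val hbc).symm
  · right
    exact hstep B C hBC ⟨b, hb, hb0, sub_eq_zero.1 heb⟩

theorem isTilting_of_isCompl {M : Type v} [AddCommGroup M] [Module (TL q n) M] [Module k M]
    [IsScalarTower k (TL q n) M] [Module.Finite k M] (hq : (q : k) + (q : k)⁻¹ ≠ 0)
    (hs : IsStdGood q n M) (hc : IsCostdGood q n M) {P Q : Submodule (TL q n) M}
    (h : IsCompl P Q) : IsTilting q n P := by
  have hfin := finite_submodule (k := k) P
  exact ⟨(hs.of_isCompl hq h).hasStandardFiltration hq,
    (hc.of_isCompl hq h).hasCostandardFiltration hq⟩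

/-- The tilting module `M(s, n)` contains every indecomposable tilting module of top weight `s`. -/
theorem isSummand_permModule (hq : (q : k) + (q : k)⁻¹ ≠ 0) {s : Weight n} {X : Type v}
    [AddCommGroup X] [Module (TL q n) X] (hind : IsIndecomposable (TL q n) X)
    (hX : IsTilting q n X) (h : ∀ x : X, heredityIdem q n (s.cups + 1) • x = 0)
    {x : X} (hx : x ≠ 0) (hex : heredityIdem q n s.cups • x = x)
    {P Q : Submodule (TL q n) (permModule q n s.1)} (hPQ : IsCompl P Q) {y : P} (hy : y ≠ 0)
    (hey : heredityIdem q n s.cups • y = y) : IsSummand (TL q n) X P := by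
  let _ : Module k X := Module.compHom X (algebraMap k (TL q n))
  have : IsScalarTower k (TL q n) X := ⟨fun c a z => by
    rw [Algebra.smul_def, mul_smul]
    rfl⟩
  obtain ⟨⟨m, hm⟩, m', hm'⟩ := hX
  have hfin := (hm.finite_and_finrank hq).1
  have hfin' := finite_submodule (k := k) P
  obtain ⟨m'', hm''⟩ := ((isCostdGood_permModule hq s).of_isCompl hq hPQ).hasCostandardFiltration hq
  exact hind.isSummand_of_top hq (hm.isStdGood hq) hm'
    ((isStdGood_permModule hq s).of_isCompl hq hPQ) hm'' h
    (fun z => Subtype.ext ((permModule_top hq s).1 z.1)) hx hex hy hey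

/-- The top weight of the module `T_n(s)` is `s`. -/
theorem IsIndecTiltingOfWeight.top (hq : (q : k) + (q : k)⁻¹ ≠ 0) {s : Weight n} {X : Type v}
    [AddCommGroup X] [Module (TL q n) X] (hX : IsIndecTiltingOfWeight q n s X) :
    (∀ x : X, heredityIdem q n (s.cups + 1) • x = 0) ∧
      ∃ x : X, x ≠ 0 ∧ heredityIdem q n s.cups • x = x := by
  let _ : Module k X := Module.compHom X (algebraMap k (TL q n))
  have : IsScalarTower k (TL q n) X := ⟨fun c a z => by
    rw [Algebra.smul_def, mul_smul]
    rfl⟩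
  obtain ⟨-, -, m, hm, hms, hmin⟩ := hX
  have hfin := (hm.finite_and_finrank hq).1
  rw [← hm.stdDim_eq hq] at hms hmin
  exact exists_top_of_stdDim hq (by omega) hmin

/-- The vectors of `e_l M(s, n)`, for `s = n - 2 l`, form a line. -/
theorem exists_smul_eq_of_top (hq : (q : k) + (q : k)⁻¹ ≠ 0) {s : Weight n}
    {x y : permModule q n s.1} (hx : x ≠ 0) (hex : heredityIdem q n s.cups • x = x)
    (hey : heredityIdem q n s.cups • y = y) : ∃ c : k, c • x = y := by
  have h := (permModule_top hq s).1
  have hmem : ∀ z : permModule q n s.1, heredityIdem q n s.cups • z = z →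
      z ∈ costdVectors q n s.cups (permModule q n s.1) :=
    fun z hz => ⟨hz, fun a ha => smul_eq_zero_of_heredityIdem h ha z⟩
  have hle : Module.finrank k (costdVectors q n s.cups (permModule q n s.1)) ≤ 1 := by
    have := costdDim_permModule_le hq s s
    rwa [if_pos le_rfl] at this
  obtain ⟨v, hv⟩ := finrank_le_one_iff.1 hle
  obtain ⟨a, ha⟩ := hv ⟨x, hmem x hex⟩
  obtain ⟨b, hb⟩ := hv ⟨y, hmem y hey⟩
  have hax : a • v.1 = x := congrArg Subtype.val ha
  have hby : b • v.1 = y := congrArg Subtype.val hb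
  have ha0 : a ≠ 0 := fun h0 => hx (by rw [← hax, h0, zero_smul])
  exact ⟨b * a⁻¹, by rw [← hax, ← hby, smul_smul, inv_mul_cancel_right₀ ha0]⟩

theorem isIndecTiltingOfWeight_of_isCompl (hq : (q : k) + (q : k)⁻¹ ≠ 0) {s : Weight n}
    {P Q : Submodule (TL q n) (permModule q n s.1)} (hPQ : IsCompl P Q)
    (hP : IsIndecomposable (TL q n) P) {y : P} (hy : y ≠ 0)
    (hey : heredityIdem q n s.cups • y = y) : IsIndecTiltingOfWeight q n s P := by
  have hfin := finite_submodule (k := k) P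
  have hgood := (isStdGood_permModule hq s).of_isCompl hq hPQ
  have hle : stdDim q n P ≤ fun u => if s.1 ≤ u.1 then 1 else 0 := by
    rw [← stdDim_permModule hq]
    exact stdDim_le_of_surjective (f := P.projectionOnto Q hPQ)
      (LinearMap.range_eq_top.1 (Submodule.range_projectionOnto hPQ))
  refine ⟨hP, isTilting_of_isCompl hq (isStdGood_permModule hq s) (isCostdGood_permModule hq s) hPQ,
    _, hgood.hasStandardFiltration_stdDim hq, le_antisymm (by simpa using hle s) ?_, fun u hu => ?_⟩
  · have h := stdDim_lt_of_surjective hq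
      (fun z : P => Subtype.ext ((permModule_top hq s).1 z.1))
      (Submodule.mkQ_surjective (Submodule.span (TL q n) {y}))
      hy hey ((Submodule.Quotient.mk_eq_zero _).2 (Submodule.mem_span_singleton_self y))
    omega
  · by_contra h
    have := hle u
    simp only [h, if_false] at this
    omega

end TiltingModules

end TLTilting

end

theorem mainTheorem5 {k : Type u} [Field k] (q : kˣ) (hq : (q : k) + (q : k)⁻¹ ≠ 0)
    (n : ℕ) :
    IsFullTilting.{u, v, u} q n (TensorSpace q n) ∧
    ∀ s : Weight n,
      IsTilting q n (permModule q n s.1) ∧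
      (∀ m : Weight n → ℕ, HasStandardFiltration q n (permModule q n s.1) m ↔
        m = fun u => if s.1 ≤ u.1 then 1 else 0) ∧
      ∃ T : Submodule (TL q n) (permModule q n s.1),
        IsIndecTiltingOfWeight q n s T ∧
        (∀ (X : Type v) [AddCommGroup X] [Module (TL q n) X],
          IsIndecTiltingOfWeight q n s X → Nonempty (X ≃ₗ[TL q n] T)) ∧
        OccursExactlyOnce (TL q n) T (permModule q n s.1) := by
  refine ⟨⟨⟨(isStdGood_tensorSpace hq).hasStandardFiltration hq,
    (isCostdGood_tensorSpace hq).hasCostandardFiltration hq⟩, fun X _ _ hind hX => ?_⟩,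
    fun s => ⟨⟨(isStdGood_permModule hq s).hasStandardFiltration hq,
      (isCostdGood_permModule hq s).hasCostandardFiltration hq⟩, fun m => ⟨fun hm => ?_, ?_⟩, ?_⟩⟩
  · have := hind.1
    obtain ⟨s, h, x, hx, hex⟩ := exists_top_weight (n := n) hq X
    obtain ⟨-, y, hy, hey⟩ := permModule_top hq s
    refine IsSummand.of_isCompl (permModule_isCompl s.1)
      (IsSummand.of_isCompl (isCompl_top_bot (α := Submodule (TL q n) (permModule q n s.1))) ?_)
    exact isSummand_permModule hq hind hX h hx hex isCompl_top_bot (y := ⟨y, trivial⟩)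
      (fun h0 => hy (congrArg Subtype.val h0)) (Subtype.ext hey)
  · rw [← hm.stdDim_eq hq, stdDim_permModule hq]
  · rintro rfl
    rw [← stdDim_permModule hq]
    exact (isStdGood_permModule hq s).hasStandardFiltration_stdDim hq
  · obtain ⟨-, x, hx, hex⟩ := permModule_top hq s
    obtain ⟨T, Q, hTQ, hind, y, hy, hey⟩ := exists_minimal_summand (k := k) hx hex
    have hT := isIndecTiltingOfWeight_of_isCompl hq hTQ hind hy hey
    refine ⟨T, hT, fun X _ _ hX => ?_, T, Q, hTQ, ⟨LinearEquiv.refl _ _⟩, ?_⟩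
    · obtain ⟨h, z, hz, hez⟩ := hX.top hq
      have := hX.1.1
      exact hind.equiv_of_isSummand
        (isSummand_permModule hq hX.1 hX.2.1 h hz hez hTQ hy hey)
    · -- a second copy of `T` would meet the line `e_l M(s, n)`, which lies in `T`
      rintro ⟨B, C, -, ⟨f⟩⟩
      have hfy : heredityIdem q n s.cups • (f y).1.1 = (f y).1.1 :=
        congrArg (fun z : B => z.1.1) ((map_smul f _ y).symm.trans (congrArg f hey))
      obtain ⟨c, hc⟩ := exists_smul_eq_of_top hq (fun h0 => hy (Subtype.ext h0))
        (congrArg Subtype.val hey : heredityIdem q n s.cups • y.1 = y.1) hfy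
      have hmem : (f y).1.1 ∈ T := by
        rw [← hc, ← algebraMap_smul (TL q n) c]
        exact T.smul_mem _ y.2
      have h0 := Submodule.disjoint_def.1 hTQ.1 _ hmem (f y).1.2
      exact hy (f.map_eq_zero_iff.1 (Subtype.ext (Subtype.ext h0)))
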